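/- Let $\Bbbk$ be an algebraically closed field of characteristic $0$, let $n\ge 3$ be odd and let $q\in\Bbbk$ be a primitive $n$-th root of unity. Let $u_q(\mathfrak{sl}_2)$ be the Hopf algebra generated by $K,E,F$ with relations \[ K^n=1,\quad E^n=F^n=0,\quad KE=q^2EK,\quad KF=q^{-2}FK,\quad EF-FE=\frac{K-K^{-1}}{q-q^{-1}}, \] and with $\Delta(K)=K\otimes K$, $\Delta(E)=1\otimes E+E\otimes K$, $\Delta(F)=K^{-1}\otimes F+F\otimes 1$, $\varepsilon(K)=1$, $\varepsilon(E)=\varepsilon(F)=0$. For a finite-dimensional Hopf algebra $H$ with antipode $S$, let $D(H)$ be its Drinfel'd double: the coalgebra $H^{*\,\mathrm{cop}}\otimes H$ with unit $\varepsilon\otimes 1$ and multiplication \[ (p\otimes x)(p'\otimes y)=p\,\bigl(x_{(1)}\succ p'\prec S^{-1}(x_{(3)})\bigr)\otimes x_{(2)}y,\qquad \langle x\succ p'\prec y,z\rangle=\langle p',yzx\rangle , \] and identify $x\in H$ with $\varepsilon\otimes x$ and $p\in H^*$ with $p\otimes 1$. For $H=u_q(\mathfrak{sl}_2)$ let $a,b,c,d\in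 H^*\subseteq D(H)$ be the matrix coefficients of the two-dimensional representation \[ \rho=\begin{pmatrix}a&b\\ c&d\end{pmatrix},\quad \rho(K)=\begin{pmatrix}q&0\\0&q^{-1}\end{pmatrix},\quad \rho(E)=\begin{pmatrix}0&1\\0&0\end{pmatrix},\quad \rho(F)=\begin{pmatrix}0&0\\1&0\end{pmatrix}. \] Let $\gamma,\delta\in\Bbbk$ with $\gamma\delta=-q$, and fix a $u_q(\mathfrak{sl}_2)$-module algebra structure on $A=\Bbbk[u]/(u^n-1)$ with \[ K\cdot u=q^2u,\qquad F\cdot u=\gamma 1,\qquad E\cdot u=\delta u^2 . \] If this action extends to an action of $D(u_q(\mathfrak{sl}_2))$ that makes $A$ a $D(u_q(\mathfrak{sl}_2))$-module algebra, then the extended action satisfies one of the following two conditions: (i) $a\cdot u=qu$, $b\cdot u=\gamma(q-q^{-1})1$, $c\cdot u=0$, $d\cdot u=q^{-1}u$; or (ii) $a\cdot u=q^{-1}u$, $b\cdot u=0$, $c\cdot u=\gamma^{-1}(q-q^{-1})u^2$, $d\cdot u=qu$. Conversely, for each of (i) and (ii) there is exactly one extension of the action to a $D(u_q(\mathfrak{sl}_2))$-module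 algebra structure on $A$ that satisfies it. Thus there are exactly two extensions. -/

import Mathlib

open scoped TensorProduct

noncomputable section

/-! ### Module algebras -/

/-- `φ : D → End(A)` makes the algebra `A` a (left) `D`-module algebra, where `D` carries a
multiplication, a unit, a comultiplication and a counit:
`A` is a `D`-module, `h · (x y) = (h₁ · x) (h₂ · y)` and `h · 1 = ε(h) 1`. -/
structure IsModuleAlgebra {k D A : Type*} [Field k] [AddCommGroup D] [Module k D]
    [Mul D] [One D] [CoalgebraStruct k D] [Ring A] [Algebra k A]
    (φ : D →ₗ[k] Module.End k A) : Prop where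
  one_act : ∀ x : A, φ 1 x = x
  mul_act : ∀ (g h : D) (x : A), φ (g * h) x = φ g (φ h x)
  act_mul : ∀ (h : D) (x y : A),
    φ h (x * y) =
      LinearMap.mul' k A (TensorProduct.map (φ.flip x) (φ.flip y) (CoalgebraStruct.comul h))
  act_one : ∀ h : D, φ h 1 = (CoalgebraStruct.counit h : k) • (1 : A)

/-! ### The Drinfel'd double of a finite-dimensional Hopf algebra -/

namespace DoubleConstruction

variable (k H : Type*) [Field k] [Ring H] [HopfAlgebra k H]

/-- The product of the dual algebra `H*`: `(p q)(x) = p(x₁) q(x₂)`. -/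
def dualMul : Module.Dual k H →ₗ[k] Module.Dual k H →ₗ[k] Module.Dual k H :=
  LinearMap.mk₂ k
    (fun p q => LinearMap.mul' k k ∘ₗ TensorProduct.map p q ∘ₗ Coalgebra.comul)
    (fun p p' q => by simp [TensorProduct.map_add_left, LinearMap.add_comp, LinearMap.comp_add])
    (fun c p q => by simp [TensorProduct.map_smul_left, LinearMap.smul_comp, LinearMap.comp_smul])
    (fun p q q' => by simp [TensorProduct.map_add_right, LinearMap.add_comp, LinearMap.comp_add])
    (fun c p q => by simp [TensorProduct.map_smul_right, LinearMap.smul_comp, LinearMap.comp_smul])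

/-- The coproduct of `H*` (`H` finite-dimensional): `Δ(p) = p₁ ⊗ p₂` is the tensor with
`p₁(x) p₂(y) = p(x y)`. -/
def dualComul [Module.Finite k H] :
    Module.Dual k H →ₗ[k] Module.Dual k H ⊗[k] Module.Dual k H :=
  (TensorProduct.dualDistribEquiv k H H).symm.toLinearMap ∘ₗ
    Module.Dual.transpose (R := k) (LinearMap.mul' k H)

/-- The two transpose actions together: `transposeAct x y p = x ≻ p ≺ y`, that is
`z ↦ p (y z x)`. -/
def transposeAct : H →ₗ[k] H →ₗ[k] Module.Dual k H →ₗ[k] Module.Dual k H :=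
  LinearMap.mk₂ k
    (fun x y =>
      Module.Dual.transpose (R := k) (LinearMap.mulLeft k y ∘ₗ LinearMap.mulRight k x))
    (fun x x' y => by ext p z; simp [Module.Dual.transpose_apply, mul_add])
    (fun c x y => by ext p z; simp [Module.Dual.transpose_apply])
    (fun x y y' => by ext p z; simp [Module.Dual.transpose_apply, add_mul])
    (fun c x y => by ext p z; simp [Module.Dual.transpose_apply])

variable {k H}

/-- `x ⊗ (y ⊗ z) ↦ (q ↦ (x ≻ q ≺ S⁻¹(z)) ⊗ y)`, where `T` stands for `S⁻¹`. -/
def straightenAux (T : H →ₗ[k] H) :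
    H ⊗[k] (H ⊗[k] H) →ₗ[k] (Module.Dual k H →ₗ[k] Module.Dual k H ⊗[k] H) :=
  TensorProduct.lift
    { toFun := fun x =>
        TensorProduct.lift
          (LinearMap.mk₂ k
            (fun y z =>
              (TensorProduct.mk k (Module.Dual k H) H).flip y ∘ₗ transposeAct k H x (T z))
            (fun y y' z => by ext q; simp)
            (fun c y z => by ext q; simp)
            (fun y z z' => by ext q; simp)
            (fun c y z => by ext q; simp [TensorProduct.smul_tmul']))
      map_add' := fun x x' => by
        refine TensorProduct.ext' fun y z => LinearMap.ext fun q => ?_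
        simp
      map_smul' := fun c x => by
        refine TensorProduct.ext' fun y z => LinearMap.ext fun q => ?_
        simp [TensorProduct.smul_tmul'] }

/-- `a ↦ (q ↦ (a₁ ≻ q ≺ S⁻¹(a₃)) ⊗ a₂)`, where `T` stands for `S⁻¹`. -/
def straighten (T : H →ₗ[k] H) :
    H →ₗ[k] (Module.Dual k H →ₗ[k] Module.Dual k H ⊗[k] H) :=
  straightenAux T ∘ₗ Coalgebra.comul.lTensor H ∘ₗ Coalgebra.comul

/-- The product of the double on `H* ⊗ H`, where `T` stands for `S⁻¹`:
`(p ⊗ a) (q ⊗ b) = p (a₁ ≻ q ≺ S⁻¹(a₃)) ⊗ a₂ b`. -/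
def doubleMul (T : H →ₗ[k] H) :
    (Module.Dual k H ⊗[k] H) →ₗ[k] (Module.Dual k H ⊗[k] H) →ₗ[k] (Module.Dual k H ⊗[k] H) :=
  TensorProduct.lift
    (LinearMap.mk₂ k
      (fun p a =>
        TensorProduct.lift
          (LinearMap.mk₂ k
            (fun q b =>
              TensorProduct.map (dualMul k H p) (LinearMap.mulRight k b) (straighten T a q))
            (fun q q' b => by simp)
            (fun c q b => by simp)
            (fun q b b' => by
              rw [← LinearMap.add_apply, ← TensorProduct.map_add_right]
              congr 2; ext x; simp [mul_add])
            (fun c q b => by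
              rw [← LinearMap.smul_apply, ← TensorProduct.map_smul_right]
              congr 2; ext x; simp)))
      (fun p p' a => by ext q b; simp [TensorProduct.map_add_left])
      (fun c p a => by ext q b; simp [TensorProduct.map_smul_left])
      (fun p a a' => by ext q b; simp)
      (fun c p a => by ext q b; simp))

end DoubleConstruction

/-- The Drinfel'd double `D(H)` of a finite-dimensional Hopf algebra `H`; as a vector space it is
`H* ⊗ H`.  The hypothesis that the antipode is bijective (automatic in finite dimension) gives
access to `S⁻¹`. -/
def DrinfeldDouble (k H : Type*) [Field k] [Ring H] [HopfAlgebra k H]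
    (_hS : Function.Bijective (HopfAlgebra.antipode k (A := H))) : Type _ :=
  Module.Dual k H ⊗[k] H

namespace DrinfeldDouble

variable {k H : Type*} [Field k] [Ring H] [HopfAlgebra k H]
  (hS : Function.Bijective (HopfAlgebra.antipode k (A := H)))

instance : AddCommGroup (DrinfeldDouble k H hS) :=
  inferInstanceAs (AddCommGroup (Module.Dual k H ⊗[k] H))

instance : Module k (DrinfeldDouble k H hS) :=
  inferInstanceAs (Module k (Module.Dual k H ⊗[k] H))

/-- The simple tensor `p ⋈ a`. -/
def pure (p : Module.Dual k H) (a : H) : DrinfeldDouble k H hS := p ⊗ₜ[k] a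

/-- The inverse `S⁻¹` of the antipode. -/
def antipodeInv : H →ₗ[k] H :=
  (LinearEquiv.ofBijective (HopfAlgebra.antipode k (A := H)) hS).symm.toLinearMap

instance : Mul (DrinfeldDouble k H hS) where
  mul x y := DoubleConstruction.doubleMul (antipodeInv hS) x y

instance : One (DrinfeldDouble k H hS) where
  one := pure hS (Coalgebra.counit : H →ₗ[k] k) (1 : H)

/-- The coalgebra structure is that of `H*ᶜᵒᵖ ⊗ H`:
`Δ(p ⋈ a) = (p₂ ⋈ a₁) ⊗ (p₁ ⋈ a₂)` and `ε(p ⋈ a) = p(1) ε(a)`. -/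
instance [Module.Finite k H] : CoalgebraStruct k (DrinfeldDouble k H hS) where
  comul :=
    (TensorProduct.tensorTensorTensorComm k
        (Module.Dual k H) (Module.Dual k H) H H).toLinearMap ∘ₗ
      TensorProduct.map
        ((TensorProduct.comm k (Module.Dual k H) (Module.Dual k H)).toLinearMap ∘ₗ
          DoubleConstruction.dualComul k H)
        Coalgebra.comul
  counit :=
    LinearMap.mul' k k ∘ₗ
      TensorProduct.map (Module.Dual.eval k H 1) Coalgebra.counit

/-- The embedding `H → D(H)`, `a ↦ ε ⋈ a`. -/
def ofHopf (a : H) : DrinfeldDouble k H hS := pure hS (Coalgebra.counit : H →ₗ[k] k) a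

/-- The embedding `H*ᶜᵒᵖ → D(H)`, `p ↦ p ⋈ 1`. -/
def ofDual (p : Module.Dual k H) : DrinfeldDouble k H hS := pure hS p 1

end DrinfeldDouble

/-! ### The Frobenius-Lusztig kernel -/

/-- `q` is a primitive `n`-th root of unity, with `n ≥ 3` odd. -/
class IsOddPrimitiveRoot {k : Type*} [Field k] (n : ℕ) (q : k) : Prop where
  three_le : 3 ≤ n
  odd : Odd n
  prim : IsPrimitiveRoot q n

inductive UqGen : Type
  | K : UqGen
  | E : UqGen
  | F : UqGen

/-- The defining relations of `u_q(sl₂)`; as `Kⁿ = 1`, the inverse of `K` is `Kⁿ⁻¹`. -/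
inductive UqRel {k : Type*} [Field k] (n : ℕ) (q : k) :
    FreeAlgebra k UqGen → FreeAlgebra k UqGen → Prop
  | K_pow : UqRel n q (FreeAlgebra.ι k UqGen.K ^ n) 1
  | E_pow : UqRel n q (FreeAlgebra.ι k UqGen.E ^ n) 0
  | F_pow : UqRel n q (FreeAlgebra.ι k UqGen.F ^ n) 0
  | KE : UqRel n q (FreeAlgebra.ι k UqGen.K * FreeAlgebra.ι k UqGen.E)
      (q ^ 2 • (FreeAlgebra.ι k UqGen.E * FreeAlgebra.ι k UqGen.K))
  | KF : UqRel n q (FreeAlgebra.ι k UqGen.K * FreeAlgebra.ι k UqGen.F)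
      ((q ^ 2)⁻¹ • (FreeAlgebra.ι k UqGen.F * FreeAlgebra.ι k UqGen.K))
  | EF : UqRel n q
      (FreeAlgebra.ι k UqGen.E * FreeAlgebra.ι k UqGen.F -
        FreeAlgebra.ι k UqGen.F * FreeAlgebra.ι k UqGen.E)
      ((q - q⁻¹)⁻¹ • (FreeAlgebra.ι k UqGen.K - FreeAlgebra.ι k UqGen.K ^ (n - 1)))

/-- The Frobenius-Lusztig kernel `u_q(sl₂)`. -/
def Uq {k : Type*} [Field k] (n : ℕ) (q : k) : Type _ := RingQuot (UqRel n q)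

namespace Uq

variable {k : Type*} [Field k] (n : ℕ) (q : k)

instance : Ring (Uq n q) := inferInstanceAs (Ring (RingQuot (UqRel n q)))

instance : Algebra k (Uq n q) := inferInstanceAs (Algebra k (RingQuot (UqRel n q)))

/-- The projection from the free algebra. -/
def mk : FreeAlgebra k UqGen →ₐ[k] Uq n q := RingQuot.mkAlgHom k (UqRel n q)

variable {n q} in
theorem mk_rel {x y : FreeAlgebra k UqGen} (h : UqRel n q x y) : mk n q x = mk n q y :=
  RingQuot.mkAlgHom_rel k h

/-- The class of a generator. -/
def gen (x : UqGen) : Uq n q := mk n q (FreeAlgebra.ι k x)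

abbrev K : Uq n q := gen n q UqGen.K
abbrev E : Uq n q := gen n q UqGen.E
abbrev F : Uq n q := gen n q UqGen.F

theorem K_pow : K n q ^ n = 1 := by
  simpa [K, gen] using mk_rel (UqRel.K_pow (n := n) (q := q))

theorem E_pow : E n q ^ n = 0 := by
  simpa [K, E, F, gen] using mk_rel (UqRel.E_pow (n := n) (q := q))

theorem F_pow : F n q ^ n = 0 := by
  simpa [K, E, F, gen] using mk_rel (UqRel.F_pow (n := n) (q := q))

theorem K_mul_E : K n q * E n q = q ^ 2 • (E n q * K n q) := by
  simpa [K, E, F, gen] using mk_rel (UqRel.KE (n := n) (q := q))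

theorem K_mul_F : K n q * F n q = (q ^ 2)⁻¹ • (F n q * K n q) := by
  simpa [K, E, F, gen] using mk_rel (UqRel.KF (n := n) (q := q))

theorem E_mul_F : E n q * F n q - F n q * E n q =
    (q - q⁻¹)⁻¹ • (K n q - K n q ^ (n - 1)) := by
  simpa [K, E, F, gen] using mk_rel (UqRel.EF (n := n) (q := q))

end Uq

/-- Three elements of an algebra that satisfy the defining relations of `u_q(sl₂)`. -/
structure IsUqTriple {k B : Type*} [Field k] [Ring B] [Algebra k B] (n : ℕ) (q : k)
    (K E F : B) : Prop where
  K_pow : K ^ n = 1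
  E_pow : E ^ n = 0
  F_pow : F ^ n = 0
  KE : K * E = q ^ 2 • (E * K)
  KF : K * F = (q ^ 2)⁻¹ • (F * K)
  EF : E * F - F * E = (q - q⁻¹)⁻¹ • (K - K ^ (n - 1))

namespace Uq

variable {k : Type*} [Field k] {n : ℕ} {q : k}

theorem isUqTriple : IsUqTriple n q (K n q) (E n q) (F n q) :=
  ⟨K_pow n q, E_pow n q, F_pow n q, K_mul_E n q, K_mul_F n q, E_mul_F n q⟩

/-- The universal property of `u_q(sl₂)`. -/
def lift {B : Type*} [Ring B] [Algebra k B] {x y z : B} (h : IsUqTriple n q x y z) :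
    Uq n q →ₐ[k] B :=
  RingQuot.liftAlgHom k ⟨FreeAlgebra.lift k (fun g => UqGen.casesOn g x y z), by
    intro a b hab
    cases hab
    · simpa using h.K_pow
    · simpa using h.E_pow
    · simpa using h.F_pow
    · simpa using h.KE
    · simpa using h.KF
    · simpa using h.EF⟩

theorem lift_mk {B : Type*} [Ring B] [Algebra k B] {x y z : B} (h : IsUqTriple n q x y z)
    (t : FreeAlgebra k UqGen) :
    lift h (mk n q t) = FreeAlgebra.lift k (fun g => UqGen.casesOn g x y z) t :=
  RingQuot.liftAlgHom_mkAlgHom_apply _ _ _ _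

@[simp] theorem lift_K {B : Type*} [Ring B] [Algebra k B] {x y z : B}
    (h : IsUqTriple n q x y z) : lift h (K n q) = x := by
  rw [K, gen, lift_mk, FreeAlgebra.lift_ι_apply]

@[simp] theorem lift_E {B : Type*} [Ring B] [Algebra k B] {x y z : B}
    (h : IsUqTriple n q x y z) : lift h (E n q) = y := by
  rw [E, gen, lift_mk, FreeAlgebra.lift_ι_apply]

@[simp] theorem lift_F {B : Type*} [Ring B] [Algebra k B] {x y z : B}
    (h : IsUqTriple n q x y z) : lift h (F n q) = z := by
  rw [F, gen, lift_mk, FreeAlgebra.lift_ι_apply]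

theorem mk_surjective : Function.Surjective (mk n q) :=
  RingQuot.mkAlgHom_surjective k (UqRel n q)

/-- To prove something for all elements of `u_q(sl₂)`, one may build them from `1` by sums,
scalars and left multiplication by generators. -/
theorem induction_left {P : Uq n q → Prop} (h1 : P 1) (hadd : ∀ x y, P x → P y → P (x + y))
    (hsmul : ∀ (c : k) x, P x → P (c • x)) (hK : ∀ x, P x → P (K n q * x))
    (hE : ∀ x, P x → P (E n q * x)) (hF : ∀ x, P x → P (F n q * x)) (x : Uq n q) : P x := by
  obtain ⟨t, rfl⟩ := mk_surjective x
  suffices h : ∀ s, P s → P (mk n q t * s) by simpa using h 1 h1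
  induction t using FreeAlgebra.induction with
  | grade0 r => intro s hs; simpa [Algebra.algebraMap_eq_smul_one] using hsmul r s hs
  | grade1 g =>
    intro s hs
    cases g
    · exact hK s hs
    · exact hE s hs
    · exact hF s hs
  | mul a b ha hb => intro s hs; rw [map_mul, mul_assoc]; exact ha _ (hb _ hs)
  | add a b ha hb => intro s hs; rw [map_add, add_mul]; exact hadd _ _ (ha _ hs) (hb _ hs)

theorem algHom_ext {B : Type*} [Ring B] [Algebra k B] {f g : Uq n q →ₐ[k] B}
    (hK : f (K n q) = g (K n q)) (hE : f (E n q) = g (E n q)) (hF : f (F n q) = g (F n q)) :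
    f = g := by
  ext x
  induction x using induction_left with
  | h1 => simp
  | hadd x y hx hy => simp [hx, hy]
  | hsmul c x hx => simp [hx]
  | hK x hx => simp [hx, hK]
  | hE x hx => simp [hx, hE]
  | hF x hx => simp [hx, hF]

end Uq

/-! Powers of a sum of two `ζ`-commuting elements. -/

/-- The `ζ`-binomial coefficients. -/
def zetaBinom {k : Type*} [Field k] (ζ : k) : ℕ → ℕ → k
  | 0, 0 => 1
  | 0, _ + 1 => 0
  | m + 1, 0 => zetaBinom ζ m 0
  | m + 1, j + 1 => zetaBinom ζ m j + ζ ^ (j + 1) * zetaBinom ζ m (j + 1)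

theorem zetaBinom_self_lt {k : Type*} [Field k] (ζ : k) (m j : ℕ) (h : m < j) :
    zetaBinom ζ m j = 0 := by
  induction m generalizing j with
  | zero => obtain ⟨i, rfl⟩ := Nat.exists_eq_succ_of_ne_zero (by lia : j ≠ 0); simp [zetaBinom]
  | succ m ih =>
    obtain ⟨i, rfl⟩ := Nat.exists_eq_succ_of_ne_zero (by lia : j ≠ 0)
    simp [zetaBinom, ih i (by lia), ih (i + 1) (by lia)]

theorem zetaBinom_rec {k : Type*} [Field k] (ζ : k) (m j : ℕ) :
    (1 - ζ ^ (j + 1)) * ζ ^ j * zetaBinom ζ m (j + 1) = (ζ ^ j - ζ ^ m) * zetaBinom ζ m j := by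
  induction m generalizing j with
  | zero => cases j <;> simp [zetaBinom]
  | succ m ih =>
    cases j with
    | zero =>
      have := ih 0
      simp only [zetaBinom]
      linear_combination ζ * this
    | succ i =>
      have h1 := ih (i + 1)
      have h2 := ih i
      simp only [zetaBinom]
      linear_combination ζ ^ (i + 2) * h1 + ζ * h2

theorem add_pow_zeta {k B : Type*} [Field k] [Ring B] [Algebra k B] (ζ : k) (x y : B)
    (h : y * x = ζ • (x * y)) (m : ℕ) :
    (x + y) ^ m = ∑ j ∈ Finset.range (m + 1), zetaBinom ζ m j • (x ^ j * y ^ (m - j)) := by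
  have hyx : ∀ j, y * x ^ j = ζ ^ j • (x ^ j * y) := by
    intro j
    induction j with
    | zero => simp
    | succ j ih =>
      rw [pow_succ x, ← mul_assoc, ih, smul_mul_assoc, mul_assoc, h, mul_smul_comm, smul_smul,
        ← pow_succ, mul_assoc]
  induction m with
  | zero => simp [zetaBinom]
  | succ m ih =>
    rw [pow_succ', ih, Finset.mul_sum, Finset.sum_range_succ'
      (fun j => zetaBinom ζ (m + 1) j • (x ^ j * y ^ (m + 1 - j)))]
    have e1 : ∀ j ∈ Finset.range (m + 1),
        (x + y) * zetaBinom ζ m j • (x ^ j * y ^ (m - j)) =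
          zetaBinom ζ m j • (x ^ (j + 1) * y ^ (m - j)) +
            (ζ ^ j * zetaBinom ζ m j) • (x ^ j * y ^ (m + 1 - j)) := by
      intro j hj
      have hj' : m + 1 - j = (m - j) + 1 := by
        have := Finset.mem_range.1 hj; lia
      rw [hj', mul_smul_comm, add_mul, ← mul_assoc, ← mul_assoc, hyx, ← pow_succ', smul_add,
        smul_mul_assoc, mul_assoc (x ^ j), ← pow_succ', smul_smul, mul_comm (ζ ^ j)]
    rw [Finset.sum_congr rfl e1, Finset.sum_add_distrib,
      Finset.sum_range_succ' (fun j => (ζ ^ j * zetaBinom ζ m j) • (x ^ j * y ^ (m + 1 - j)))]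
    have e2 : ∑ j ∈ Finset.range m,
          (ζ ^ (j + 1) * zetaBinom ζ m (j + 1)) • (x ^ (j + 1) * y ^ (m + 1 - (j + 1))) =
        ∑ j ∈ Finset.range (m + 1),
          (ζ ^ (j + 1) * zetaBinom ζ m (j + 1)) • (x ^ (j + 1) * y ^ (m + 1 - (j + 1))) := by
      rw [Finset.sum_range_succ, zetaBinom_self_lt ζ m (m + 1) (by lia)]; simp
    rw [e2, ← add_assoc, ← Finset.sum_add_distrib]
    congr 1
    · refine Finset.sum_congr rfl fun j _ => ?_
      simp [zetaBinom, add_smul]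
    · simp [zetaBinom]

theorem add_pow_eq_zero_of_zeta {k B : Type*} [Field k] [Ring B] [Algebra k B] {ζ : k} {n : ℕ}
    (hζ : IsPrimitiveRoot ζ n) (hn : 0 < n) {x y : B} (h : y * x = ζ • (x * y))
    (hx : x ^ n = 0) (hy : y ^ n = 0) : (x + y) ^ n = 0 := by
  have hz : ∀ j, 0 < j → j < n → zetaBinom ζ n j = 0 := by
    intro j hj0 hjn
    induction j with
    | zero => lia
    | succ i ih =>
      have h1 := zetaBinom_rec ζ n i
      have h2 : (ζ ^ i - ζ ^ n) * zetaBinom ζ n i = 0 := by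
        rcases Nat.eq_zero_or_pos i with rfl | hi
        · simp [hζ.pow_eq_one]
        · rw [ih hi (by lia), mul_zero]
      rw [h2] at h1
      have h3 : (1 - ζ ^ (i + 1)) * ζ ^ i ≠ 0 := by
        refine mul_ne_zero (sub_ne_zero.2 fun h => ?_) (pow_ne_zero _ (hζ.ne_zero (by lia)))
        exact hζ.pow_ne_one_of_pos_of_lt (by lia) hjn h.symm
      exact (mul_eq_zero.1 h1).resolve_left h3
  rw [add_pow_zeta ζ x y h]
  refine Finset.sum_eq_zero fun j hj => ?_
  rcases Nat.eq_zero_or_pos j with rfl | h0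
  · simp [hy]
  · rcases (Nat.lt_succ_iff_lt_or_eq.1 (Finset.mem_range.1 hj)) with h1 | rfl
    · rw [hz j h0 h1, zero_smul]
    · simp [hx]

theorem mul_pow_eq_zero_of_zeta {k B : Type*} [Field k] [Ring B] [Algebra k B] {ζ : k} {n : ℕ}
    {x y : B} (h : y * x = ζ • (x * y)) (hx : x ^ n = 0) : (x * y) ^ n = 0 := by
  have hyx : ∀ j, y * x ^ j = ζ ^ j • (x ^ j * y) := by
    intro j
    induction j with
    | zero => simp
    | succ j ih =>
      rw [pow_succ x, ← mul_assoc, ih, smul_mul_assoc, mul_assoc, h, mul_smul_comm, smul_smul,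
        ← pow_succ, mul_assoc]
  have : ∀ j, ∃ c : k, (x * y) ^ j = c • (x ^ j * y ^ j) := by
    intro j
    induction j with
    | zero => exact ⟨1, by simp⟩
    | succ j ih =>
      obtain ⟨c, hc⟩ := ih
      refine ⟨ζ ^ j * c, ?_⟩
      rw [pow_succ' (x * y), hc, mul_smul_comm, mul_assoc, ← mul_assoc y, hyx, smul_mul_assoc,
        mul_smul_comm, smul_smul, mul_assoc (x ^ j), ← pow_succ', ← mul_assoc, ← pow_succ',
        mul_comm c]
  obtain ⟨c, hc⟩ := this n
  rw [hc, hx, zero_mul, smul_zero]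

section Triple

variable {k B : Type*} [Field k] [Ring B] [Algebra k B] {n : ℕ} {q : k}

namespace IsOddPrimitiveRoot

theorem pos (n : ℕ) (q : k) [h : IsOddPrimitiveRoot n q] : 0 < n := by
  have := h.three_le; lia

theorem ne_zero (n : ℕ) (q : k) [h : IsOddPrimitiveRoot n q] : q ≠ 0 :=
  h.prim.ne_zero (pos n q).ne'

theorem sq_prim (n : ℕ) (q : k) [h : IsOddPrimitiveRoot n q] : IsPrimitiveRoot (q ^ 2) n :=
  h.prim.pow_of_coprime 2 (Nat.coprime_two_left.2 h.odd)

theorem sub_inv_ne_zero (n : ℕ) (q : k) [h : IsOddPrimitiveRoot n q] : q - q⁻¹ ≠ 0 := by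
  intro h0
  have h1 : q ^ 2 = 1 := by
    have := sub_eq_zero.1 h0
    have hq := ne_zero n q
    field_simp at this
    exact this
  have := (h.prim.dvd_of_pow_eq_one 2 h1)
  have := Nat.le_of_dvd (by norm_num) this
  have := h.three_le
  lia

end IsOddPrimitiveRoot

namespace IsUqTriple

open IsOddPrimitiveRoot

theorem K_mul_inv [IsOddPrimitiveRoot n q] {K E F : B} (h : IsUqTriple n q K E F) :
    K * K ^ (n - 1) = 1 := by
  rw [← pow_succ', Nat.sub_add_cancel (pos n q), h.K_pow]

theorem inv_mul_K [IsOddPrimitiveRoot n q] {K E F : B} (h : IsUqTriple n q K E F) :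
    K ^ (n - 1) * K = 1 := by
  rw [← pow_succ, Nat.sub_add_cancel (pos n q), h.K_pow]

theorem E_mul_inv [IsOddPrimitiveRoot n q] {K E F : B} (h : IsUqTriple n q K E F) :
    E * K ^ (n - 1) = q ^ 2 • (K ^ (n - 1) * E) := by
  have hq := ne_zero n q
  calc E * K ^ (n - 1) = K ^ (n - 1) * (K * E) * K ^ (n - 1) := by
        rw [← mul_assoc, h.inv_mul_K, one_mul]
    _ = q ^ 2 • (K ^ (n - 1) * E) := by
        rw [h.KE, mul_smul_comm, smul_mul_assoc, mul_assoc, mul_assoc, h.K_mul_inv, mul_one]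

theorem F_mul_inv [IsOddPrimitiveRoot n q] {K E F : B} (h : IsUqTriple n q K E F) :
    F * K ^ (n - 1) = (q ^ 2)⁻¹ • (K ^ (n - 1) * F) := by
  calc F * K ^ (n - 1) = K ^ (n - 1) * (K * F) * K ^ (n - 1) := by
        rw [← mul_assoc, h.inv_mul_K, one_mul]
    _ = (q ^ 2)⁻¹ • (K ^ (n - 1) * F) := by
        rw [h.KF, mul_smul_comm, smul_mul_assoc, mul_assoc, mul_assoc, h.K_mul_inv, mul_one]

theorem inv_pow_pred [IsOddPrimitiveRoot n q] {K E F : B} (h : IsUqTriple n q K E F) :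
    (K ^ (n - 1)) ^ (n - 1) = K := by
  have h1 : (K ^ (n - 1)) ^ n = 1 := by rw [← pow_mul, mul_comm, pow_mul, h.K_pow, one_pow]
  calc (K ^ (n - 1)) ^ (n - 1) = (K ^ (n - 1)) ^ (n - 1) * (K ^ (n - 1) * K) := by
        rw [h.inv_mul_K, mul_one]
    _ = K := by
        rw [← mul_assoc, ← pow_succ, Nat.sub_add_cancel (pos n q), h1, one_mul]

theorem F_mul_K [IsOddPrimitiveRoot n q] {K E F : B} (h : IsUqTriple n q K E F) :
    F * K = q ^ 2 • (K * F) := by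
  rw [h.KF, smul_smul, mul_inv_cancel₀ (pow_ne_zero 2 (ne_zero n q)), one_smul]

theorem E_mul_K [IsOddPrimitiveRoot n q] {K E F : B} (h : IsUqTriple n q K E F) :
    E * K = (q ^ 2)⁻¹ • (K * E) := by
  rw [h.KE, smul_smul, inv_mul_cancel₀ (pow_ne_zero 2 (ne_zero n q)), one_smul]

theorem inv_mul_E [IsOddPrimitiveRoot n q] {K E F : B} (h : IsUqTriple n q K E F) :
    K ^ (n - 1) * E = (q ^ 2)⁻¹ • (E * K ^ (n - 1)) := by
  rw [h.E_mul_inv, smul_smul, inv_mul_cancel₀ (pow_ne_zero 2 (ne_zero n q)), one_smul]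

theorem inv_mul_F [IsOddPrimitiveRoot n q] {K E F : B} (h : IsUqTriple n q K E F) :
    K ^ (n - 1) * F = q ^ 2 • (F * K ^ (n - 1)) := by
  rw [h.F_mul_inv, smul_smul, mul_inv_cancel₀ (pow_ne_zero 2 (ne_zero n q)), one_smul]

/-- The triple that defines the comultiplication. -/
theorem comul_triple [IsOddPrimitiveRoot n q] {K E F : B} (h : IsUqTriple n q K E F) :
    IsUqTriple n q (K ⊗ₜ[k] K) (1 ⊗ₜ[k] E + E ⊗ₜ[k] K)
      ((K ^ (n - 1)) ⊗ₜ[k] F + F ⊗ₜ[k] 1) where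
  K_pow := by
    rw [Algebra.TensorProduct.tmul_pow, h.K_pow, Algebra.TensorProduct.one_def]
  E_pow := by
    refine add_pow_eq_zero_of_zeta (sq_prim n q) (pos n q) ?_ ?_ ?_
    · simp [h.KE]
    · simp [Algebra.TensorProduct.tmul_pow, h.E_pow]
    · simp [Algebra.TensorProduct.tmul_pow, h.E_pow]
  F_pow := by
    rw [add_comm]
    refine add_pow_eq_zero_of_zeta (sq_prim n q) (pos n q) ?_ ?_ ?_
    · simp [h.inv_mul_F, TensorProduct.smul_tmul']
    · simp [Algebra.TensorProduct.tmul_pow, h.F_pow]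
    · simp [Algebra.TensorProduct.tmul_pow, h.F_pow]
  KE := by
    simp [mul_add, add_mul, h.KE, TensorProduct.smul_tmul']
  KF := by
    simp [mul_add, add_mul, h.KF, TensorProduct.smul_tmul', h.inv_mul_K, h.K_mul_inv]
  EF := by
    have hc : (E ⊗ₜ[k] K) * ((K ^ (n - 1)) ⊗ₜ[k] F) =
        ((K ^ (n - 1)) ⊗ₜ[k] F) * (E ⊗ₜ[k] K) := by
      simp [h.E_mul_inv, h.KF, TensorProduct.smul_tmul', smul_smul, ne_zero n q]
    have hd : (1 ⊗ₜ[k] E : B ⊗[k] B) * (F ⊗ₜ[k] 1) = (F ⊗ₜ[k] 1) * (1 ⊗ₜ[k] E) := by simp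
    have e1 : (1 ⊗ₜ[k] E : B ⊗[k] B) * ((K ^ (n - 1)) ⊗ₜ[k] F) -
        ((K ^ (n - 1)) ⊗ₜ[k] F) * (1 ⊗ₜ[k] E) =
          (q - q⁻¹)⁻¹ • ((K ^ (n - 1)) ⊗ₜ[k] K - (K ^ (n - 1)) ⊗ₜ[k] (K ^ (n - 1))) := by
      simp only [Algebra.TensorProduct.tmul_mul_tmul, one_mul, mul_one]
      rw [← TensorProduct.tmul_sub, h.EF, TensorProduct.tmul_smul, TensorProduct.tmul_sub]
    have e2 : (E ⊗ₜ[k] K : B ⊗[k] B) * (F ⊗ₜ[k] 1) - (F ⊗ₜ[k] 1) * (E ⊗ₜ[k] K) =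
          (q - q⁻¹)⁻¹ • (K ⊗ₜ[k] K - (K ^ (n - 1)) ⊗ₜ[k] K) := by
      simp only [Algebra.TensorProduct.tmul_mul_tmul, one_mul, mul_one]
      rw [← TensorProduct.sub_tmul, h.EF, ← TensorProduct.smul_tmul', TensorProduct.sub_tmul]
    rw [Algebra.TensorProduct.tmul_pow]
    calc _ = ((1 ⊗ₜ[k] E : B ⊗[k] B) * ((K ^ (n - 1)) ⊗ₜ[k] F) -
            ((K ^ (n - 1)) ⊗ₜ[k] F) * (1 ⊗ₜ[k] E)) +
          ((E ⊗ₜ[k] K : B ⊗[k] B) * (F ⊗ₜ[k] 1) - (F ⊗ₜ[k] 1) * (E ⊗ₜ[k] K)) := by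
            simp only [mul_add, add_mul, hc, hd]; abel
      _ = _ := by rw [e1, e2, ← smul_add]; congr 1; abel

/-- The triple that defines the counit. -/
theorem counit_triple (n : ℕ) (q : k) [IsOddPrimitiveRoot n q] :
    IsUqTriple n q (1 : k) (0 : k) (0 : k) where
  K_pow := by simp
  E_pow := by simp [(pos n q).ne']
  F_pow := by simp [(pos n q).ne']
  KE := by simp
  KF := by simp
  EF := by simp

/-- The triple that defines the antipode. -/
theorem antipode_triple [IsOddPrimitiveRoot n q] {K E F : B} (h : IsUqTriple n q K E F) :
    IsUqTriple n q (MulOpposite.op (K ^ (n - 1))) (MulOpposite.op (-(E * K ^ (n - 1))))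
      (MulOpposite.op (-(K * F))) where
  K_pow := by
    rw [← MulOpposite.op_pow, ← pow_mul, mul_comm, pow_mul, h.K_pow, one_pow, MulOpposite.op_one]
  E_pow := by
    rw [← MulOpposite.op_pow, neg_pow, mul_pow_eq_zero_of_zeta h.inv_mul_E h.E_pow]
    simp
  F_pow := by
    rw [← MulOpposite.op_pow, neg_pow]
    have : K * F = (q ^ 2)⁻¹ • (F * K) := h.KF
    rw [this, smul_pow, mul_pow_eq_zero_of_zeta h.KF h.F_pow]
    simp
  KE := by
    rw [← MulOpposite.op_mul, ← MulOpposite.op_mul, ← MulOpposite.op_smul]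
    congr 1
    rw [neg_mul, mul_neg, smul_neg, ← mul_assoc (K ^ (n - 1)), ← smul_mul_assoc, ← h.E_mul_inv]
  KF := by
    rw [← MulOpposite.op_mul, ← MulOpposite.op_mul, ← MulOpposite.op_smul]
    congr 1
    rw [neg_mul, mul_neg, smul_neg, ← mul_assoc (K ^ (n - 1)), h.inv_mul_K, one_mul, mul_assoc,
      h.F_mul_inv, mul_smul_comm, ← mul_assoc, h.K_mul_inv, one_mul]
  EF := by
    rw [← MulOpposite.op_mul, ← MulOpposite.op_mul, ← MulOpposite.op_sub, ← MulOpposite.op_pow,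
      ← MulOpposite.op_sub, ← MulOpposite.op_smul]
    congr 1
    rw [h.inv_pow_pred, neg_mul_neg, neg_mul_neg]
    have e1 : K * F * (E * K ^ (n - 1)) = F * E := by
      rw [h.E_mul_inv, h.KF]
      simp only [smul_mul_assoc, mul_smul_comm, smul_smul]
      rw [mul_inv_cancel₀ (pow_ne_zero 2 (ne_zero n q)), one_smul, mul_assoc, ← mul_assoc K,
        h.K_mul_inv, one_mul]
    have e2 : E * K ^ (n - 1) * (K * F) = E * F := by
      rw [mul_assoc, ← mul_assoc _ K, h.inv_mul_K, one_mul]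
    rw [e1, e2, ← neg_sub, h.EF, ← smul_neg, neg_sub]

/-- The triple that defines the inverse of the antipode. -/
theorem antipodeInv_triple [IsOddPrimitiveRoot n q] {K E F : B} (h : IsUqTriple n q K E F) :
    IsUqTriple n q (MulOpposite.op (K ^ (n - 1))) (MulOpposite.op (-(K ^ (n - 1) * E)))
      (MulOpposite.op (-(F * K))) where
  K_pow := h.antipode_triple.K_pow
  E_pow := by
    rw [← MulOpposite.op_pow, neg_pow, h.inv_mul_E, smul_pow,
      mul_pow_eq_zero_of_zeta h.inv_mul_E h.E_pow]
    simp
  F_pow := by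
    rw [← MulOpposite.op_pow, neg_pow, mul_pow_eq_zero_of_zeta h.KF h.F_pow]
    simp
  KE := by
    rw [← MulOpposite.op_mul, ← MulOpposite.op_mul, ← MulOpposite.op_smul]
    congr 1
    rw [neg_mul, mul_neg, smul_neg, mul_assoc, h.E_mul_inv, mul_smul_comm]
  KF := by
    rw [← MulOpposite.op_mul, ← MulOpposite.op_mul, ← MulOpposite.op_smul]
    congr 1
    rw [neg_mul, mul_neg, smul_neg, mul_assoc, h.K_mul_inv, mul_one, ← mul_assoc, h.inv_mul_F,
      smul_mul_assoc, mul_assoc, h.inv_mul_K, mul_one, smul_smul,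
      inv_mul_cancel₀ (pow_ne_zero 2 (ne_zero n q)), one_smul]
  EF := by
    rw [← MulOpposite.op_mul, ← MulOpposite.op_mul, ← MulOpposite.op_sub, ← MulOpposite.op_pow,
      ← MulOpposite.op_sub, ← MulOpposite.op_smul]
    congr 1
    rw [h.inv_pow_pred, neg_mul_neg, neg_mul_neg]
    have e1 : F * K * (K ^ (n - 1) * E) = F * E := by
      rw [mul_assoc, ← mul_assoc K, h.K_mul_inv, one_mul]
    have e2 : K ^ (n - 1) * E * (F * K) = E * F := by
      rw [h.inv_mul_E, h.F_mul_K]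
      simp only [smul_mul_assoc, mul_smul_comm, smul_smul]
      rw [mul_inv_cancel₀ (pow_ne_zero 2 (ne_zero n q)), one_smul, mul_assoc, ← mul_assoc _ K,
        h.inv_mul_K, one_mul]
    rw [e1, e2, ← neg_sub, h.EF, ← smul_neg, neg_sub]

end IsUqTriple

end Triple

namespace Uq

open IsOddPrimitiveRoot

variable {k : Type*} [Field k] (n : ℕ) (q : k) [IsOddPrimitiveRoot n q]

/-- `Δ(K) = K ⊗ K`, `Δ(E) = 1 ⊗ E + E ⊗ K`, `Δ(F) = K⁻¹ ⊗ F + F ⊗ 1`. -/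
def comulHom : Uq n q →ₐ[k] Uq n q ⊗[k] Uq n q :=
  lift (isUqTriple (n := n) (q := q)).comul_triple

/-- `ε(K) = 1`, `ε(E) = ε(F) = 0`. -/
def counitHom : Uq n q →ₐ[k] k := lift (IsUqTriple.counit_triple n q)

/-- `S(K) = K⁻¹`, `S(E) = -E K⁻¹`, `S(F) = -K F`, as a homomorphism to the opposite algebra. -/
def antipodeHom : Uq n q →ₐ[k] (Uq n q)ᵐᵒᵖ :=
  lift (isUqTriple (n := n) (q := q)).antipode_triple

/-- `K ↦ K⁻¹`, `E ↦ -K⁻¹ E`, `F ↦ -F K`, as a homomorphism to the opposite algebra. -/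
def antipodeInvHom : Uq n q →ₐ[k] (Uq n q)ᵐᵒᵖ :=
  lift (isUqTriple (n := n) (q := q)).antipodeInv_triple

instance : Bialgebra k (Uq n q) :=
  Bialgebra.ofAlgHom (comulHom n q) (counitHom n q)
    (by
      apply algHom_ext <;>
        simp [comulHom, Algebra.TensorProduct.one_def, TensorProduct.tmul_add,
          TensorProduct.add_tmul, add_assoc])
    (by
      apply algHom_ext <;> simp [comulHom, counitHom])
    (by
      apply algHom_ext <;> simp [comulHom, counitHom])

theorem comul_K : Coalgebra.comul (R := k) (K n q) = K n q ⊗ₜ[k] K n q :=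
  lift_K _

theorem comul_E :
    Coalgebra.comul (R := k) (E n q) = 1 ⊗ₜ[k] E n q + E n q ⊗ₜ[k] K n q :=
  lift_E _

theorem comul_F :
    Coalgebra.comul (R := k) (F n q) = (K n q ^ (n - 1)) ⊗ₜ[k] F n q + F n q ⊗ₜ[k] 1 :=
  lift_F _

theorem counit_K : Coalgebra.counit (R := k) (K n q) = 1 := lift_K _

theorem counit_E : Coalgebra.counit (R := k) (E n q) = 0 := lift_E _

theorem counit_F : Coalgebra.counit (R := k) (F n q) = 0 := lift_F _

/-- The antipode as a linear map. -/
def antipodeLin : Uq n q →ₗ[k] Uq n q :=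
  (MulOpposite.opLinearEquiv k).symm.toLinearMap ∘ₗ (antipodeHom n q).toLinearMap

/-- The inverse of the antipode as a linear map. -/
def antipodeInvLin : Uq n q →ₗ[k] Uq n q :=
  (MulOpposite.opLinearEquiv k).symm.toLinearMap ∘ₗ (antipodeInvHom n q).toLinearMap

theorem antipodeLin_one : antipodeLin n q 1 = 1 := by simp [antipodeLin]

theorem antipodeInvLin_one : antipodeInvLin n q 1 = 1 := by simp [antipodeInvLin]

theorem antipodeLin_mul (x y : Uq n q) :
    antipodeLin n q (x * y) = antipodeLin n q y * antipodeLin n q x := by simp [antipodeLin]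

theorem antipodeInvLin_mul (x y : Uq n q) :
    antipodeInvLin n q (x * y) = antipodeInvLin n q y * antipodeInvLin n q x := by
  simp [antipodeInvLin]

theorem antipodeLin_K : antipodeLin n q (K n q) = K n q ^ (n - 1) := by
  simp [antipodeLin, antipodeHom]

theorem antipodeLin_E : antipodeLin n q (E n q) = -(E n q * K n q ^ (n - 1)) := by
  simp [antipodeLin, antipodeHom]

theorem antipodeLin_F : antipodeLin n q (F n q) = -(K n q * F n q) := by
  simp [antipodeLin, antipodeHom]

theorem antipodeInvLin_K : antipodeInvLin n q (K n q) = K n q ^ (n - 1) := by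
  simp [antipodeInvLin, antipodeInvHom]

theorem antipodeInvLin_E : antipodeInvLin n q (E n q) = -(K n q ^ (n - 1) * E n q) := by
  simp [antipodeInvLin, antipodeInvHom]

theorem antipodeInvLin_F : antipodeInvLin n q (F n q) = -(F n q * K n q) := by
  simp [antipodeInvLin, antipodeInvHom]

theorem antipodeLin_K_pow : antipodeLin n q (K n q ^ (n - 1)) = K n q := by
  have h := (isUqTriple (n := n) (q := q)).inv_pow_pred
  have e : antipodeHom n q (K n q) = MulOpposite.op (K n q ^ (n - 1)) := lift_K _
  simp [antipodeLin, map_pow, e, h, ← MulOpposite.op_pow]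

theorem antipodeInvLin_K_pow : antipodeInvLin n q (K n q ^ (n - 1)) = K n q := by
  have h := (isUqTriple (n := n) (q := q)).inv_pow_pred
  have e : antipodeInvHom n q (K n q) = MulOpposite.op (K n q ^ (n - 1)) := lift_K _
  simp [antipodeInvLin, map_pow, e, h, ← MulOpposite.op_pow]

theorem antipodeInv_antipode (x : Uq n q) :
    antipodeInvLin n q (antipodeLin n q x) = x := by
  have h := isUqTriple (n := n) (q := q)
  induction x using induction_left with
  | h1 => rw [antipodeLin_one, antipodeInvLin_one]
  | hadd x y hx hy => rw [map_add, map_add, hx, hy]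
  | hsmul c x hx => rw [map_smul, map_smul, hx]
  | hK x hx => rw [antipodeLin_mul, antipodeInvLin_mul, hx, antipodeLin_K, antipodeInvLin_K_pow]
  | hE x hx =>
    rw [antipodeLin_mul, antipodeInvLin_mul, hx, antipodeLin_E, map_neg, antipodeInvLin_mul,
      antipodeInvLin_K_pow, antipodeInvLin_E, mul_neg, neg_neg, ← mul_assoc, h.K_mul_inv, one_mul]
  | hF x hx =>
    rw [antipodeLin_mul, antipodeInvLin_mul, hx, antipodeLin_F, map_neg, antipodeInvLin_mul,
      antipodeInvLin_K, antipodeInvLin_F, neg_mul, neg_mul, neg_mul, neg_neg, mul_assoc (F n q), h.K_mul_inv, mul_one]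

theorem antipode_antipodeInv (x : Uq n q) :
    antipodeLin n q (antipodeInvLin n q x) = x := by
  have h := isUqTriple (n := n) (q := q)
  induction x using induction_left with
  | h1 => rw [antipodeInvLin_one, antipodeLin_one]
  | hadd x y hx hy => rw [map_add, map_add, hx, hy]
  | hsmul c x hx => rw [map_smul, map_smul, hx]
  | hK x hx => rw [antipodeInvLin_mul, antipodeLin_mul, hx, antipodeInvLin_K, antipodeLin_K_pow]
  | hE x hx =>
    rw [antipodeInvLin_mul, antipodeLin_mul, hx, antipodeInvLin_E, map_neg, antipodeLin_mul,
      antipodeLin_K_pow, antipodeLin_E, neg_mul, neg_mul, neg_mul, neg_neg, mul_assoc (E n q), h.inv_mul_K, mul_one]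
  | hF x hx =>
    rw [antipodeInvLin_mul, antipodeLin_mul, hx, antipodeInvLin_F, map_neg, antipodeLin_mul,
      antipodeLin_K, antipodeLin_F, mul_neg, neg_neg, ← mul_assoc (_ ^ _), h.inv_mul_K, one_mul]

/-- `Σ S(t₁) t₂`. -/
def mulAntipodeLeft : Uq n q ⊗[k] Uq n q →ₗ[k] Uq n q :=
  LinearMap.mul' k (Uq n q) ∘ₗ (antipodeLin n q).rTensor (Uq n q)

/-- `Σ t₁ S(t₂)`. -/
def mulAntipodeRight : Uq n q ⊗[k] Uq n q →ₗ[k] Uq n q :=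
  LinearMap.mul' k (Uq n q) ∘ₗ (antipodeLin n q).lTensor (Uq n q)

theorem mulAntipodeLeft_tmul (x y : Uq n q) :
    mulAntipodeLeft n q (x ⊗ₜ y) = antipodeLin n q x * y := by simp [mulAntipodeLeft]

theorem mulAntipodeRight_tmul (x y : Uq n q) :
    mulAntipodeRight n q (x ⊗ₜ y) = x * antipodeLin n q y := by simp [mulAntipodeRight]

theorem mulAntipodeLeft_mul (s t : Uq n q ⊗[k] Uq n q) (c : k)
    (hs : mulAntipodeLeft n q s = algebraMap k _ c) :
    mulAntipodeLeft n q (s * t) = c • mulAntipodeLeft n q t := by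
  induction t with
  | zero => simp
  | add t t' ht ht' => rw [mul_add, map_add, map_add, ht, ht', smul_add]
  | tmul x y =>
    have e : mulAntipodeLeft n q (s * (x ⊗ₜ[k] y)) =
        antipodeLin n q x * mulAntipodeLeft n q s * y := by
      clear hs
      induction s with
      | zero => simp
      | add s s' hs hs' => rw [add_mul, map_add, map_add, hs, hs', mul_add, add_mul]
      | tmul a b =>
        rw [Algebra.TensorProduct.tmul_mul_tmul, mulAntipodeLeft_tmul, mulAntipodeLeft_tmul,
          antipodeLin_mul]
        simp only [mul_assoc]
    rw [e, hs, mulAntipodeLeft_tmul, ← Algebra.commutes, mul_assoc, Algebra.smul_def]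

theorem mulAntipodeRight_mul (s t : Uq n q ⊗[k] Uq n q) (c : k)
    (ht : mulAntipodeRight n q t = algebraMap k _ c) :
    mulAntipodeRight n q (s * t) = c • mulAntipodeRight n q s := by
  induction s with
  | zero => simp
  | add s s' hs hs' => rw [add_mul, map_add, map_add, hs, hs', smul_add]
  | tmul x y =>
    have e : mulAntipodeRight n q ((x ⊗ₜ[k] y) * t) =
        x * mulAntipodeRight n q t * antipodeLin n q y := by
      clear ht
      induction t with
      | zero => simp
      | add s s' hs hs' => rw [mul_add, map_add, map_add, hs, hs', mul_add, add_mul]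
      | tmul a b =>
        rw [Algebra.TensorProduct.tmul_mul_tmul, mulAntipodeRight_tmul, mulAntipodeRight_tmul,
          antipodeLin_mul]
        simp only [mul_assoc]
    rw [e, ht, mulAntipodeRight_tmul, ← Algebra.commutes, mul_assoc, Algebra.smul_def]

theorem mulAntipodeLeft_comul (x : Uq n q) :
    mulAntipodeLeft n q (Coalgebra.comul x) =
      algebraMap k (Uq n q) (Coalgebra.counit x) := by
  have h := isUqTriple (n := n) (q := q)
  have key : ∀ g : Uq n q, mulAntipodeLeft n q (Coalgebra.comul g) =
      algebraMap k (Uq n q) (Coalgebra.counit g) → ∀ x : Uq n q,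
      mulAntipodeLeft n q (Coalgebra.comul x) = algebraMap k (Uq n q) (Coalgebra.counit x) →
      mulAntipodeLeft n q (Coalgebra.comul (g * x)) =
        algebraMap k (Uq n q) (Coalgebra.counit (g * x)) := by
    intro g hg x hx
    rw [Bialgebra.comul_mul, mulAntipodeLeft_mul n q _ _ _ hg, hx, Bialgebra.counit_mul, map_mul,
      Algebra.smul_def]
  induction x using induction_left with
  | h1 =>
    simp [Algebra.TensorProduct.one_def, mulAntipodeLeft_tmul, antipodeLin_one]
  | hadd x y hx hy => simp only [map_add, hx, hy]
  | hsmul c x hx => rw [map_smul, map_smul, hx, map_smul, smul_eq_mul, map_mul, Algebra.smul_def]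
  | hK x hx =>
    refine key _ ?_ x hx
    rw [comul_K, counit_K, mulAntipodeLeft_tmul, antipodeLin_K, h.inv_mul_K, map_one]
  | hE x hx =>
    refine key _ ?_ x hx
    rw [comul_E, counit_E, map_add, mulAntipodeLeft_tmul, mulAntipodeLeft_tmul, antipodeLin_E,
      antipodeLin_one, neg_mul, mul_assoc, h.inv_mul_K, one_mul, mul_one, map_zero, add_neg_cancel]
  | hF x hx =>
    refine key _ ?_ x hx
    rw [comul_F, counit_F, map_add, mulAntipodeLeft_tmul, mulAntipodeLeft_tmul, antipodeLin_F,
      antipodeLin_K_pow, mul_one, map_zero, add_neg_cancel]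

theorem mulAntipodeRight_comul (x : Uq n q) :
    mulAntipodeRight n q (Coalgebra.comul x) =
      algebraMap k (Uq n q) (Coalgebra.counit x) := by
  have h := isUqTriple (n := n) (q := q)
  have key : ∀ g : Uq n q, mulAntipodeRight n q (Coalgebra.comul g) =
      algebraMap k (Uq n q) (Coalgebra.counit g) → ∀ x : Uq n q,
      mulAntipodeRight n q (Coalgebra.comul x) = algebraMap k (Uq n q) (Coalgebra.counit x) →
      mulAntipodeRight n q (Coalgebra.comul (g * x)) =
        algebraMap k (Uq n q) (Coalgebra.counit (g * x)) := by
    intro g hg x hx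
    rw [Bialgebra.comul_mul, mulAntipodeRight_mul n q _ _ _ hx, hg, Bialgebra.counit_mul, mul_comm,
      map_mul, Algebra.smul_def]
  induction x using induction_left with
  | h1 =>
    simp [Algebra.TensorProduct.one_def, mulAntipodeRight_tmul, antipodeLin_one]
  | hadd x y hx hy => simp only [map_add, hx, hy]
  | hsmul c x hx => rw [map_smul, map_smul, hx, map_smul, smul_eq_mul, map_mul, Algebra.smul_def]
  | hK x hx =>
    refine key _ ?_ x hx
    rw [comul_K, counit_K, mulAntipodeRight_tmul, antipodeLin_K, h.K_mul_inv, map_one]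
  | hE x hx =>
    refine key _ ?_ x hx
    rw [comul_E, counit_E, map_add, mulAntipodeRight_tmul, mulAntipodeRight_tmul, antipodeLin_E,
      antipodeLin_K, one_mul, map_zero, neg_add_cancel]
  | hF x hx =>
    refine key _ ?_ x hx
    rw [comul_F, counit_F, map_add, mulAntipodeRight_tmul, mulAntipodeRight_tmul, antipodeLin_F,
      antipodeLin_one, mul_neg, ← mul_assoc, h.inv_mul_K, one_mul, mul_one, map_zero,
      neg_add_cancel]

instance : HopfAlgebra k (Uq n q) where
  antipode := antipodeLin n q
  mul_antipode_rTensor_comul := LinearMap.ext (mulAntipodeLeft_comul n q)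
  mul_antipode_lTensor_comul := LinearMap.ext (mulAntipodeRight_comul n q)

theorem antipode_bijective :
    Function.Bijective (HopfAlgebra.antipode k (A := Uq n q)) :=
  ⟨Function.LeftInverse.injective (g := antipodeInvLin n q) (antipodeInv_antipode n q),
    Function.RightInverse.surjective (g := antipodeInvLin n q) (antipode_antipodeInv n q)⟩

/-- The span of the monomials `Eⁱ Fʲ Kˡ` with `0 ≤ i, j, l < n`. -/
def monomialSpan : Submodule k (Uq n q) :=
  Submodule.span k (Set.range fun t : Fin n × Fin n × Fin n =>
    E n q ^ (t.1 : ℕ) * F n q ^ (t.2.1 : ℕ) * K n q ^ (t.2.2 : ℕ))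

theorem monomial_mem (i j l : ℕ) :
    E n q ^ i * F n q ^ j * K n q ^ l ∈ monomialSpan n q := by
  by_cases hi : i < n
  · by_cases hj : j < n
    · have hl : K n q ^ l = K n q ^ (l % n) := by
        conv_lhs => rw [← Nat.mod_add_div l n, pow_add, pow_mul, K_pow, one_pow, mul_one]
      rw [hl]
      exact Submodule.subset_span ⟨(⟨i, hi⟩, ⟨j, hj⟩, ⟨l % n, Nat.mod_lt _ (pos n q)⟩), rfl⟩
    · rw [← Nat.add_sub_cancel' (not_lt.1 hj), pow_add, F_pow]; simp
  · rw [← Nat.add_sub_cancel' (not_lt.1 hi), pow_add, E_pow]; simp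

theorem mul_mem_of_monomial (g : Uq n q)
    (hg : ∀ i j l, g * (E n q ^ i * F n q ^ j * K n q ^ l) ∈ monomialSpan n q)
    {x : Uq n q} (hx : x ∈ monomialSpan n q) : g * x ∈ monomialSpan n q := by
  refine Submodule.span_induction ?_ ?_ ?_ ?_ hx
  · rintro _ ⟨t, rfl⟩; exact hg _ _ _
  · simp
  · intro x y _ _ hx hy; rw [mul_add]; exact Submodule.add_mem _ hx hy
  · intro c x _ hx; rw [mul_smul_comm]; exact Submodule.smul_mem _ _ hx

theorem E_mul_mem {x : Uq n q} (hx : x ∈ monomialSpan n q) :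
    E n q * x ∈ monomialSpan n q := by
  refine mul_mem_of_monomial n q _ (fun i j l => ?_) hx
  rw [← mul_assoc, ← mul_assoc, ← pow_succ']
  exact monomial_mem n q _ _ _

theorem K_mul_mem {x : Uq n q} (hx : x ∈ monomialSpan n q) :
    K n q * x ∈ monomialSpan n q := by
  refine mul_mem_of_monomial n q _ (fun i j l => ?_) hx
  have hE : ∀ i, K n q * E n q ^ i = (q ^ 2) ^ i • (E n q ^ i * K n q) := by
    intro i
    induction i with
    | zero => simp
    | succ i ih =>
      rw [pow_succ (E n q), ← mul_assoc, ih, smul_mul_assoc, mul_assoc, K_mul_E, mul_smul_comm,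
        smul_smul, ← pow_succ, mul_assoc]
  have hF : ∀ i, K n q * F n q ^ i = ((q ^ 2)⁻¹) ^ i • (F n q ^ i * K n q) := by
    intro i
    induction i with
    | zero => simp
    | succ i ih =>
      rw [pow_succ (F n q), ← mul_assoc, ih, smul_mul_assoc, mul_assoc, K_mul_F, mul_smul_comm,
        smul_smul, ← pow_succ, mul_assoc]
  have e : K n q * (E n q ^ i * F n q ^ j * K n q ^ l) =
      ((q ^ 2) ^ i * ((q ^ 2)⁻¹) ^ j) • (E n q ^ i * F n q ^ j * K n q ^ (l + 1)) := by
    rw [← mul_assoc, ← mul_assoc, hE, smul_mul_assoc, mul_assoc (E n q ^ i), hF, mul_smul_comm,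
      smul_smul, smul_mul_assoc, ← mul_assoc, mul_assoc _ (K n q), ← pow_succ']
  rw [e]
  exact Submodule.smul_mem _ _ (monomial_mem n q _ _ _)

theorem K_pow_mul_mem (m : ℕ) {x : Uq n q} (hx : x ∈ monomialSpan n q) :
    K n q ^ m * x ∈ monomialSpan n q := by
  induction m with
  | zero => simpa using hx
  | succ m ih => rw [pow_succ', mul_assoc]; exact K_mul_mem n q ih

theorem F_mul_mem {x : Uq n q} (hx : x ∈ monomialSpan n q) :
    F n q * x ∈ monomialSpan n q := by
  refine mul_mem_of_monomial n q _ (fun i j l => ?_) hx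
  induction i with
  | zero =>
    have := monomial_mem n q 0 (j + 1) l
    simpa [pow_succ', mul_assoc] using this
  | succ i ih =>
    have hFE : F n q * E n q =
        E n q * F n q - (q - q⁻¹)⁻¹ • (K n q - K n q ^ (n - 1)) := by
      rw [← E_mul_F]; abel
    have e : F n q * (E n q ^ (i + 1) * F n q ^ j * K n q ^ l) =
        E n q * (F n q * (E n q ^ i * F n q ^ j * K n q ^ l)) -
          (q - q⁻¹)⁻¹ • (K n q * (E n q ^ i * F n q ^ j * K n q ^ l) -
            K n q ^ (n - 1) * (E n q ^ i * F n q ^ j * K n q ^ l)) := by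
      rw [pow_succ', mul_assoc, mul_assoc (E n q), ← mul_assoc (F n q), hFE, sub_mul,
        smul_mul_assoc, sub_mul]
      simp only [mul_assoc]
    rw [e]
    have hm := monomial_mem n q i j l
    exact Submodule.sub_mem _ (E_mul_mem n q ih) (Submodule.smul_mem _ _
      (Submodule.sub_mem _ (K_mul_mem n q hm) (K_pow_mul_mem n q _ hm)))

theorem monomialSpan_eq_top : monomialSpan n q = ⊤ := by
  rw [eq_top_iff]
  rintro x -
  induction x using induction_left with
  | h1 => simpa using monomial_mem n q 0 0 0
  | hadd x y hx hy => exact Submodule.add_mem _ hx hy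
  | hsmul c x hx => exact Submodule.smul_mem _ _ hx
  | hK x hx => exact K_mul_mem n q hx
  | hE x hx => exact E_mul_mem n q hx
  | hF x hx => exact F_mul_mem n q hx

instance : Module.Finite k (Uq n q) :=
  ⟨by rw [← monomialSpan_eq_top n q]; exact Submodule.fg_span (Set.finite_range _)⟩

/-- `K ↦ diag(q, q⁻¹)`, `E ↦ e₁₂`, `F ↦ e₂₁` satisfy the relations of `u_q(sl₂)`. -/
theorem standard_triple : IsUqTriple n q (!![q, 0; 0, q⁻¹] : Matrix (Fin 2) (Fin 2) k)
    !![0, 1; 0, 0] !![0, 0; 1, 0] := by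
  have hq := ne_zero n q
  have hdiag : ∀ m, (!![q, 0; 0, q⁻¹] : Matrix (Fin 2) (Fin 2) k) ^ m =
      !![q ^ m, 0; 0, q⁻¹ ^ m] := by
    intro m
    induction m with
    | zero => ext i j; fin_cases i <;> fin_cases j <;> simp
    | succ m ih => rw [pow_succ, ih]; ext i j; fin_cases i <;> fin_cases j <;> simp [pow_succ]
  have hn : 2 + (n - 2) = n := by have := IsOddPrimitiveRoot.three_le (n := n) (q := q); lia
  have hqn : q ^ n = 1 := (IsOddPrimitiveRoot.prim (n := n) (q := q)).pow_eq_one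
  have hqi : q ^ (n - 1) = q⁻¹ := by
    refine eq_inv_of_mul_eq_one_left ?_
    rw [← pow_succ, Nat.sub_add_cancel (pos n q), hqn]
  have hs := sub_inv_ne_zero n q
  have hE : (!![0, 1; 0, 0] : Matrix (Fin 2) (Fin 2) k) ^ 2 = 0 := by
    rw [pow_two]; ext i j; fin_cases i <;> fin_cases j <;> simp
  have hF : (!![0, 0; 1, 0] : Matrix (Fin 2) (Fin 2) k) ^ 2 = 0 := by
    rw [pow_two]; ext i j; fin_cases i <;> fin_cases j <;> simp
  constructor
  · rw [hdiag]; ext i j; fin_cases i <;> fin_cases j <;> simp [hqn]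
  · rw [← hn, pow_add, hE, zero_mul]
  · rw [← hn, pow_add, hF, zero_mul]
  · ext i j; fin_cases i <;> fin_cases j <;> simp; field_simp
  · ext i j; fin_cases i <;> fin_cases j <;> simp; field_simp
  · rw [hdiag]
    ext i j; fin_cases i <;> fin_cases j <;> simp [hqi, hs]
    rw [← neg_sub q, mul_neg, inv_mul_cancel₀ hs]

/-- The two-dimensional representation of `u_q(sl₂)` with highest weight `q`. -/
def standardRep : Uq n q →ₐ[k] Matrix (Fin 2) (Fin 2) k := lift (standard_triple n q)

/-- The matrix coefficients of the two-dimensional representation. -/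
def matrixCoeff (i j : Fin 2) : Module.Dual k (Uq n q) :=
  Matrix.entryLinearMap k k i j ∘ₗ (standardRep n q).toLinearMap

end Uq

/-- The Drinfel'd double of `u_q(sl₂)`. -/
abbrev UqDouble {k : Type*} [Field k] (n : ℕ) (q : k) [IsOddPrimitiveRoot n q] : Type _ :=
  DrinfeldDouble k (Uq n q) (Uq.antipode_bijective n q)

namespace UqDouble

variable {k : Type*} [Field k] (n : ℕ) (q : k) [IsOddPrimitiveRoot n q]

/-- The inclusion of `u_q(sl₂)` in its double. -/
abbrev incl (h : Uq n q) : UqDouble n q := DrinfeldDouble.ofHopf (Uq.antipode_bijective n q) h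

/-! The generators `a`, `b`, `c`, `d` of `u_q(sl₂)* ⊆ D(u_q(sl₂))`: the entries of the matrix
`(a b; c d)` of the two-dimensional representation. -/

def a : UqDouble n q := DrinfeldDouble.ofDual _ (Uq.matrixCoeff n q 0 0)
def b : UqDouble n q := DrinfeldDouble.ofDual _ (Uq.matrixCoeff n q 0 1)
def c : UqDouble n q := DrinfeldDouble.ofDual _ (Uq.matrixCoeff n q 1 0)
def d : UqDouble n q := DrinfeldDouble.ofDual _ (Uq.matrixCoeff n q 1 1)

end UqDouble

/-- The algebra `k[u]/(uⁿ - 1)`. -/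
abbrev TruncPoly (k : Type*) [Field k] (n : ℕ) : Type _ :=
  AdjoinRoot (Polynomial.X ^ n - 1 : Polynomial k)

/-- The generator `u` of `k[u]/(uⁿ - 1)`. -/
abbrev TruncPoly.u (k : Type*) [Field k] (n : ℕ) : TruncPoly k n :=
  AdjoinRoot.root (Polynomial.X ^ n - 1 : Polynomial k)

/-- `Φ` makes `k[u]/(uⁿ - 1)` a `D(u_q(sl₂))`-module algebra and restricts to the action `φ` of
`u_q(sl₂)`. -/
def IsDoubleExtension {k : Type*} [Field k] (n : ℕ) (q : k) [IsOddPrimitiveRoot n q]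
    (φ : Uq n q →ₗ[k] Module.End k (TruncPoly k n))
    (Φ : UqDouble n q →ₗ[k] Module.End k (TruncPoly k n)) : Prop :=
  IsModuleAlgebra Φ ∧ ∀ h : Uq n q, Φ (UqDouble.incl n q h) = φ h

/-- Case (i): `a · u = q u`, `b · u = γ (q - q⁻¹) 1`, `c · u = 0`, `d · u = q⁻¹ u`. -/
structure ActsByFirst {k : Type*} [Field k] (n : ℕ) (q : k) [IsOddPrimitiveRoot n q] (γ : k)
    (Φ : UqDouble n q →ₗ[k] Module.End k (TruncPoly k n)) : Prop where
  a_act : Φ (UqDouble.a n q) (TruncPoly.u k n) = q • TruncPoly.u k n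
  b_act : Φ (UqDouble.b n q) (TruncPoly.u k n) = (γ * (q - q⁻¹)) • (1 : TruncPoly k n)
  c_act : Φ (UqDouble.c n q) (TruncPoly.u k n) = 0
  d_act : Φ (UqDouble.d n q) (TruncPoly.u k n) = q⁻¹ • TruncPoly.u k n

/-- Case (ii): `a · u = q⁻¹ u`, `b · u = 0`, `c · u = γ⁻¹ (q - q⁻¹) u²`, `d · u = q u`. -/
structure ActsBySecond {k : Type*} [Field k] (n : ℕ) (q : k) [IsOddPrimitiveRoot n q] (γ : k)
    (Φ : UqDouble n q →ₗ[k] Module.End k (TruncPoly k n)) : Prop where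
  a_act : Φ (UqDouble.a n q) (TruncPoly.u k n) = q⁻¹ • TruncPoly.u k n
  b_act : Φ (UqDouble.b n q) (TruncPoly.u k n) = 0
  c_act : Φ (UqDouble.c n q) (TruncPoly.u k n) = (γ⁻¹ * (q - q⁻¹)) • TruncPoly.u k n ^ 2
  d_act : Φ (UqDouble.d n q) (TruncPoly.u k n) = q • TruncPoly.u k n

end

/-!
Write `H = u_q(sl₂)`. A module algebra structure over `D(H)` is the same as a pair of module algebra
structures over `H` and over `H*ᶜᵒᵖ` that satisfy the straightening rule
`x · p = (x₁ ≻ p ≺ S⁻¹(x₃)) · x₂` (`DrinfeldDouble.isModuleAlgebra_act`,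
`DrinfeldDouble.crosses_dualPart_hopfPart`).

*The two cases.* By the straightening rule for `K`, the matrix coefficients change the weight of
`u` by fixed amounts, so that `a u = α u`, `b u = β 1`, `c u = η u²` and `d u = ω u`. The rules for
`F` and `a`, `d` give `β = γ (α - q⁻¹)` and `α + ω = q + q⁻¹`, while the quantum determinant acts as
the identity and yields `α ω = 1`. Hence `α` is `q` or `q⁻¹`, and the rule for `E` and `a`
determines `η` (`UqDouble.actsByFirst_or_actsBySecond`).

*Uniqueness.* The functionals `bⁱ dˢ cʲ` separate the points of `H`: their pairing with the
monomials `Eⁱ Fʲ Kˡ` is triangular in the exponents of `E` and `F`, and of Vandermonde type in the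
exponent of `K`. As `H` is finite-dimensional, `a`, `b`, `c`, `d` generate `H*`
(`Uq.eq_top_of_matrixCoeff_mem`). They span a subcoalgebra, so that their action on `A` is
determined by their action on `u`, and the action of the double by that of `H` and theirs on `u`
(`UqDouble.eq_of_coeffAct_eq`).

*Existence.* An action of `H*` on `A` is a coaction `κ : A → A ⊗ H`, via `p · w = p(w₁) w₀`. As `A`
is commutative, `A` is a module algebra over `H*ᶜᵒᵖ` if `κ` is an algebra homomorphism. The
straightening rule turns into the Yetter-Drinfel'd condition, which can be checked for the
generators of `H` and on a generator of `A` (`Uq.isModuleAlgebra_act_dualAct`). The two extensions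
come from the coactions `u ↦ u ⊗ K + γ (q - q⁻¹) 1 ⊗ E` and
`u⁻¹ ↦ u⁻¹ ⊗ K - γ⁻¹ (q - q⁻¹) q⁻¹ 1 ⊗ F K` (`UqDouble.exists_actsByFirst`,
`UqDouble.exists_actsBySecond`). These respect `uⁿ = 1` by the `ζ`-binomial formula, since `ζ = q²`
is a primitive `n`-th root of unity and `Eⁿ = (F K)ⁿ = 0`.
-/

noncomputable section

/-! ### Multiplication in the Drinfel'd double -/

namespace DrinfeldDouble

open DoubleConstruction

variable {k H : Type*} [Field k] [Ring H] [HopfAlgebra k H]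

theorem dualMul_apply (p r : Module.Dual k H) (x : H) :
    dualMul k H p r x = LinearMap.mul' k k (TensorProduct.map p r (Coalgebra.comul x)) := rfl

theorem dualMul_eq_conv (p r : Module.Dual k H) :
    dualMul k H p r = (WithConv.toConv p * WithConv.toConv r).ofConv := rfl

theorem counit_dualMul (p : Module.Dual k H) : dualMul k H Coalgebra.counit p = p := by
  rw [dualMul_eq_conv]
  exact congrArg WithConv.ofConv (one_mul (WithConv.toConv p))

theorem dualMul_counit (p : Module.Dual k H) : dualMul k H p Coalgebra.counit = p := by
  rw [dualMul_eq_conv]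
  exact congrArg WithConv.ofConv (mul_one (WithConv.toConv p))

@[simp] theorem transposeAct_apply (x y z : H) (p : Module.Dual k H) :
    transposeAct k H x y p z = p (y * (z * x)) := rfl

theorem transposeAct_transposeAct (x y x' y' : H) (p : Module.Dual k H) :
    transposeAct k H x y (transposeAct k H x' y' p) = transposeAct k H (x * x') (y' * y) p := by
  ext z; simp [mul_assoc]

theorem straightenAux_tmul (T : H →ₗ[k] H) (x y z : H) (p : Module.Dual k H) :
    straightenAux T (x ⊗ₜ (y ⊗ₜ z)) p = transposeAct k H x (T z) p ⊗ₜ y := rfl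

theorem straighten_apply (T : H →ₗ[k] H) (x : H) :
    straighten T x = straightenAux T (Coalgebra.comul.lTensor H (Coalgebra.comul x)) := rfl

theorem dualDistribEquiv_dualComul [Module.Finite k H] (p : Module.Dual k H) :
    TensorProduct.dualDistrib k H H (dualComul k H p) = p ∘ₗ LinearMap.mul' k H :=
  (TensorProduct.dualDistribEquiv k H H).apply_symm_apply (p ∘ₗ LinearMap.mul' k H)

variable (hS : Function.Bijective (HopfAlgebra.antipode k (A := H)))

theorem pure_mul_pure (p r : Module.Dual k H) (x y : H) :
    pure hS p x * pure hS r y =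
      (TensorProduct.map (dualMul k H p) (LinearMap.mulRight k y)
        (straighten (antipodeInv hS) x r) : Module.Dual k H ⊗[k] H) := rfl

theorem straighten_one (T : H →ₗ[k] H) (hT : T 1 = 1) (p : Module.Dual k H) :
    straighten T 1 p = p ⊗ₜ 1 := by
  rw [straighten_apply, Bialgebra.comul_one, Algebra.TensorProduct.one_def,
    LinearMap.lTensor_tmul, Bialgebra.comul_one, Algebra.TensorProduct.one_def,
    straightenAux_tmul, hT]
  congr 1
  ext z; simp

theorem antipodeInv_antipode (x : H) : antipodeInv hS (HopfAlgebra.antipode k x) = x :=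
  (LinearEquiv.ofBijective (HopfAlgebra.antipode k (A := H)) hS).symm_apply_apply x

theorem antipode_antipodeInv (x : H) : HopfAlgebra.antipode k (antipodeInv hS x) = x :=
  (LinearEquiv.ofBijective (HopfAlgebra.antipode k (A := H)) hS).apply_symm_apply x

theorem antipodeInv_one : antipodeInv hS 1 = 1 := by
  conv_lhs => rw [← HopfAlgebra.antipode_one (R := k) (A := H)]
  exact antipodeInv_antipode hS 1

theorem antipodeInv_mul (x y : H) :
    antipodeInv hS (x * y) = antipodeInv hS y * antipodeInv hS x := by
  apply hS.1
  rw [HopfAlgebra.antipode_mul_antidistrib, antipode_antipodeInv, antipode_antipodeInv,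
    antipode_antipodeInv]

theorem ofDual_mul_ofDual (p r : Module.Dual k H) :
    ofDual hS p * ofDual hS r = ofDual hS (dualMul k H p r) := by
  rw [ofDual, ofDual, pure_mul_pure, straighten_one _ (antipodeInv_one hS),
    TensorProduct.map_tmul, LinearMap.mulRight_apply, one_mul]
  rfl

theorem ofDual_mul_ofHopf (p : Module.Dual k H) (x : H) :
    ofDual hS p * ofHopf hS x = pure hS p x := by
  rw [ofDual, ofHopf, pure_mul_pure, straighten_one _ (antipodeInv_one hS),
    TensorProduct.map_tmul, LinearMap.mulRight_apply, one_mul, dualMul_counit]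
  rfl

theorem ofHopf_mul_ofDual (p : Module.Dual k H) (x : H) :
    ofHopf hS x * ofDual hS p =
      (straighten (antipodeInv hS) x p : Module.Dual k H ⊗[k] H) := by
  have e1 : dualMul k H (Coalgebra.counit : H →ₗ[k] k) = LinearMap.id :=
    LinearMap.ext fun p => counit_dualMul p
  have e2 : LinearMap.mulRight k (1 : H) = LinearMap.id := by ext; simp
  rw [ofDual, ofHopf, pure_mul_pure, e1, e2, TensorProduct.map_id]
  rfl

theorem comul_pure [Module.Finite k H] (p : Module.Dual k H) (x : H) :
    CoalgebraStruct.comul (R := k) (pure hS p x) =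
      (TensorProduct.tensorTensorTensorComm k
        (Module.Dual k H) (Module.Dual k H) H H
          (TensorProduct.comm k (Module.Dual k H) (Module.Dual k H) (dualComul k H p) ⊗ₜ[k]
            Coalgebra.comul x) :
        (Module.Dual k H ⊗[k] H) ⊗[k] (Module.Dual k H ⊗[k] H)) := rfl

theorem counit_pure [Module.Finite k H] (p : Module.Dual k H) (x : H) :
    CoalgebraStruct.counit (R := k) (pure hS p x) = p 1 * Coalgebra.counit (R := k) x := rfl

/-- Linear maps on the double that agree on simple tensors are equal. -/
theorem linearMap_ext {B : Type*} [AddCommGroup B] [Module k B]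
    {f g : DrinfeldDouble k H hS →ₗ[k] B} (h : ∀ p x, f (pure hS p x) = g (pure hS p x)) : f = g :=
  TensorProduct.ext' h

/-- Induction on an element of the double as a sum of simple tensors. -/
theorem induction_pure {motive : DrinfeldDouble k H hS → Prop} (g : DrinfeldDouble k H hS)
    (zero : motive 0) (add : ∀ g h, motive g → motive h → motive (g + h))
    (pure : ∀ p x, motive (pure hS p x)) : motive g :=
  TensorProduct.induction_on g zero pure add

/-- The multiplication of the double as a bilinear map. -/
def mulLin : DrinfeldDouble k H hS →ₗ[k] DrinfeldDouble k H hS →ₗ[k] DrinfeldDouble k H hS :=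
  doubleMul (antipodeInv hS)

theorem mul_eq_mulLin (g h : DrinfeldDouble k H hS) : g * h = mulLin hS g h := rfl

end DrinfeldDouble

/-! ### Module algebras over the double from compatible actions of its two factors -/

namespace DrinfeldDouble

open DoubleConstruction

variable {k H A : Type*} [Field k] [Ring H] [HopfAlgebra k H] [Ring A] [Algebra k A]

/-- The linear map `p ⊗ x ↦ P p ∘ φ x` obtained from linear maps `P` on `H*` and `φ` on `H`. -/
def combine (P : Module.Dual k H →ₗ[k] Module.End k A) (φ : H →ₗ[k] Module.End k A) :
    Module.Dual k H ⊗[k] H →ₗ[k] Module.End k A :=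
  TensorProduct.lift ((LinearMap.mul k (Module.End k A)).compl₁₂ P φ)

@[simp] theorem combine_tmul (P : Module.Dual k H →ₗ[k] Module.End k A)
    (φ : H →ₗ[k] Module.End k A) (p : Module.Dual k H) (x : H) :
    combine P φ (p ⊗ₜ x) = P p * φ x := rfl

/-- The straightening rule `x · p = (x₁ ≻ p ≺ T x₃) · x₂` for the actions `φ` of `x` and `P` of
all `p`. -/
def Crosses (T : H →ₗ[k] H) (P : Module.Dual k H →ₗ[k] Module.End k A)
    (φ : H →ₗ[k] Module.End k A) (x : H) : Prop :=
  ∀ p, φ x * P p = combine P φ (straighten T x p)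

section Crosses

variable {T : H →ₗ[k] H} {P : Module.Dual k H →ₗ[k] Module.End k A}
  {φ : H →ₗ[k] Module.End k A}

theorem Crosses.add {x y : H} (hx : Crosses T P φ x) (hy : Crosses T P φ y) :
    Crosses T P φ (x + y) := fun p => by
  rw [map_add, map_add, add_mul, hx p, hy p, LinearMap.add_apply, map_add]

theorem Crosses.smul {x : H} (c : k) (hx : Crosses T P φ x) : Crosses T P φ (c • x) := fun p => by
  rw [map_smul, map_smul, smul_mul_assoc, hx p, LinearMap.smul_apply, map_smul]

theorem Crosses.one (hT : T 1 = 1) (hφ : φ 1 = 1) : Crosses T P φ 1 := fun p => by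
  rw [straighten_one T hT, combine_tmul, hφ, one_mul, mul_one]

/-- The straightening rule is multiplicative, as `T` is an antihomomorphism. -/
theorem Crosses.mul (hT : ∀ x y, T (x * y) = T y * T x) (hφ : ∀ x y, φ (x * y) = φ x * φ y)
    {x y : H} (hx : Crosses T P φ x) (hy : Crosses T P φ y) : Crosses T P φ (x * y) := by
  have pure_right : ∀ (X : H ⊗[k] (H ⊗[k] H)) (y₁ y₂ y₃ : H) (p : Module.Dual k H),
      combine P φ (straightenAux T (X * (y₁ ⊗ₜ (y₂ ⊗ₜ y₃))) p) =
        combine P φ (straightenAux T X (transposeAct k H y₁ (T y₃) p)) * φ y₂ := by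
    intro X y₁ y₂ y₃ p
    induction X with
    | zero => simp
    | add X X' hX hX' => simp only [add_mul, map_add, LinearMap.add_apply, hX, hX']
    | tmul x₁ X =>
      induction X with
      | zero => simp
      | add X X' hX hX' =>
        simp only [TensorProduct.tmul_add, add_mul, map_add, LinearMap.add_apply, hX, hX']
      | tmul x₂ x₃ =>
        simp only [Algebra.TensorProduct.tmul_mul_tmul, straightenAux_tmul, combine_tmul, hT, hφ,
          transposeAct_transposeAct, mul_assoc]
  have left : ∀ (Y : H ⊗[k] (H ⊗[k] H)) (p : Module.Dual k H),
      combine P φ (straightenAux T (Coalgebra.comul.lTensor H (Coalgebra.comul x) * Y) p) =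
        φ x * combine P φ (straightenAux T Y p) := by
    intro Y p
    induction Y with
    | zero => simp
    | add Y Y' hY hY' => simp only [mul_add, map_add, LinearMap.add_apply, hY, hY']
    | tmul y₁ Y =>
      induction Y with
      | zero => simp
      | add Y Y' hY hY' =>
        simp only [TensorProduct.tmul_add, mul_add, map_add, LinearMap.add_apply, hY, hY']
      | tmul y₂ y₃ =>
        rw [pure_right, ← straighten_apply, ← hx, straightenAux_tmul, combine_tmul, mul_assoc]
  intro p
  have e : Coalgebra.comul.lTensor H (Coalgebra.comul (R := k) (x * y)) =
      Coalgebra.comul.lTensor H (Coalgebra.comul (R := k) x) *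
        Coalgebra.comul.lTensor H (Coalgebra.comul (R := k) y) := by
    rw [Bialgebra.comul_mul]
    exact map_mul (Algebra.TensorProduct.map (AlgHom.id k H) (Bialgebra.comulAlgHom k H)) _ _
  rw [hφ, mul_assoc, hy, straighten_apply, straighten_apply, e, left]

end Crosses

variable (hS : Function.Bijective (HopfAlgebra.antipode k (A := H)))

/-- The action of the double given by actions of `H*` and of `H`. -/
def act (P : Module.Dual k H →ₗ[k] Module.End k A) (φ : H →ₗ[k] Module.End k A) :
    DrinfeldDouble k H hS →ₗ[k] Module.End k A := combine P φ

@[simp] theorem act_pure (P : Module.Dual k H →ₗ[k] Module.End k A)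
    (φ : H →ₗ[k] Module.End k A) (p : Module.Dual k H) (x : H) :
    act hS P φ (pure hS p x) = P p * φ x := rfl

/-- An `H`-module algebra and an `H*ᶜᵒᵖ`-module algebra structure that satisfy the straightening
rule combine to a module algebra structure over the double. -/
theorem isModuleAlgebra_act [Module.Finite k H] {P : Module.Dual k H →ₗ[k] Module.End k A}
    {φ : H →ₗ[k] Module.End k A} (hφ : IsModuleAlgebra φ)
    (P_counit : P Coalgebra.counit = 1)
    (P_mul : ∀ p r, P (dualMul k H p r) = P p * P r)
    (P_act_mul : ∀ p v w, P p (v * w) = LinearMap.mul' k A (TensorProduct.map (P.flip v) (P.flip w)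
      (TensorProduct.comm k _ _ (dualComul k H p))))
    (P_act_one : ∀ p, P p 1 = p 1 • (1 : A))
    (cross : ∀ x, Crosses (antipodeInv hS) P φ x) :
    IsModuleAlgebra (act hS P φ) where
  one_act x := by
    change (P Coalgebra.counit * φ 1) x = x
    rw [P_counit, one_mul, hφ.one_act]
  mul_act g h x := by
    have key : ∀ (p : Module.Dual k H) (y : H) (t : Module.Dual k H ⊗[k] H),
        combine P φ (TensorProduct.map (dualMul k H p) (LinearMap.mulRight k y) t) =
          P p * combine P φ t * φ y := by
      intro p y t
      induction t with
      | zero => simp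
      | add t t' ht ht' => simp only [map_add, mul_add, add_mul, ht, ht']
      | tmul r z =>
        have e : φ (z * y) = φ z * φ y := LinearMap.ext fun v => hφ.mul_act z y v
        simp only [TensorProduct.map_tmul, combine_tmul, P_mul, LinearMap.mulRight_apply, e,
          mul_assoc]
    have : ∀ g h : DrinfeldDouble k H hS, act hS P φ (g * h) = act hS P φ g * act hS P φ h := by
      intro g h
      induction g using induction_pure with
      | zero => simp only [mul_eq_mulLin, map_zero, LinearMap.zero_apply, zero_mul]
      | add g g' hg hg' =>
        simp only [mul_eq_mulLin, map_add, LinearMap.add_apply, add_mul] at hg hg' ⊢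
        rw [hg, hg']
      | pure p x =>
        induction h using induction_pure with
        | zero => simp only [mul_eq_mulLin, map_zero, mul_zero]
        | add h h' hh hh' =>
          simp only [mul_eq_mulLin, map_add, mul_add] at hh hh' ⊢
          rw [hh, hh']
        | pure r y =>
          change combine P φ (TensorProduct.map (dualMul k H p) (LinearMap.mulRight k y)
            (straighten (antipodeInv hS) x r)) = (P p * φ x) * (P r * φ y)
          rw [key, ← cross x r]
          simp only [mul_assoc]
    rw [this]; rfl
  act_mul h x y := by
    have key' : ∀ (p : Module.Dual k H) (t : H ⊗[k] H),
        P p (LinearMap.mul' k A (TensorProduct.map (φ.flip x) (φ.flip y) t)) =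
        LinearMap.mul' k A (TensorProduct.map ((combine P φ).flip x) ((combine P φ).flip y)
          (TensorProduct.tensorTensorTensorComm k _ _ H H
            (TensorProduct.comm k _ _ (dualComul k H p) ⊗ₜ t))) := by
      intro p t
      induction t with
      | zero => simp
      | add t t' ht ht' => simp only [map_add, TensorProduct.tmul_add, ht, ht']
      | tmul x₁ x₂ =>
        rw [TensorProduct.map_tmul, LinearMap.mul'_apply, LinearMap.flip_apply,
          LinearMap.flip_apply, P_act_mul]
        generalize TensorProduct.comm k _ _ (dualComul k H p) = s
        induction s with
        | zero => simp
        | add s s' hs hs' => simp only [map_add, TensorProduct.add_tmul, hs, hs']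
        | tmul p₁ p₂ => simp
    induction h using induction_pure with
    | zero => simp
    | add g g' hg hg' => simp only [map_add, LinearMap.add_apply, hg, hg']
    | pure p z =>
      change P p (φ z (x * y)) = _
      rw [hφ.act_mul, key']
      rfl
  act_one h := by
    induction h using induction_pure with
    | zero => simp
    | add g g' hg hg' => simp only [map_add, LinearMap.add_apply, hg, hg', add_smul]
    | pure p z =>
      change P p (φ z 1) = (p 1 * Coalgebra.counit (R := k) z) • (1 : A)
      rw [hφ.act_one, map_smul, P_act_one, smul_smul, mul_comm]

section Restriction

variable {hS}
variable (Φ : DrinfeldDouble k H hS →ₗ[k] Module.End k A)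

/-- The restriction of an action of the double to `H*`. -/
def dualPart : Module.Dual k H →ₗ[k] Module.End k A :=
  Φ ∘ₗ (TensorProduct.mk k (Module.Dual k H) H).flip 1

/-- The restriction of an action of the double to `H`. -/
def hopfPart : H →ₗ[k] Module.End k A :=
  Φ ∘ₗ TensorProduct.mk k (Module.Dual k H) H Coalgebra.counit

theorem dualPart_apply (p : Module.Dual k H) : dualPart Φ p = Φ (ofDual hS p) := rfl

theorem hopfPart_apply (x : H) : hopfPart Φ x = Φ (ofHopf hS x) := rfl

variable {Φ} [Module.Finite k H] (hΦ : IsModuleAlgebra Φ)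

include hΦ

theorem map_mul_of_isModuleAlgebra (g h : DrinfeldDouble k H hS) : Φ (g * h) = Φ g * Φ h :=
  LinearMap.ext fun x => hΦ.mul_act g h x

/-- An action of the double is determined by its restrictions to the two factors. -/
theorem act_dualPart_hopfPart : act hS (dualPart Φ) (hopfPart Φ) = Φ :=
  linearMap_ext hS fun p x => by
    rw [← ofDual_mul_ofHopf, map_mul_of_isModuleAlgebra hΦ, ofDual_mul_ofHopf]
    rfl

theorem crosses_dualPart_hopfPart (x : H) :
    Crosses (antipodeInv hS) (dualPart Φ) (hopfPart Φ) x := by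
  intro p
  rw [hopfPart_apply, dualPart_apply, ← map_mul_of_isModuleAlgebra hΦ, ofHopf_mul_ofDual]
  exact (LinearMap.congr_fun (act_dualPart_hopfPart hΦ) _).symm

theorem dualPart_dualMul (p r : Module.Dual k H) :
    dualPart Φ (dualMul k H p r) = dualPart Φ p * dualPart Φ r := by
  rw [dualPart_apply, ← ofDual_mul_ofDual, map_mul_of_isModuleAlgebra hΦ]
  rfl

theorem dualPart_counit : dualPart Φ Coalgebra.counit = 1 :=
  LinearMap.ext hΦ.one_act

end Restriction

end DrinfeldDouble

/-! ### Comodules as modules over the dual -/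

section Comodule

open DoubleConstruction

variable {k H A : Type*} [Field k] [Ring H] [HopfAlgebra k H] [CommRing A] [Algebra k A]

/-- The contraction `a ⊗ h ↦ p(h) a` of `A ⊗ H` with `p ∈ H*`. -/
def contract : Module.Dual k H →ₗ[k] A ⊗[k] H →ₗ[k] A :=
  LinearMap.compRight k (TensorProduct.rid k A).toLinearMap ∘ₗ LinearMap.lTensorHom A

@[simp] theorem contract_tmul (p : Module.Dual k H) (a : A) (h : H) :
    contract p (a ⊗ₜ[k] h) = p h • a := by
  simp [contract]

theorem contract_transposeAct (x y : H) (p : Module.Dual k H) (X : A ⊗[k] H) :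
    contract (transposeAct k H x y p) X = contract p ((1 ⊗ₜ y) * X * (1 ⊗ₜ x)) := by
  induction X with
  | zero => simp
  | add X X' hX hX' => simp only [map_add, mul_add, add_mul, hX, hX']
  | tmul a h => simp [mul_assoc]

theorem map_contract (f : Module.End k A) (p : Module.Dual k H) (X : A ⊗[k] H) :
    f (contract p X) = contract p (f.rTensor H X) := by
  induction X with
  | zero => simp
  | add X X' hX hX' => simp only [map_add, hX, hX']
  | tmul a h => simp

/-- The operators `a ↦ p(a₁) a₀` for a linear map `κ(a) = a₀ ⊗ a₁`. -/
def dualAct (κ : A →ₐ[k] A ⊗[k] H) : Module.Dual k H →ₗ[k] Module.End k A :=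
  LinearMap.lcomp k A κ.toLinearMap ∘ₗ contract

@[simp] theorem dualAct_apply (κ : A →ₐ[k] A ⊗[k] H) (p : Module.Dual k H) (a : A) :
    dualAct κ p a = contract p (κ a) := rfl

theorem dualAct_mul (κ : A →ₐ[k] A ⊗[k] H)
    (hκ : ∀ a, TensorProduct.assoc k A H H (κ.toLinearMap.rTensor H (κ a)) =
      Coalgebra.comul.lTensor A (κ a)) (p r : Module.Dual k H) :
    dualAct κ (dualMul k H p r) = dualAct κ p * dualAct κ r := by
  set m : H ⊗[k] H →ₗ[k] k := LinearMap.mul' k k ∘ₗ TensorProduct.map p r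
  have left : ∀ X : A ⊗[k] H, contract (dualMul k H p r) X =
      TensorProduct.rid k A (m.lTensor A (Coalgebra.comul.lTensor A X)) := by
    intro X
    induction X with
    | zero => simp
    | add X X' hX hX' => simp only [map_add, hX, hX']
    | tmul a h => simp [m, DrinfeldDouble.dualMul_apply]
  have right : ∀ X : A ⊗[k] H, contract p (κ (contract r X)) =
      TensorProduct.rid k A (m.lTensor A
        (TensorProduct.assoc k A H H (κ.toLinearMap.rTensor H X))) := by
    intro X
    induction X with
    | zero => simp
    | add X X' hX hX' => simp only [map_add, hX, hX']
    | tmul a h =>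
      simp only [contract_tmul, map_smul, LinearMap.rTensor_tmul, AlgHom.toLinearMap_apply]
      generalize κ a = Y
      induction Y with
      | zero => simp
      | add X X' hX hX' => simp only [map_add, smul_add, TensorProduct.add_tmul, hX, hX']
      | tmul b g => simp [m, smul_smul, mul_comm]
  refine LinearMap.ext fun a => ?_
  rw [Module.End.mul_apply, dualAct_apply, dualAct_apply, dualAct_apply, left, right, hκ]

/-- As `A` is commutative, an algebra homomorphism `A → A ⊗ H` is also one to `A ⊗ Hᵒᵖ`, whence
the action of `H*` is compatible with the opposite coproduct. -/
theorem dualAct_apply_mul [Module.Finite k H] (κ : A →ₐ[k] A ⊗[k] H) (p : Module.Dual k H)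
    (v w : A) :
    dualAct κ p (v * w) = LinearMap.mul' k A
      (TensorProduct.map ((dualAct κ).flip v) ((dualAct κ).flip w)
        (TensorProduct.comm k _ _ (dualComul k H p))) := by
  have key : ∀ (s : Module.Dual k H ⊗[k] Module.Dual k H) (a b : A) (g h : H),
      TensorProduct.dualDistrib k H H s (g ⊗ₜ h) • (b * a) = LinearMap.mul' k A
        (TensorProduct.map (contract.flip (a ⊗ₜ[k] h)) (contract.flip (b ⊗ₜ[k] g))
          (TensorProduct.comm k _ _ s)) := by
    intro s a b g h
    induction s with
    | zero => simp
    | add s s' hs hs' => simp only [map_add, LinearMap.add_apply, add_smul, hs, hs']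
    | tmul p₁ p₂ => simp [smul_smul, mul_comm]
  have key' : ∀ X Y : A ⊗[k] H, contract p (Y * X) = LinearMap.mul' k A
      (TensorProduct.map (contract.flip X) (contract.flip Y)
        (TensorProduct.comm k _ _ (dualComul k H p))) := by
    intro X Y
    induction X with
    | zero => simp [TensorProduct.map_zero_left]
    | add X X' hX hX' =>
      simp only [map_add, mul_add, TensorProduct.map_add_left, LinearMap.add_apply, hX, hX']
    | tmul a h =>
      induction Y with
      | zero => simp [TensorProduct.map_zero_right]
      | add Y Y' hY hY' =>
        simp only [map_add, add_mul, TensorProduct.map_add_right, LinearMap.add_apply, hY, hY']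
      | tmul b g =>
        rw [← key, DrinfeldDouble.dualDistribEquiv_dualComul]
        simp
  rw [dualAct_apply, mul_comm v w, map_mul, key']
  rfl

theorem dualAct_one (κ : A →ₐ[k] A ⊗[k] H) (p : Module.Dual k H) :
    dualAct κ p 1 = p 1 • (1 : A) := by
  rw [dualAct_apply, map_one, Algebra.TensorProduct.one_def, contract_tmul]

end Comodule

/-! ### The straightening rule for the generators of `u_q(sl₂)` -/

namespace Uq

open IsOddPrimitiveRoot DrinfeldDouble

variable {k : Type*} [Field k] (n : ℕ) (q : k) [IsOddPrimitiveRoot n q]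

theorem antipodeInv_eq (x : Uq n q) :
    antipodeInv (antipode_bijective n q) x = antipodeInvLin n q x := by
  apply (antipode_bijective n q).1
  rw [DrinfeldDouble.antipode_antipodeInv]
  exact (antipode_antipodeInv n q x).symm

theorem comul_K_pow (m : ℕ) :
    Coalgebra.comul (R := k) (K n q ^ m) = (K n q ^ m) ⊗ₜ[k] (K n q ^ m) := by
  rw [Bialgebra.comul_pow, comul_K, Algebra.TensorProduct.tmul_pow]

section Straighten

open DoubleConstruction

variable {n q}

local notation "T" => antipodeInv (antipode_bijective n q)
local notation "K⁻" => K n q ^ (n - 1)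

theorem straighten_K (p : Module.Dual k (Uq n q)) :
    straighten T (K n q) p = transposeAct k _ (K n q) K⁻ p ⊗ₜ K n q := by
  rw [straighten_apply, comul_K, LinearMap.lTensor_tmul, comul_K, straightenAux_tmul,
    antipodeInv_eq, antipodeInvLin_K]

theorem straighten_E (p : Module.Dual k (Uq n q)) :
    straighten T (E n q) p =
      transposeAct k _ 1 (-(K⁻ * E n q)) p ⊗ₜ 1 + transposeAct k _ 1 K⁻ p ⊗ₜ E n q +
        transposeAct k _ (E n q) K⁻ p ⊗ₜ K n q := by
  rw [straighten_apply, comul_E, map_add, LinearMap.lTensor_tmul, LinearMap.lTensor_tmul,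
    comul_K, comul_E, TensorProduct.tmul_add, map_add, map_add, LinearMap.add_apply,
    LinearMap.add_apply, straightenAux_tmul, straightenAux_tmul, straightenAux_tmul,
    antipodeInv_eq, antipodeInv_eq, antipodeInvLin_K, antipodeInvLin_E]

theorem straighten_F (p : Module.Dual k (Uq n q)) :
    straighten T (F n q) p =
      transposeAct k _ K⁻ (-(F n q * K n q)) p ⊗ₜ K⁻ + transposeAct k _ K⁻ 1 p ⊗ₜ F n q +
        transposeAct k _ (F n q) 1 p ⊗ₜ 1 := by
  rw [straighten_apply, comul_F, map_add, LinearMap.lTensor_tmul, LinearMap.lTensor_tmul,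
    Bialgebra.comul_one, comul_F, Algebra.TensorProduct.one_def, TensorProduct.tmul_add, map_add,
    map_add, LinearMap.add_apply, LinearMap.add_apply, straightenAux_tmul, straightenAux_tmul,
    straightenAux_tmul, antipodeInv_eq, antipodeInv_eq, antipodeInvLin_F, antipodeInvLin_one]

end Straighten

end Uq

namespace IsModuleAlgebra

variable {k : Type*} [Field k] {n : ℕ} {q : k} [IsOddPrimitiveRoot n q]
  {A : Type*} [Ring A] [Algebra k A] {φ : Uq n q →ₗ[k] Module.End k A}

open Uq

theorem K_mul (hφ : IsModuleAlgebra φ) (x y : A) :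
    φ (K n q) (x * y) = φ (K n q) x * φ (K n q) y := by
  rw [hφ.act_mul]
  rw [comul_K]
  simp

theorem K_pow_mul (hφ : IsModuleAlgebra φ) (m : ℕ) (x y : A) :
    φ (K n q ^ m) (x * y) = φ (K n q ^ m) x * φ (K n q ^ m) y := by
  rw [hφ.act_mul]
  rw [comul_K_pow]
  simp

theorem E_mul (hφ : IsModuleAlgebra φ) (x y : A) :
    φ (E n q) (x * y) = x * φ (E n q) y + φ (E n q) x * φ (K n q) y := by
  rw [hφ.act_mul]
  rw [comul_E]
  simp [hφ.one_act]

theorem F_mul (hφ : IsModuleAlgebra φ) (x y : A) :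
    φ (F n q) (x * y) = φ (K n q ^ (n - 1)) x * φ (F n q) y + φ (F n q) x * y := by
  rw [hφ.act_mul]
  rw [comul_F]
  simp [hφ.one_act]

theorem K_one (hφ : IsModuleAlgebra φ) : φ (K n q) 1 = 1 := by
  rw [hφ.act_one]; rw [counit_K]; rw [one_smul]

theorem E_one (hφ : IsModuleAlgebra φ) : φ (E n q) 1 = 0 := by
  rw [hφ.act_one]; rw [counit_E]; rw [zero_smul]

theorem F_one (hφ : IsModuleAlgebra φ) : φ (F n q) 1 = 0 := by
  rw [hφ.act_one]; rw [counit_F]; rw [zero_smul]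

theorem K_inv_K (hφ : IsModuleAlgebra φ) (x : A) :
    φ (K n q ^ (n - 1)) (φ (K n q) x) = x := by
  rw [← hφ.mul_act, isUqTriple.inv_mul_K, hφ.one_act]

theorem K_K_inv (hφ : IsModuleAlgebra φ) (x : A) :
    φ (K n q) (φ (K n q ^ (n - 1)) x) = x := by
  rw [← hφ.mul_act, isUqTriple.K_mul_inv, hφ.one_act]

end IsModuleAlgebra

/-! ### Compatible coactions of `u_q(sl₂)` -/

namespace Uq

open IsOddPrimitiveRoot DrinfeldDouble DoubleConstruction

variable {k : Type*} [Field k] {n : ℕ} {q : k} [IsOddPrimitiveRoot n q]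
  {A : Type*} [CommRing A] [Algebra k A]

/-- The Yetter-Drinfel'd condition `x₁ v₀ ⊗ x₂ v₁ = (x₂ v)₀ ⊗ (x₂ v)₁ x₁` for `x = K`. -/
def YetterDrinfeldK (φ : Uq n q →ₗ[k] Module.End k A) (κ : A →ₐ[k] A ⊗[k] Uq n q) (v : A) : Prop :=
  (1 ⊗ₜ K n q) * (φ (K n q)).rTensor _ (κ v) = κ (φ (K n q) v) * (1 ⊗ₜ K n q)

/-- The Yetter-Drinfel'd condition `x₁ v₀ ⊗ x₂ v₁ = (x₂ v)₀ ⊗ (x₂ v)₁ x₁` for `x = E`. -/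
def YetterDrinfeldE (φ : Uq n q →ₗ[k] Module.End k A) (κ : A →ₐ[k] A ⊗[k] Uq n q) (v : A) : Prop :=
  (1 ⊗ₜ E n q) * κ v + (1 ⊗ₜ K n q) * (φ (E n q)).rTensor _ (κ v) =
    κ (φ (E n q) v) + κ (φ (K n q) v) * (1 ⊗ₜ E n q)

/-- The Yetter-Drinfel'd condition `x₁ v₀ ⊗ x₂ v₁ = (x₂ v)₀ ⊗ (x₂ v)₁ x₁` for `x = F`. -/
def YetterDrinfeldF (φ : Uq n q →ₗ[k] Module.End k A) (κ : A →ₐ[k] A ⊗[k] Uq n q) (v : A) : Prop :=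
  (1 ⊗ₜ F n q) * (φ (K n q ^ (n - 1))).rTensor _ (κ v) + (φ (F n q)).rTensor _ (κ v) =
    κ (φ (F n q) v) * (1 ⊗ₜ (K n q ^ (n - 1))) + κ v * (1 ⊗ₜ F n q)

variable {φ : Uq n q →ₗ[k] Module.End k A} {κ : A →ₐ[k] A ⊗[k] Uq n q}

theorem rTensor_K_mul (hφ : IsModuleAlgebra φ) (X Y : A ⊗[k] Uq n q) :
    (φ (K n q)).rTensor _ (X * Y) = (φ (K n q)).rTensor _ X * (φ (K n q)).rTensor _ Y := by
  induction X with
  | zero => simp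
  | add X X' hX hX' => simp only [map_add, add_mul, hX, hX']
  | tmul a h =>
    induction Y with
    | zero => simp
    | add X X' hX hX' => simp only [map_add, mul_add, hX, hX']
    | tmul b g => simp [hφ.K_mul]

theorem rTensor_E_mul (hφ : IsModuleAlgebra φ) (X Y : A ⊗[k] Uq n q) :
    (φ (E n q)).rTensor _ (X * Y) =
      (φ (E n q)).rTensor _ X * Y + (φ (K n q)).rTensor _ X * (φ (E n q)).rTensor _ Y := by
  induction X with
  | zero => simp
  | add X X' hX hX' => simp only [map_add, add_mul, hX, hX']; abel
  | tmul a h =>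
    induction Y with
    | zero => simp
    | add X X' hX hX' => simp only [map_add, mul_add, hX, hX']; abel
    | tmul b g =>
      have e : φ (E n q) (a * b) = φ (E n q) a * b + φ (K n q) a * φ (E n q) b := by
        rw [mul_comm a b, hφ.E_mul, mul_comm b, mul_comm (φ (E n q) b)]
      simp [e, TensorProduct.add_tmul]

theorem rTensor_F_mul (hφ : IsModuleAlgebra φ) (X Y : A ⊗[k] Uq n q) :
    (φ (F n q)).rTensor _ (X * Y) =
      X * (φ (F n q)).rTensor _ Y +
        (φ (F n q)).rTensor _ X * (φ (K n q ^ (n - 1))).rTensor _ Y := by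
  induction X with
  | zero => simp
  | add X X' hX hX' => simp only [map_add, add_mul, hX, hX']; abel
  | tmul a h =>
    induction Y with
    | zero => simp
    | add X X' hX hX' => simp only [map_add, mul_add, hX, hX']; abel
    | tmul b g =>
      have e : φ (F n q) (a * b) =
          a * φ (F n q) b + φ (F n q) a * φ (K n q ^ (n - 1)) b := by
        rw [mul_comm a b, hφ.F_mul, mul_comm (φ (F n q) b), add_comm,
          mul_comm (φ (K n q ^ (n - 1)) b)]
      simp [e, TensorProduct.add_tmul]

theorem rTensor_K_pow_mul (hφ : IsModuleAlgebra φ) (m : ℕ) (X Y : A ⊗[k] Uq n q) :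
    (φ (K n q ^ m)).rTensor _ (X * Y) =
      (φ (K n q ^ m)).rTensor _ X * (φ (K n q ^ m)).rTensor _ Y := by
  induction X with
  | zero => simp
  | add X X' hX hX' => simp only [map_add, add_mul, hX, hX']
  | tmul a h =>
    induction Y with
    | zero => simp
    | add X X' hX hX' => simp only [map_add, mul_add, hX, hX']
    | tmul b g => simp [hφ.K_pow_mul]

/-- The Yetter-Drinfel'd condition for `K⁻¹` follows from that for `K`. -/
theorem YetterDrinfeldK.inv (hφ : IsModuleAlgebra φ) (h : ∀ w, YetterDrinfeldK φ κ w) (w : A) :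
    (1 ⊗ₜ (K n q ^ (n - 1))) * (φ (K n q ^ (n - 1))).rTensor _ (κ w) =
      κ (φ (K n q ^ (n - 1)) w) * (1 ⊗ₜ (K n q ^ (n - 1))) := by
  have h1 := h (φ (K n q ^ (n - 1)) w)
  unfold YetterDrinfeldK at h1
  rw [hφ.K_K_inv] at h1
  have right : ∀ (X : A ⊗[k] Uq n q) (x : Uq n q),
      (φ (K n q ^ (n - 1))).rTensor _ (X * (1 ⊗ₜ x)) =
        (φ (K n q ^ (n - 1))).rTensor _ X * (1 ⊗ₜ x) := by
    intro X x
    induction X with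
    | zero => simp
    | add X X' hX hX' => simp only [map_add, add_mul, hX, hX']
    | tmul a h => simp
  have left : ∀ (X : A ⊗[k] Uq n q) (x : Uq n q),
      (φ (K n q ^ (n - 1))).rTensor _ ((1 ⊗ₜ x) * (φ (K n q)).rTensor _ X) = (1 ⊗ₜ x) * X := by
    intro X x
    induction X with
    | zero => simp
    | add X X' hX hX' => simp only [map_add, mul_add, hX, hX']
    | tmul a h => simp [hφ.K_inv_K]
  have h2 := congrArg ((φ (K n q ^ (n - 1))).rTensor (Uq n q)) h1
  rw [left, right] at h2
  have kk : (1 ⊗ₜ[k] (K n q ^ (n - 1)) : A ⊗[k] Uq n q) * (1 ⊗ₜ K n q) = 1 := by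
    rw [Algebra.TensorProduct.tmul_mul_tmul, isUqTriple.inv_mul_K, one_mul]; rfl
  have kk' : (1 ⊗ₜ[k] K n q : A ⊗[k] Uq n q) * (1 ⊗ₜ (K n q ^ (n - 1))) = 1 := by
    rw [Algebra.TensorProduct.tmul_mul_tmul, isUqTriple.K_mul_inv, one_mul]; rfl
  calc _ = (1 ⊗ₜ (K n q ^ (n - 1))) * ((φ (K n q ^ (n - 1))).rTensor _ (κ w) * (1 ⊗ₜ K n q)) *
        (1 ⊗ₜ (K n q ^ (n - 1))) := by rw [mul_assoc, mul_assoc, kk', mul_one]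
    _ = _ := by rw [← h2, ← mul_assoc, kk, one_mul]

variable {v : A} (hv : Algebra.adjoin k {v} = ⊤)

/-- A multiplicative linear condition that holds for a generator holds everywhere. -/
theorem forall_of_generator {P : A → Prop} (hv : Algebra.adjoin k {v} = ⊤) (h : P v) (one : P 1)
    (smul : ∀ (c : k) x, P x → P (c • x)) (add : ∀ x y, P x → P y → P (x + y))
    (mul : ∀ x y, P x → P y → P (x * y)) (w : A) : P w := by
  have hw : w ∈ Algebra.adjoin k {v} := hv ▸ Algebra.mem_top
  induction hw using Algebra.adjoin_induction with
  | mem x hx => rwa [Set.mem_singleton_iff.1 hx]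
  | algebraMap r => rw [Algebra.algebraMap_eq_smul_one]; exact smul r 1 one
  | add x y _ _ hx hy => exact add x y hx hy
  | mul x y _ _ hx hy => exact mul x y hx hy

include hv

theorem YetterDrinfeldK.forall (hφ : IsModuleAlgebra φ) (h : YetterDrinfeldK φ κ v) (w : A) :
    YetterDrinfeldK φ κ w := by
  refine forall_of_generator hv h ?_ ?_ ?_ ?_ w
  · simp [YetterDrinfeldK, Algebra.TensorProduct.one_def, hφ.K_one]
  · intro c x hx
    unfold YetterDrinfeldK at *
    simp only [map_smul, mul_smul_comm, smul_mul_assoc, hx]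
  · intro x y hx hy
    unfold YetterDrinfeldK at *
    simp only [map_add, mul_add, add_mul, hx, hy]
  · intro x y hx hy
    unfold YetterDrinfeldK at *
    rw [map_mul, rTensor_K_mul hφ, hφ.K_mul, map_mul, ← mul_assoc, hx, mul_assoc, hy, mul_assoc]

theorem YetterDrinfeldE.forall (hφ : IsModuleAlgebra φ) (hK : YetterDrinfeldK φ κ v)
    (h : YetterDrinfeldE φ κ v) (w : A) : YetterDrinfeldE φ κ w := by
  have hK := hK.forall hv hφ
  refine forall_of_generator hv h ?_ ?_ ?_ ?_ w
  · simp [YetterDrinfeldE, Algebra.TensorProduct.one_def, hφ.K_one, hφ.E_one]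
  · intro c x hx
    unfold YetterDrinfeldE at *
    simp only [map_smul, mul_smul_comm, smul_mul_assoc, ← smul_add, hx]
  · intro x y hx hy
    unfold YetterDrinfeldE at *
    simp only [map_add, mul_add, add_mul]
    rw [add_add_add_comm, hx, hy, add_add_add_comm]
  · intro x y hx hy
    have hKx := hK x
    unfold YetterDrinfeldK at hKx
    unfold YetterDrinfeldE at *
    have e : φ (E n q) (x * y) = φ (E n q) x * y + φ (K n q) x * φ (E n q) y := by
      rw [mul_comm x y, hφ.E_mul, mul_comm y, mul_comm (φ (E n q) y)]
    rw [map_mul κ, rTensor_E_mul hφ, hφ.K_mul, e, map_add κ, map_mul κ, map_mul κ, map_mul κ]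
    calc _ = ((1 ⊗ₜ E n q) * κ x + (1 ⊗ₜ K n q) * (φ (E n q)).rTensor _ (κ x)) * κ y +
          (1 ⊗ₜ K n q) * (φ (K n q)).rTensor _ (κ x) * (φ (E n q)).rTensor _ (κ y) := by
          noncomm_ring
      _ = κ (φ (E n q) x) * κ y + κ (φ (K n q) x) *
          ((1 ⊗ₜ E n q) * κ y + (1 ⊗ₜ K n q) * (φ (E n q)).rTensor _ (κ y)) := by
          rw [hx, hKx]; noncomm_ring
      _ = _ := by rw [hy]; noncomm_ring

theorem YetterDrinfeldF.forall (hφ : IsModuleAlgebra φ) (hK : YetterDrinfeldK φ κ v)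
    (h : YetterDrinfeldF φ κ v) (w : A) : YetterDrinfeldF φ κ w := by
  have hK := hK.forall hv hφ
  refine forall_of_generator hv h ?_ ?_ ?_ ?_ w
  · have : φ (K n q ^ (n - 1)) 1 = 1 := by
      conv_lhs => rw [← hφ.K_one (n := n) (q := q)]
      exact hφ.K_inv_K 1
    simp [YetterDrinfeldF, Algebra.TensorProduct.one_def, this, hφ.F_one]
  · intro c x hx
    unfold YetterDrinfeldF at *
    simp only [map_smul, mul_smul_comm, smul_mul_assoc, ← smul_add, hx]
  · intro x y hx hy
    unfold YetterDrinfeldF at *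
    simp only [map_add, mul_add, add_mul]
    rw [add_add_add_comm, hx, hy, add_add_add_comm]
  · intro x y hx hy
    have hKy := YetterDrinfeldK.inv hφ hK y
    unfold YetterDrinfeldF at *
    have e : φ (F n q) (x * y) = x * φ (F n q) y + φ (F n q) x * φ (K n q ^ (n - 1)) y := by
      rw [mul_comm x y, hφ.F_mul, mul_comm (φ (F n q) y), add_comm,
        mul_comm (φ (K n q ^ (n - 1)) y)]
    rw [map_mul κ, rTensor_F_mul hφ, rTensor_K_pow_mul hφ, e, map_add κ, map_mul κ, map_mul κ]
    calc _ = ((1 ⊗ₜ F n q) * (φ (K n q ^ (n - 1))).rTensor _ (κ x) +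
            (φ (F n q)).rTensor _ (κ x)) * (φ (K n q ^ (n - 1))).rTensor _ (κ y) +
          κ x * (φ (F n q)).rTensor _ (κ y) := by
          noncomm_ring
      _ = κ (φ (F n q) x) * ((1 ⊗ₜ (K n q ^ (n - 1))) * (φ (K n q ^ (n - 1))).rTensor _ (κ y)) +
          κ x * ((1 ⊗ₜ F n q) * (φ (K n q ^ (n - 1))).rTensor _ (κ y) +
            (φ (F n q)).rTensor _ (κ y)) := by
          rw [hx]; noncomm_ring
      _ = _ := by rw [hy, hKy]; noncomm_ring

omit hv

/-- A comodule algebra structure `κ` on `A` that satisfies the Yetter-Drinfel'd condition for the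
generators of `u_q(sl₂)` extends the module algebra structure to the double. -/
theorem isModuleAlgebra_act_dualAct (hφ : IsModuleAlgebra φ)
    (hκ : ∀ a, TensorProduct.assoc k A _ _ (κ.toLinearMap.rTensor _ (κ a)) =
      Coalgebra.comul.lTensor A (κ a))
    (hκ' : ∀ a, contract Coalgebra.counit (κ a) = a)
    (hK : ∀ w, YetterDrinfeldK φ κ w) (hE : ∀ w, YetterDrinfeldE φ κ w)
    (hF : ∀ w, YetterDrinfeldF φ κ w) :
    IsModuleAlgebra (act (antipode_bijective n q) (dualAct κ) φ) := by
  have kk : (1 ⊗ₜ[k] (K n q ^ (n - 1)) : A ⊗[k] Uq n q) * (1 ⊗ₜ K n q) = 1 := by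
    rw [Algebra.TensorProduct.tmul_mul_tmul, isUqTriple.inv_mul_K, one_mul]; rfl
  refine isModuleAlgebra_act _ hφ (LinearMap.ext hκ') (dualAct_mul κ hκ) (dualAct_apply_mul κ)
    (dualAct_one κ) fun x => ?_
  have mulφ : ∀ x y, φ (x * y) = φ x * φ y := fun x y => LinearMap.ext fun v => hφ.mul_act x y v
  have cK : Crosses (antipodeInv (antipode_bijective n q)) (dualAct κ) φ (K n q) := by
    intro p
    ext w
    have h := hK w
    unfold YetterDrinfeldK at h
    rw [straighten_K, combine_tmul, Module.End.mul_apply, Module.End.mul_apply, dualAct_apply,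
      dualAct_apply, map_contract, contract_transposeAct, mul_assoc, ← h, ← mul_assoc, kk, one_mul]
  have cE : Crosses (antipodeInv (antipode_bijective n q)) (dualAct κ) φ (E n q) := by
    intro p
    ext w
    have h := hE w
    unfold YetterDrinfeldE at h
    simp only [straighten_E, map_add, combine_tmul, LinearMap.add_apply, Module.End.mul_apply,
      dualAct_apply, map_contract, contract_transposeAct, hφ.one_act]
    rw [← map_add, ← map_add]
    congr 1
    have one : (1 ⊗ₜ[k] 1 : A ⊗[k] Uq n q) = 1 := rfl
    have e : (1 ⊗ₜ[k] (-(K n q ^ (n - 1) * E n q)) : A ⊗[k] Uq n q) =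
        -((1 ⊗ₜ (K n q ^ (n - 1))) * (1 ⊗ₜ E n q)) := by
      rw [Algebra.TensorProduct.tmul_mul_tmul, one_mul, TensorProduct.tmul_neg]
    rw [one, e, mul_one, mul_one, mul_assoc _ (κ _) (_ ⊗ₜ _), add_assoc, ← mul_add, ← h, mul_add,
      ← mul_assoc, ← mul_assoc, kk]
    noncomm_ring
  have cF : Crosses (antipodeInv (antipode_bijective n q)) (dualAct κ) φ (F n q) := by
    intro p
    ext w
    have h := hF w
    have hKw := YetterDrinfeldK.inv hφ hK w
    unfold YetterDrinfeldF at h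
    simp only [straighten_F, map_add, combine_tmul, LinearMap.add_apply, Module.End.mul_apply,
      dualAct_apply, map_contract, contract_transposeAct, hφ.one_act]
    rw [← map_add, ← map_add]
    congr 1
    have one : (1 ⊗ₜ[k] 1 : A ⊗[k] Uq n q) = 1 := rfl
    have kk' : (1 ⊗ₜ[k] K n q : A ⊗[k] Uq n q) * (1 ⊗ₜ (K n q ^ (n - 1))) = 1 := by
      rw [Algebra.TensorProduct.tmul_mul_tmul, isUqTriple.K_mul_inv, one_mul]; rfl
    have e : (1 ⊗ₜ[k] (-(F n q * K n q)) : A ⊗[k] Uq n q) =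
        -((1 ⊗ₜ F n q) * (1 ⊗ₜ K n q)) := by
      rw [Algebra.TensorProduct.tmul_mul_tmul, one_mul, TensorProduct.tmul_neg]
    rw [one, e, one_mul, one_mul, add_assoc, ← h, neg_mul, neg_mul, mul_assoc _ (κ _), ← hKw,
      mul_assoc (1 ⊗ₜ F n q), ← mul_assoc (1 ⊗ₜ K n q), kk', one_mul]
    abel
  have hT := DrinfeldDouble.antipodeInv_mul (antipode_bijective n q)
  induction x using induction_left with
  | h1 =>
    exact Crosses.one (DrinfeldDouble.antipodeInv_one _) (LinearMap.ext hφ.one_act)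
  | hadd x y hx hy => exact hx.add hy
  | hsmul c x hx => exact hx.smul c
  | hK x hx => exact cK.mul hT mulφ hx
  | hE x hx => exact cE.mul hT mulφ hx
  | hF x hx => exact cF.mul hT mulφ hx

end Uq

/-! ### Translations on the dual algebra -/

section Translation

open WithConv

variable {k H : Type*} [Field k] [Ring H] [HopfAlgebra k H]

/-- The right translation `f ↦ x ≻ f`, that is `z ↦ f (z x)`, on the convolution algebra `H*`. -/
def rtrans (x : H) : WithConv (H →ₗ[k] k) →ₗ[k] WithConv (H →ₗ[k] k) where
  toFun f := toConv (f.ofConv ∘ₗ LinearMap.mulRight k x)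
  map_add' _ _ := rfl
  map_smul' _ _ := rfl

/-- The left translation `f ↦ f ≺ y`, that is `z ↦ f (y z)`, on the convolution algebra `H*`. -/
def ltrans (y : H) : WithConv (H →ₗ[k] k) →ₗ[k] WithConv (H →ₗ[k] k) where
  toFun f := toConv (f.ofConv ∘ₗ LinearMap.mulLeft k y)
  map_add' _ _ := rfl
  map_smul' _ _ := rfl

@[simp] theorem rtrans_apply (x z : H) (f : WithConv (H →ₗ[k] k)) : rtrans x f z = f (z * x) := rfl

@[simp] theorem ltrans_apply (y z : H) (f : WithConv (H →ₗ[k] k)) : ltrans y f z = f (y * z) := rfl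

theorem conv_ext {f g : WithConv (H →ₗ[k] k)} (h : ∀ z, f z = g z) : f = g :=
  WithConv.ext (LinearMap.ext h)

theorem rtrans_mul (x y : H) (f : WithConv (H →ₗ[k] k)) :
    rtrans (x * y) f = rtrans x (rtrans y f) := conv_ext fun z => by simp [mul_assoc]

theorem ltrans_mul (x y : H) (f : WithConv (H →ₗ[k] k)) :
    ltrans (x * y) f = ltrans y (ltrans x f) := conv_ext fun z => by simp [mul_assoc]

@[simp] theorem rtrans_one (f : WithConv (H →ₗ[k] k)) : rtrans (1 : H) f = f :=
  conv_ext fun z => by simp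

@[simp] theorem ltrans_one (f : WithConv (H →ₗ[k] k)) : ltrans (1 : H) f = f :=
  conv_ext fun z => by simp

/-- The convolution product of `f` and `g` translated by the two legs of a tensor. -/
theorem conv_apply_mul_tmul (f g : WithConv (H →ₗ[k] k)) (Z : H ⊗[k] H) (x y : H) :
    LinearMap.mul' k k (TensorProduct.map f.ofConv g.ofConv (Z * (x ⊗ₜ y))) =
      LinearMap.mul' k k (TensorProduct.map (rtrans x f).ofConv (rtrans y g).ofConv Z) := by
  induction Z with
  | zero => simp
  | add Z Z' hZ hZ' => simp only [add_mul, map_add, hZ, hZ']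
  | tmul a b => simp

theorem conv_apply_tmul_mul (f g : WithConv (H →ₗ[k] k)) (Z : H ⊗[k] H) (x y : H) :
    LinearMap.mul' k k (TensorProduct.map f.ofConv g.ofConv ((x ⊗ₜ y) * Z)) =
      LinearMap.mul' k k (TensorProduct.map (ltrans x f).ofConv (ltrans y g).ofConv Z) := by
  induction Z with
  | zero => simp
  | add Z Z' hZ hZ' => simp only [mul_add, map_add, hZ, hZ']
  | tmul a b => simp

theorem conv_mul_apply_one (f g : WithConv (H →ₗ[k] k)) : (f * g) (1 : H) = f 1 * g 1 := by
  rw [LinearMap.convMul_apply, Bialgebra.comul_one, Algebra.TensorProduct.one_def]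
  simp

end Translation

namespace Uq

open IsOddPrimitiveRoot WithConv

variable {k : Type*} [Field k] {n : ℕ} {q : k} [IsOddPrimitiveRoot n q]

section

variable (f g : WithConv (Uq n q →ₗ[k] k))

theorem rtrans_K_mul : rtrans (K n q) (f * g) = rtrans (K n q) f * rtrans (K n q) g :=
  conv_ext fun z => by
    rw [rtrans_apply, LinearMap.convMul_apply, Bialgebra.comul_mul, comul_K, conv_apply_mul_tmul]
    rfl

theorem ltrans_K_mul : ltrans (K n q) (f * g) = ltrans (K n q) f * ltrans (K n q) g :=
  conv_ext fun z => by
    rw [ltrans_apply, LinearMap.convMul_apply, Bialgebra.comul_mul, comul_K, conv_apply_tmul_mul]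
    rfl

theorem ltrans_E_mul :
    ltrans (E n q) (f * g) = f * ltrans (E n q) g + ltrans (E n q) f * ltrans (K n q) g :=
  conv_ext fun z => by
    rw [ltrans_apply, LinearMap.convMul_apply, Bialgebra.comul_mul, comul_E, add_mul, map_add,
      map_add, conv_apply_tmul_mul, conv_apply_tmul_mul, ltrans_one]
    rfl

theorem rtrans_F_mul : rtrans (F n q) (f * g) =
    rtrans (K n q ^ (n - 1)) f * rtrans (F n q) g + rtrans (F n q) f * g :=
  conv_ext fun z => by
    rw [rtrans_apply, LinearMap.convMul_apply, Bialgebra.comul_mul, comul_F, mul_add, map_add,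
      map_add, conv_apply_mul_tmul, conv_apply_mul_tmul, rtrans_one]
    rfl

theorem ltrans_F_mul : ltrans (F n q) (f * g) =
    ltrans (K n q ^ (n - 1)) f * ltrans (F n q) g + ltrans (F n q) f * g :=
  conv_ext fun z => by
    rw [ltrans_apply, LinearMap.convMul_apply, Bialgebra.comul_mul, comul_F, add_mul, map_add,
      map_add, conv_apply_tmul_mul, conv_apply_tmul_mul, ltrans_one]
    rfl

variable {f}

theorem rtrans_K_inv {μ : k} (hμ : μ ≠ 0) (hf : rtrans (K n q) f = μ • f) :
    rtrans (K n q ^ (n - 1)) f = μ⁻¹ • f := by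
  have h : rtrans (K n q ^ (n - 1)) (rtrans (K n q) f) = f := by
    rw [← rtrans_mul, isUqTriple.inv_mul_K, rtrans_one]
  rw [hf, map_smul] at h
  rw [eq_inv_smul_iff₀ hμ, h]

theorem ltrans_K_inv {μ : k} (hμ : μ ≠ 0) (hf : ltrans (K n q) f = μ • f) :
    ltrans (K n q ^ (n - 1)) f = μ⁻¹ • f := by
  have h : ltrans (K n q ^ (n - 1)) (ltrans (K n q) f) = f := by
    rw [← ltrans_mul, isUqTriple.K_mul_inv, ltrans_one]
  rw [hf, map_smul] at h
  rw [eq_inv_smul_iff₀ hμ, h]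

end

/-! ### The matrix coefficients of the two-dimensional representation -/

variable (n q)

theorem matrixCoeff_apply (i j : Fin 2) (x : Uq n q) :
    matrixCoeff n q i j x = standardRep n q x i j := rfl

theorem standardRep_K : standardRep n q (K n q) = !![q, 0; 0, q⁻¹] := lift_K _

theorem standardRep_E : standardRep n q (E n q) = !![0, 1; 0, 0] := lift_E _

theorem standardRep_F : standardRep n q (F n q) = !![0, 0; 1, 0] := lift_F _

theorem matrixCoeff_one (i j : Fin 2) : matrixCoeff n q i j 1 = if i = j then 1 else 0 := by
  rw [matrixCoeff_apply, map_one, Matrix.one_apply]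

theorem matrixCoeff_mul (i j : Fin 2) (x y : Uq n q) :
    matrixCoeff n q i j (x * y) = matrixCoeff n q i 0 x * matrixCoeff n q 0 j y +
      matrixCoeff n q i 1 x * matrixCoeff n q 1 j y := by
  simp [matrixCoeff_apply, Matrix.mul_apply]

/-- The coproduct of the matrix coefficients is that of a matrix coalgebra. -/
theorem dualComul_matrixCoeff (i j : Fin 2) :
    DoubleConstruction.dualComul k (Uq n q) (matrixCoeff n q i j) =
      matrixCoeff n q i 0 ⊗ₜ matrixCoeff n q 0 j + matrixCoeff n q i 1 ⊗ₜ matrixCoeff n q 1 j := by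
  apply (TensorProduct.dualDistribEquiv k (Uq n q) (Uq n q)).injective
  refine (DrinfeldDouble.dualDistribEquiv_dualComul _).trans ?_
  refine TensorProduct.ext' fun x y => ?_
  change matrixCoeff n q i j (x * y) = _
  rw [matrixCoeff_mul, map_add]
  rfl

/-- The matrix coefficient at `i`, `j` as an element of the convolution algebra. -/
abbrev coeff (i j : Fin 2) : WithConv (Uq n q →ₗ[k] k) := toConv (matrixCoeff n q i j)

theorem coeff_apply (i j : Fin 2) (x : Uq n q) : coeff n q i j x = matrixCoeff n q i j x := rfl

theorem rtrans_K_coeff_zero (i : Fin 2) : rtrans (K n q) (coeff n q i 0) = q • coeff n q i 0 :=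
  conv_ext fun z => by
    rw [rtrans_apply, coeff_apply, matrixCoeff_mul]
    simp [matrixCoeff_apply, standardRep_K, mul_comm]

theorem rtrans_K_coeff_one (i : Fin 2) : rtrans (K n q) (coeff n q i 1) = q⁻¹ • coeff n q i 1 :=
  conv_ext fun z => by
    rw [rtrans_apply, coeff_apply, matrixCoeff_mul]
    simp [matrixCoeff_apply, standardRep_K, mul_comm]

theorem rtrans_F_coeff_zero (i : Fin 2) : rtrans (F n q) (coeff n q i 0) = coeff n q i 1 :=
  conv_ext fun z => by
    rw [rtrans_apply, coeff_apply, matrixCoeff_mul]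
    simp [matrixCoeff_apply, standardRep_F]

theorem rtrans_F_coeff_one (i : Fin 2) : rtrans (F n q) (coeff n q i 1) = 0 :=
  conv_ext fun z => by
    rw [rtrans_apply, coeff_apply, matrixCoeff_mul]
    simp [matrixCoeff_apply, standardRep_F]

theorem ltrans_K_coeff_zero (j : Fin 2) : ltrans (K n q) (coeff n q 0 j) = q • coeff n q 0 j :=
  conv_ext fun z => by
    rw [ltrans_apply, coeff_apply, matrixCoeff_mul]
    simp [matrixCoeff_apply, standardRep_K]

theorem ltrans_K_coeff_one (j : Fin 2) : ltrans (K n q) (coeff n q 1 j) = q⁻¹ • coeff n q 1 j :=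
  conv_ext fun z => by
    rw [ltrans_apply, coeff_apply, matrixCoeff_mul]
    simp [matrixCoeff_apply, standardRep_K]

theorem ltrans_E_coeff_zero (j : Fin 2) : ltrans (E n q) (coeff n q 0 j) = coeff n q 1 j :=
  conv_ext fun z => by
    rw [ltrans_apply, coeff_apply, matrixCoeff_mul]
    simp [matrixCoeff_apply, standardRep_E]

theorem ltrans_E_coeff_one (j : Fin 2) : ltrans (E n q) (coeff n q 1 j) = 0 :=
  conv_ext fun z => by
    rw [ltrans_apply, coeff_apply, matrixCoeff_mul]
    simp [matrixCoeff_apply, standardRep_E]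

theorem ltrans_F_coeff_zero (j : Fin 2) : ltrans (F n q) (coeff n q 0 j) = 0 :=
  conv_ext fun z => by
    rw [ltrans_apply, coeff_apply, matrixCoeff_mul]
    simp [matrixCoeff_apply, standardRep_F]

theorem ltrans_F_coeff_one (j : Fin 2) : ltrans (F n q) (coeff n q 1 j) = coeff n q 0 j :=
  conv_ext fun z => by
    rw [ltrans_apply, coeff_apply, matrixCoeff_mul]
    simp [matrixCoeff_apply, standardRep_F]

theorem ltrans_K_inv_coeff_zero (j : Fin 2) :
    ltrans (K n q ^ (n - 1)) (coeff n q 0 j) = q⁻¹ • coeff n q 0 j :=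
  ltrans_K_inv (ne_zero n q) (ltrans_K_coeff_zero n q j)

theorem ltrans_K_inv_coeff_one (j : Fin 2) :
    ltrans (K n q ^ (n - 1)) (coeff n q 1 j) = q • coeff n q 1 j := by
  simpa using ltrans_K_inv (inv_ne_zero (ne_zero n q)) (ltrans_K_coeff_one n q j)

theorem rtrans_K_inv_coeff_zero (i : Fin 2) :
    rtrans (K n q ^ (n - 1)) (coeff n q i 0) = q⁻¹ • coeff n q i 0 :=
  rtrans_K_inv (ne_zero n q) (rtrans_K_coeff_zero n q i)

variable {n q}

/-- An element of `H*` with `f ≺ x = ε(x) f` for the generators `x` is a multiple of `ε`. -/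
theorem eq_smul_one_of_ltrans {f : WithConv (Uq n q →ₗ[k] k)} (hK : ltrans (K n q) f = f)
    (hE : ltrans (E n q) f = 0) (hF : ltrans (F n q) f = 0) : f = f 1 • 1 := by
  refine conv_ext fun x => ?_
  induction x using induction_left with
  | h1 => simp
  | hadd x y hx hy => rw [map_add, map_add, hx, hy]
  | hsmul c x hx => rw [map_smul, map_smul, hx]
  | hK x hx =>
    rw [← ltrans_apply, hK, hx]
    simp [counit_K]
  | hE x hx =>
    rw [← ltrans_apply, hE]
    simp [counit_E]
  | hF x hx =>
    rw [← ltrans_apply, hF]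
    simp [counit_F]

variable (n q)

/-- The functional `q e₁* ⊗ e₂* - e₂* ⊗ e₁*` on the tensor square of the two-dimensional
representation is invariant; this relation is its value on `x · (eᵢ ⊗ eⱼ)` as a function of `x`. -/
theorem coeff_row_relation (i j : Fin 2) :
    q • (coeff n q 0 i * coeff n q 1 j) - coeff n q 1 i * coeff n q 0 j =
      (q * ((if 0 = i then 1 else 0) * if 1 = j then 1 else 0) -
        (if 1 = i then 1 else 0) * if 0 = j then 1 else 0) • 1 := by
  have hq := ne_zero n q
  rw [eq_smul_one_of_ltrans (f := q • (coeff n q 0 i * coeff n q 1 j) -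
    coeff n q 1 i * coeff n q 0 j)]
  · congr 1
    change q * (coeff n q 0 i * coeff n q 1 j) 1 - (coeff n q 1 i * coeff n q 0 j) 1 = _
    rw [conv_mul_apply_one, conv_mul_apply_one]
    simp only [matrixCoeff_one]
  · rw [map_sub, map_smul, ltrans_K_mul, ltrans_K_mul]
    simp only [ltrans_K_coeff_zero, ltrans_K_coeff_one, smul_mul_smul_comm, mul_inv_cancel₀ hq,
      inv_mul_cancel₀ hq, one_smul]
  · rw [map_sub, map_smul, ltrans_E_mul, ltrans_E_mul]
    simp only [ltrans_E_coeff_zero, ltrans_E_coeff_one, ltrans_K_coeff_one, mul_zero, zero_mul,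
      zero_add, add_zero, mul_smul_comm, smul_smul, mul_inv_cancel₀ hq, one_smul, sub_self]
  · rw [map_sub, map_smul, ltrans_F_mul, ltrans_F_mul]
    simp only [ltrans_F_coeff_zero, ltrans_F_coeff_one, ltrans_K_inv_coeff_zero, mul_zero, zero_mul,
      zero_add, add_zero, smul_mul_assoc, smul_smul, mul_inv_cancel₀ hq, one_smul, sub_self]

theorem d_mul_b : coeff n q 1 1 * coeff n q 0 1 = q • (coeff n q 0 1 * coeff n q 1 1) := by
  have h := coeff_row_relation n q 1 1
  simp only [zero_ne_one, if_false, zero_mul, mul_zero, sub_zero, zero_smul] at h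
  exact (sub_eq_zero.1 h).symm

theorem a_mul_d : q • (coeff n q 0 0 * coeff n q 1 1) - coeff n q 1 0 * coeff n q 0 1 = q • 1 := by
  have h := coeff_row_relation n q 0 1
  simpa using h

/-- The companion relation within a row: the tensor `t = q e₁ ⊗ e₂ - e₂ ⊗ e₁` spans a trivial
subrepresentation of the tensor square, so that `x · t` has no component along `e₂ ⊗ e₂`. -/
theorem d_mul_c : coeff n q 1 1 * coeff n q 1 0 = q • (coeff n q 1 0 * coeff n q 1 1) := by
  have hq := ne_zero n q
  set W : Fin 2 → Fin 2 → WithConv (Uq n q →ₗ[k] k) := fun i j =>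
    q • (coeff n q i 0 * coeff n q j 1) - coeff n q i 1 * coeff n q j 0 with hW
  have K00 : ltrans (K n q) (W 0 0) = q ^ 2 • W 0 0 := by
    simp only [hW, map_sub, map_smul, ltrans_K_mul, ltrans_K_coeff_zero, smul_mul_smul_comm]
    module
  have K11 : ltrans (K n q) (W 1 1) = (q⁻¹) ^ 2 • W 1 1 := by
    simp only [hW, map_sub, map_smul, ltrans_K_mul, ltrans_K_coeff_one, smul_mul_smul_comm]
    module
  have K01 : ltrans (K n q) (W 0 1) = W 0 1 := by
    simp only [hW, map_sub, map_smul, ltrans_K_mul, ltrans_K_coeff_one, ltrans_K_coeff_zero,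
      smul_mul_smul_comm, mul_inv_cancel₀ hq, one_smul]
  have K10 : ltrans (K n q) (W 1 0) = W 1 0 := by
    simp only [hW, map_sub, map_smul, ltrans_K_mul, ltrans_K_coeff_one, ltrans_K_coeff_zero,
      smul_mul_smul_comm, inv_mul_cancel₀ hq, one_smul]
  have E00 : ltrans (E n q) (W 0 0) = W 0 1 + q • W 1 0 := by
    simp only [hW, map_sub, map_smul, ltrans_E_mul, ltrans_E_coeff_zero, ltrans_K_coeff_zero,
      mul_smul_comm]
    module
  have E11 : ltrans (E n q) (W 1 1) = 0 := by
    simp [hW, ltrans_E_mul, ltrans_E_coeff_one]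
  have E01 : ltrans (E n q) (W 0 1) = q⁻¹ • W 1 1 := by
    simp only [hW, map_sub, map_smul, ltrans_E_mul, ltrans_E_coeff_zero, ltrans_E_coeff_one,
      ltrans_K_coeff_one, mul_smul_comm, mul_zero, zero_add]
    module
  have E10 : ltrans (E n q) (W 1 0) = W 1 1 := by
    simp [hW, ltrans_E_mul, ltrans_E_coeff_one, ltrans_E_coeff_zero]
  have F00 : ltrans (F n q) (W 0 0) = 0 := by
    simp [hW, ltrans_F_mul, ltrans_F_coeff_zero]
  have F11 : ltrans (F n q) (W 1 1) = W 0 1 + q • W 1 0 := by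
    simp only [hW, map_sub, map_smul, ltrans_F_mul, ltrans_F_coeff_one, ltrans_K_inv_coeff_one,
      smul_mul_assoc]
    module
  have F01 : ltrans (F n q) (W 0 1) = q⁻¹ • W 0 0 := by
    simp only [hW, map_sub, map_smul, ltrans_F_mul, ltrans_F_coeff_zero, ltrans_F_coeff_one,
      ltrans_K_inv_coeff_zero, smul_mul_assoc, zero_mul, add_zero]
    module
  have F10 : ltrans (F n q) (W 1 0) = W 0 0 := by
    simp [hW, ltrans_F_mul, ltrans_F_coeff_one, ltrans_F_coeff_zero]
  have key : ∀ x, W 0 0 x = 0 ∧ W 1 1 x = 0 ∧ (W 0 1 + q • W 1 0) x = 0 := by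
    intro x
    induction x using induction_left with
    | h1 =>
      simp only [hW, ofConv_sub, ofConv_smul, ofConv_add, LinearMap.sub_apply, LinearMap.add_apply,
        LinearMap.smul_apply, conv_mul_apply_one, matrixCoeff_one]
      simp
    | hadd x y hx hy =>
      simp only [map_add, hx, hy, add_zero, and_self]
    | hsmul c x hx => simp only [map_smul, hx, smul_zero, and_self]
    | hK x hx =>
      simp only [← ltrans_apply, map_add, map_smul, K00, K11, K01, K10]
      refine ⟨?_, ?_, hx.2.2⟩
      · simp [hx.1]
      · simp [hx.2.1]
    | hE x hx =>
      simp only [← ltrans_apply, map_add, map_smul, E00, E11, E01, E10]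
      refine ⟨hx.2.2, rfl, ?_⟩
      simp [hx.2.1]
    | hF x hx =>
      simp only [← ltrans_apply, map_add, map_smul, F00, F11, F01, F10]
      refine ⟨rfl, hx.2.2, ?_⟩
      simp [hx.1]
  have : W 1 1 = 0 := conv_ext fun x => (key x).2.1
  exact (sub_eq_zero.1 this).symm

end Uq

/-! ### The matrix coefficients generate the dual -/

namespace Uq

open IsOddPrimitiveRoot WithConv

variable {k : Type*} [Field k] {n : ℕ} {q : k} [IsOddPrimitiveRoot n q]

theorem geom_sum_ne_zero {ζ : k} (hζ : IsPrimitiveRoot ζ n) {m : ℕ} (hm : 0 < m) (hmn : m < n) :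
    ∑ t ∈ Finset.range m, ζ ^ t ≠ 0 := by
  intro h
  have := geom_sum_mul ζ m
  rw [h, zero_mul] at this
  exact hζ.pow_ne_one_of_pos_of_lt hm.ne' hmn (sub_eq_zero.1 this.symm)

theorem rtrans_K_pow_eigen {f : WithConv (Uq n q →ₗ[k] k)} {μ : k}
    (hf : rtrans (K n q) f = μ • f) (m : ℕ) : rtrans (K n q ^ m) f = μ ^ m • f := by
  induction m with
  | zero => simp
  | succ m ih => rw [pow_succ, rtrans_mul, hf, map_smul, ih, smul_smul, ← pow_succ']

theorem rtrans_K_eigen_mul {f g : WithConv (Uq n q →ₗ[k] k)} {μ ν : k}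
    (hf : rtrans (K n q) f = μ • f) (hg : rtrans (K n q) g = ν • g) :
    rtrans (K n q) (f * g) = (μ * ν) • (f * g) := by
  rw [rtrans_K_mul, hf, hg, smul_mul_smul_comm]

theorem rtrans_K_eigen_pow {f : WithConv (Uq n q →ₗ[k] k)} {μ : k}
    (hf : rtrans (K n q) f = μ • f) (m : ℕ) : rtrans (K n q) (f ^ m) = μ ^ m • f ^ m := by
  induction m with
  | zero =>
    rw [pow_zero, pow_zero, one_smul]
    exact conv_ext fun z => by simp [counit_K]
  | succ m ih => rw [pow_succ, pow_succ, rtrans_K_eigen_mul ih hf]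

theorem ltrans_K_eigen_pow {f : WithConv (Uq n q →ₗ[k] k)} {μ : k}
    (hf : ltrans (K n q) f = μ • f) (m : ℕ) : ltrans (K n q) (f ^ m) = μ ^ m • f ^ m := by
  induction m with
  | zero =>
    rw [pow_zero, pow_zero, one_smul]
    exact conv_ext fun z => by simp [counit_K]
  | succ m ih => rw [pow_succ, pow_succ, ltrans_K_mul, ih, hf, smul_mul_smul_comm]

theorem rtrans_F_one : rtrans (F n q) (1 : WithConv (Uq n q →ₗ[k] k)) = 0 :=
  conv_ext fun z => by simp [counit_F]

theorem ltrans_E_one : ltrans (E n q) (1 : WithConv (Uq n q →ₗ[k] k)) = 0 :=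
  conv_ext fun z => by simp [counit_E]

theorem rtrans_F_mul_eq_zero {f g : WithConv (Uq n q →ₗ[k] k)} (hf : rtrans (F n q) f = 0)
    (hg : rtrans (F n q) g = 0) : rtrans (F n q) (f * g) = 0 := by
  rw [rtrans_F_mul, hf, hg, mul_zero, zero_mul, add_zero]

theorem rtrans_F_pow_eq_zero {f : WithConv (Uq n q →ₗ[k] k)} (hf : rtrans (F n q) f = 0) (m : ℕ) :
    rtrans (F n q) (f ^ m) = 0 := by
  induction m with
  | zero => rw [pow_zero, rtrans_F_one]
  | succ m ih => rw [pow_succ, rtrans_F_mul_eq_zero ih hf]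

theorem ltrans_E_pow_eq_zero {f : WithConv (Uq n q →ₗ[k] k)} (hf : ltrans (E n q) f = 0) (m : ℕ) :
    ltrans (E n q) (f ^ m) = 0 := by
  induction m with
  | zero => rw [pow_zero, ltrans_E_one]
  | succ m ih => rw [pow_succ, ltrans_E_mul, ih, hf, mul_zero, zero_mul, add_zero]

variable (n q)

local notation "b" => coeff n q 0 1
local notation "c" => coeff n q 1 0
local notation "d" => coeff n q 1 1

theorem rtrans_F_c_pow (j : ℕ) : rtrans (F n q) (c ^ (j + 1)) =
    (∑ t ∈ Finset.range (j + 1), ((q ^ 2)⁻¹) ^ t) • (d * c ^ j) := by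
  have hq := ne_zero n q
  have hcd : c * d = q⁻¹ • (d * c) := by
    rw [d_mul_c, smul_smul, inv_mul_cancel₀ hq, one_smul]
  induction j with
  | zero => simp [rtrans_F_coeff_zero]
  | succ j ih =>
    rw [pow_succ' _ (j + 1), rtrans_F_mul, ih, rtrans_K_inv_coeff_zero, rtrans_F_coeff_zero,
      smul_mul_smul_comm, ← mul_assoc, hcd, smul_mul_assoc, mul_assoc, ← pow_succ', smul_smul,
      Finset.sum_range_succ' _ (j + 1), add_smul, pow_zero, one_smul]
    congr 2
    rw [Finset.mul_sum, Finset.sum_mul]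
    refine Finset.sum_congr rfl fun t _ => ?_
    rw [pow_succ _ t, pow_two, mul_inv]; ring

theorem d_mul_b_pow (i : ℕ) : d * b ^ i = q ^ i • (b ^ i * d) := by
  induction i with
  | zero => simp
  | succ i ih =>
    rw [pow_succ, ← mul_assoc, ih, smul_mul_assoc, mul_assoc, d_mul_b, mul_smul_comm, smul_smul,
      ← pow_succ, mul_assoc]

theorem ltrans_E_b_pow (i : ℕ) : ltrans (E n q) (b ^ (i + 1)) =
    (∑ t ∈ Finset.range (i + 1), (q ^ 2) ^ t) • (b ^ i * d) := by
  induction i with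
  | zero => simp [ltrans_E_coeff_zero]
  | succ i ih =>
    rw [pow_succ' _ (i + 1), ltrans_E_mul, ih, ltrans_E_coeff_zero,
      ltrans_K_eigen_pow (ltrans_K_coeff_zero n q 1), mul_smul_comm, ← mul_assoc, ← pow_succ',
      mul_smul_comm, d_mul_b_pow, smul_smul, ← add_smul, Finset.sum_range_succ _ (i + 1)]
    congr 2
    ring

/-- The test functional `bⁱ dˢ cʲ`. -/
def testFun (i s j : ℕ) : WithConv (Uq n q →ₗ[k] k) := b ^ i * d ^ s * c ^ j

theorem rtrans_K_testFun (i s j : ℕ) : rtrans (K n q) (testFun n q i s j) =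
    ((q⁻¹) ^ (i + s) * q ^ j) • testFun n q i s j := by
  rw [pow_add]
  exact rtrans_K_eigen_mul (rtrans_K_eigen_mul
    (rtrans_K_eigen_pow (rtrans_K_coeff_one n q 0) i)
    (rtrans_K_eigen_pow (rtrans_K_coeff_one n q 1) s))
    (rtrans_K_eigen_pow (rtrans_K_coeff_zero n q 1) j)

theorem rtrans_F_bd (i s : ℕ) : rtrans (F n q) (b ^ i * d ^ s) = 0 :=
  rtrans_F_mul_eq_zero (rtrans_F_pow_eq_zero (rtrans_F_coeff_one n q 0) i)
    (rtrans_F_pow_eq_zero (rtrans_F_coeff_one n q 1) s)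

theorem rtrans_F_testFun_zero (i s : ℕ) : rtrans (F n q) (testFun n q i s 0) = 0 := by
  rw [testFun, pow_zero, mul_one, rtrans_F_bd]

/-- `F` lowers the exponent of `c`: `F ≻ bⁱ dˢ cʲ⁺¹` is a nonzero multiple of `bⁱ dˢ⁺¹ cʲ`. -/
theorem rtrans_F_testFun_succ (i s j : ℕ) (hj : j + 1 < n) :
    ∃ μ : k, μ ≠ 0 ∧ rtrans (F n q) (testFun n q i s (j + 1)) = μ • testFun n q i (s + 1) j := by
  have hq := ne_zero n q
  have h0 : rtrans (K n q) (b ^ i * d ^ s) = ((q⁻¹) ^ i * (q⁻¹) ^ s) • (b ^ i * d ^ s) :=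
    rtrans_K_eigen_mul (rtrans_K_eigen_pow (rtrans_K_coeff_one n q 0) i)
      (rtrans_K_eigen_pow (rtrans_K_coeff_one n q 1) s)
  have h1 : (q⁻¹) ^ i * (q⁻¹) ^ s ≠ 0 := by simp [hq]
  refine ⟨((q⁻¹) ^ i * (q⁻¹) ^ s)⁻¹ * ∑ t ∈ Finset.range (j + 1), ((q ^ 2)⁻¹) ^ t,
    mul_ne_zero (inv_ne_zero h1) (geom_sum_ne_zero (sq_prim n q).inv j.succ_pos hj), ?_⟩
  rw [testFun, rtrans_F_mul, rtrans_K_inv h1 h0, rtrans_F_bd, zero_mul, add_zero, rtrans_F_c_pow,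
    smul_mul_smul_comm, ← mul_assoc, mul_assoc (b ^ i), ← pow_succ, testFun]

theorem rtrans_F_pow_testFun_of_lt {i s j m : ℕ} (hjn : j < n) (hm : j < m) :
    rtrans (F n q ^ m) (testFun n q i s j) = 0 := by
  induction j generalizing s m with
  | zero =>
    obtain ⟨m, rfl⟩ := Nat.exists_eq_succ_of_ne_zero hm.ne'
    rw [Nat.succ_eq_add_one, pow_succ, rtrans_mul, rtrans_F_testFun_zero, map_zero]
  | succ j ih =>
    obtain ⟨m, rfl⟩ := Nat.exists_eq_succ_of_ne_zero (by lia : m ≠ 0)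
    obtain ⟨μ, -, h⟩ := rtrans_F_testFun_succ n q i s j hjn
    rw [Nat.succ_eq_add_one, pow_succ, rtrans_mul, h, map_smul, ih (by lia) (by lia), smul_zero]

theorem rtrans_F_pow_testFun (i s j : ℕ) (hjn : j < n) :
    ∃ μ : k, μ ≠ 0 ∧ rtrans (F n q ^ j) (testFun n q i s j) = μ • testFun n q i (s + j) 0 := by
  induction j generalizing s with
  | zero => exact ⟨1, one_ne_zero, by simp⟩
  | succ j ih =>
    obtain ⟨μ, hμ, h⟩ := rtrans_F_testFun_succ n q i s j hjn
    obtain ⟨ν, hν, h'⟩ := ih (s + 1) (by lia)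
    exact ⟨μ * ν, mul_ne_zero hμ hν, by
      rw [pow_succ, rtrans_mul, h, map_smul, h', smul_smul, add_assoc, add_comm 1]⟩

theorem ltrans_E_testFun_zero (s : ℕ) : ltrans (E n q) (testFun n q 0 s 0) = 0 := by
  rw [testFun, pow_zero, pow_zero, mul_one, one_mul,
    ltrans_E_pow_eq_zero (ltrans_E_coeff_one n q 1)]

theorem ltrans_E_testFun_succ (i s : ℕ) (hi : i + 1 < n) :
    ∃ μ : k, μ ≠ 0 ∧ ltrans (E n q) (testFun n q (i + 1) s 0) = μ • testFun n q i (s + 1) 0 := by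
  refine ⟨(∑ t ∈ Finset.range (i + 1), (q ^ 2) ^ t) * (q⁻¹) ^ s,
    mul_ne_zero (geom_sum_ne_zero (sq_prim n q) i.succ_pos hi) (by simp [ne_zero n q]), ?_⟩
  rw [testFun, testFun, pow_zero, mul_one, mul_one, ltrans_E_mul,
    ltrans_E_pow_eq_zero (ltrans_E_coeff_one n q 1), mul_zero, zero_add, ltrans_E_b_pow,
    ltrans_K_eigen_pow (ltrans_K_coeff_one n q 1), smul_mul_smul_comm, mul_assoc, ← pow_succ']

theorem testFun_one (i s : ℕ) : testFun n q i s 0 1 = if i = 0 then 1 else 0 := by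
  have pow_one_apply : ∀ (f : WithConv (Uq n q →ₗ[k] k)) (m : ℕ), (f ^ m) 1 = (f 1) ^ m := by
    intro f m
    induction m with
    | zero => simp
    | succ m ih => rw [pow_succ, conv_mul_apply_one, ih, pow_succ]
  rw [testFun, pow_zero, mul_one, conv_mul_apply_one, pow_one_apply, pow_one_apply, coeff_apply,
    coeff_apply, matrixCoeff_one, matrixCoeff_one]
  simp [zero_pow_eq]

/-- `bⁱ dˢ` pairs to `0` with `Eᵐ` unless `m = i`, when the value does not vanish. -/
theorem testFun_E_pow (i s m : ℕ) (hi : i < n) :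
    (m ≠ i → testFun n q i s 0 (E n q ^ m) = 0) ∧
      testFun n q i s 0 (E n q ^ i) ≠ 0 := by
  induction i generalizing s m with
  | zero =>
    refine ⟨fun hm => ?_, by simp [testFun_one]⟩
    obtain ⟨m, rfl⟩ := Nat.exists_eq_succ_of_ne_zero hm
    rw [Nat.succ_eq_add_one, pow_succ', ← ltrans_apply, ltrans_E_testFun_zero]
    rfl
  | succ i ih =>
    obtain ⟨μ, hμ, h⟩ := ltrans_E_testFun_succ n q i s hi
    refine ⟨fun hm => ?_, ?_⟩
    · rcases m with _ | m
      · rw [pow_zero, testFun_one, if_neg i.succ_ne_zero]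
      · rw [pow_succ', ← ltrans_apply, h, ofConv_smul, LinearMap.smul_apply,
          (ih (s + 1) m (by lia)).1 (by lia), smul_zero]
    · rw [pow_succ', ← ltrans_apply, h, ofConv_smul, LinearMap.smul_apply]
      exact smul_ne_zero hμ (ih (s + 1) 0 (by lia)).2

theorem testFun_monomial (i s j i' j' l : ℕ) :
    testFun n q i s j (E n q ^ i' * F n q ^ j' * K n q ^ l) =
      ((q⁻¹) ^ (i + s) * q ^ j) ^ l * rtrans (F n q ^ j') (testFun n q i s j) (E n q ^ i') := by
  rw [← rtrans_apply, rtrans_K_pow_eigen (rtrans_K_testFun n q i s j)]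
  rfl

/-- An element of `u_q(sl₂)` on which all `bⁱ dˢ cʲ` vanish is zero: in the monomial basis the
pairing is triangular with respect to the exponent of `F`, and for fixed exponents of `E` and `F`
it is a Vandermonde matrix. -/
theorem eq_zero_of_testFun {x : Uq n q} (hx : ∀ i s j, testFun n q i s j x = 0) : x = 0 := by
  have hq := ne_zero n q
  have hmem : x ∈ monomialSpan n q := by rw [monomialSpan_eq_top]; trivial
  obtain ⟨C, rfl⟩ := (Submodule.mem_span_range_iff_exists_fun k).1 hmem
  suffices h : ∀ (m : ℕ) (i j l : Fin n), (j : ℕ) = m → C (i, j, l) = 0 by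
    exact Finset.sum_eq_zero fun t _ => by rw [h _ t.1 t.2.1 t.2.2 rfl, zero_smul]
  intro m
  induction m using Nat.strong_induction_on with
  | _ m ih =>
  rintro i j l rfl
  set f : Fin n → k := fun s => (q⁻¹) ^ ((i : ℕ) + s) * q ^ (j : ℕ) with hf
  have hinj : Function.Injective f := by
    intro s t hst
    have h1 : (q⁻¹) ^ (s : ℕ) = (q⁻¹) ^ (t : ℕ) := by
      simpa [hf, pow_add, hq] using hst
    exact Fin.ext ((prim (n := n) (q := q)).inv.pow_inj s.2 t.2 h1)
  have key : ∀ s : Fin n, ∑ l : Fin n, f s ^ (l : ℕ) * C (i, j, l) = 0 := by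
    intro s
    obtain ⟨μ, hμ, hF⟩ := rtrans_F_pow_testFun n q i s j j.2
    set v := testFun n q i (s + j) 0 (E n q ^ (i : ℕ)) with hv
    have hv0 : v ≠ 0 := (testFun_E_pow n q i (s + j) 0 i.2).2
    have h := hx i s j
    rw [map_sum, Fintype.sum_prod_type, Finset.sum_eq_single i, Fintype.sum_prod_type,
      Finset.sum_eq_single j] at h
    · have e : ∀ l : Fin n, testFun n q i s j (C (i, j, l) •
          (E n q ^ (i : ℕ) * F n q ^ (j : ℕ) * K n q ^ (l : ℕ))) =
          (μ * v) * (f s ^ (l : ℕ) * C (i, j, l)) := by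
        intro l
        rw [map_smul, testFun_monomial, hF, ofConv_smul, LinearMap.smul_apply, smul_eq_mul,
          smul_eq_mul]
        ring
      rw [Finset.sum_congr rfl fun l _ => e l, ← Finset.mul_sum] at h
      exact (mul_eq_zero.1 h).resolve_left (mul_ne_zero hμ hv0)
    · intro j' _ hj'
      refine Finset.sum_eq_zero fun l _ => ?_
      rcases lt_or_gt_of_ne (Fin.val_ne_of_ne hj') with hlt | hgt
      · rw [ih j' hlt i j' l rfl, zero_smul, map_zero]
      · rw [map_smul, testFun_monomial, rtrans_F_pow_testFun_of_lt n q j.2 hgt]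
        simp
    · simp
    · intro i' _ hi'
      rw [Fintype.sum_prod_type]
      refine Finset.sum_eq_zero fun j' _ => Finset.sum_eq_zero fun l _ => ?_
      rcases lt_trichotomy (j' : ℕ) j with hlt | heq | hgt
      · rw [ih j' hlt i' j' l rfl, zero_smul, map_zero]
      · rw [map_smul, testFun_monomial, heq, hF, ofConv_smul, LinearMap.smul_apply,
          (testFun_E_pow n q i (s + j) i' i.2).1 (Fin.val_ne_of_ne hi')]
        simp
      · rw [map_smul, testFun_monomial, rtrans_F_pow_testFun_of_lt n q j.2 hgt]
        simp
    · simp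
  exact congrFun (Matrix.eq_zero_of_forall_index_sum_pow_mul_eq_zero hinj key) l

/-- The matrix coefficients of the two-dimensional representation generate `u_q(sl₂)*`. -/
theorem eq_top_of_matrixCoeff_mem (S : Submodule k (Module.Dual k (Uq n q)))
    (one : Coalgebra.counit ∈ S) (gen : ∀ i j, matrixCoeff n q i j ∈ S)
    (mul : ∀ p ∈ S, ∀ r ∈ S, DoubleConstruction.dualMul k (Uq n q) p r ∈ S) : S = ⊤ := by
  have mul' : ∀ f g : WithConv (Uq n q →ₗ[k] k), f.ofConv ∈ S → g.ofConv ∈ S →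
      (f * g).ofConv ∈ S := fun f g hf hg => mul _ hf _ hg
  have pow : ∀ (f : WithConv (Uq n q →ₗ[k] k)) (m : ℕ), f.ofConv ∈ S → (f ^ m).ofConv ∈ S := by
    intro f m hf
    induction m with
    | zero => exact one
    | succ m ih => rw [pow_succ]; exact mul' _ _ ih hf
  have hS : S.dualCoannihilator = ⊥ := by
    rw [eq_bot_iff]
    intro x hx
    rw [Submodule.mem_dualCoannihilator] at hx
    exact eq_zero_of_testFun n q fun i s j => hx _
      (mul' _ _ (mul' _ _ (pow _ _ (gen _ _)) (pow _ _ (gen _ _))) (pow _ _ (gen _ _)))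
  rw [← Subspace.dualCoannihilator_dualAnnihilator_eq (W := S), hS,
    Submodule.dualAnnihilator_bot]

end Uq

/-! ### The algebra `k[u]/(uⁿ - 1)` -/

namespace TruncPoly

variable {k : Type*} [Field k] {n : ℕ}

theorem u_pow : u k n ^ n = 1 := by
  have h : AdjoinRoot.mk (Polynomial.X ^ n - 1 : Polynomial k) (Polynomial.X ^ n - 1) = 0 :=
    AdjoinRoot.mk_self
  rw [map_sub, map_pow, AdjoinRoot.mk_X, map_one] at h
  exact sub_eq_zero.1 h

theorem u_mul_u_pow (hn : 0 < n) : u k n * u k n ^ (n - 1) = 1 := by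
  rw [← pow_succ', Nat.sub_add_cancel hn, u_pow]

theorem smul_u_pow_injective (hn : 0 < n) (m : ℕ) {r s : k}
    (h : r • u k n ^ m = s • u k n ^ m) : r = s := by
  have hd : (Polynomial.X ^ n - 1 : Polynomial k).degree ≠ 0 := by
    rw [← Polynomial.C_1, Polynomial.degree_X_pow_sub_C hn]
    exact_mod_cast hn.ne'
  have : Nontrivial (TruncPoly k n) := AdjoinRoot.nontrivial _ hd
  have hu : u k n ^ m * (u k n ^ (n - 1)) ^ m = 1 := by
    rw [← mul_pow, u_mul_u_pow hn, one_pow]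
  have := congrArg (· * (u k n ^ (n - 1)) ^ m) h
  simp only [smul_mul_assoc, hu, ← Algebra.algebraMap_eq_smul_one] at this
  exact (algebraMap k (TruncPoly k n)).injective this

theorem adjoin_u : Algebra.adjoin k {u k n} = ⊤ := AdjoinRoot.adjoinRoot_eq_top

theorem adjoin_u_pow (hn : 0 < n) : Algebra.adjoin k {u k n ^ (n - 1)} = ⊤ := by
  rw [eq_top_iff, ← adjoin_u, Algebra.adjoin_le_iff, Set.singleton_subset_iff]
  have e : u k n = (u k n ^ (n - 1)) ^ (n - 1) := by
    obtain ⟨m, rfl⟩ := Nat.exists_eq_succ_of_ne_zero hn.ne'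
    calc u k (m + 1) = u k (m + 1) * (u k (m + 1) * u k (m + 1) ^ m) ^ m := by
          rw [← pow_succ', u_pow, one_pow, mul_one]
      _ = (u k (m + 1) ^ (m + 1)) * (u k (m + 1) ^ m) ^ m := by
          rw [mul_pow, ← mul_assoc, ← pow_succ']
      _ = _ := by rw [u_pow, one_mul]; simp
  have h := pow_mem (Algebra.self_mem_adjoin_singleton k (u k n ^ (n - 1))) (n - 1)
  rwa [← e] at h

/-- An eigenvector of an operator that multiplies `uⁱ` by `ζⁱ`, for `ζ` a primitive `n`-th root of
unity, is a multiple of a power of `u`. -/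
theorem exists_eq_smul_u_pow {ζ : k} (hζ : IsPrimitiveRoot ζ n) {f : Module.End k (TruncPoly k n)}
    (hf : ∀ i, f (u k n ^ i) = ζ ^ i • u k n ^ i) {m : ℕ} (hm : m < n) {x : TruncPoly k n}
    (hx : f x = ζ ^ m • x) : ∃ r : k, x = r • u k n ^ m := by
  have hn : 0 < n := by lia
  have hmonic : (Polynomial.X ^ n - 1 : Polynomial k).Monic := Polynomial.monic_X_pow_sub_C 1 hn.ne'
  set B := (AdjoinRoot.powerBasis' hmonic).basis with hB
  have hdim : (AdjoinRoot.powerBasis' hmonic).dim = n := by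
    rw [AdjoinRoot.powerBasis'_dim, ← Polynomial.C_1, Polynomial.natDegree_X_pow_sub_C]
  have hBi : ∀ i, B i = u k n ^ (i : ℕ) := fun i => by
    rw [hB, PowerBasis.coe_basis, AdjoinRoot.powerBasis'_gen]
  have hcoord : ∀ i, B.repr x i ≠ 0 → (i : ℕ) = m := by
    intro i hi
    have h1 : B.repr (f x) i = ζ ^ (i : ℕ) * B.repr x i := by
      conv_lhs => rw [← B.sum_repr x]
      simp only [map_sum, map_smul, hBi, hf]
      simp only [← hBi, Finsupp.coe_finsetSum, Finset.sum_apply, Finsupp.smul_apply,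
        Module.Basis.repr_self, smul_eq_mul]
      rw [Finset.sum_eq_single i]
      · simp [mul_comm]
      · intro j _ hj; simp [hj]
      · simp
    rw [hx, map_smul, Finsupp.smul_apply, smul_eq_mul] at h1
    exact (hζ.pow_inj hm (by have := i.2; lia) (mul_right_cancel₀ hi h1)).symm
  refine ⟨B.repr x ⟨m, by lia⟩, ?_⟩
  conv_lhs => rw [← B.sum_repr x]
  rw [Finset.sum_eq_single ⟨m, by lia⟩, hBi]
  · intro j _ hj
    have : B.repr x j = 0 := by
      by_contra h
      exact hj (Fin.ext (hcoord j h))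
    rw [this, zero_smul]
  · simp

end TruncPoly

/-! ### The matrix coefficients on a module algebra over the double -/

namespace UqDouble

open Uq IsOddPrimitiveRoot DrinfeldDouble DoubleConstruction

variable {k : Type*} [Field k] {n : ℕ} {q : k} [IsOddPrimitiveRoot n q]

section

variable {A : Type*} [Ring A] [Algebra k A]

/-- The operator by which the matrix coefficient at `i`, `j` acts. -/
def coeffAct (Φ : UqDouble n q →ₗ[k] Module.End k A) (i j : Fin 2) : Module.End k A :=
  dualPart Φ (matrixCoeff n q i j)

variable {Φ : UqDouble n q →ₗ[k] Module.End k A}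

theorem coeffAct_one (hΦ : IsModuleAlgebra Φ) (i j : Fin 2) :
    coeffAct Φ i j 1 = (if i = j then 1 else 0 : k) • (1 : A) := by
  rw [coeffAct, dualPart_apply, hΦ.act_one, ofDual, counit_pure, matrixCoeff_one,
    Bialgebra.counit_one, mul_one]

/-- The legs of the coproduct of the matrix coefficient are interchanged, as the double contains the
dual with the opposite coproduct. -/
theorem coeffAct_mul (hΦ : IsModuleAlgebra Φ) (i j : Fin 2) (v w : A) :
    coeffAct Φ i j (v * w) =
      coeffAct Φ 0 j v * coeffAct Φ i 0 w + coeffAct Φ 1 j v * coeffAct Φ i 1 w := by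
  rw [coeffAct, dualPart_apply, hΦ.act_mul, ofDual, comul_pure, dualComul_matrixCoeff,
    Bialgebra.comul_one, Algebra.TensorProduct.one_def, map_add, TensorProduct.comm_tmul,
    TensorProduct.comm_tmul, TensorProduct.add_tmul, map_add,
    TensorProduct.tensorTensorTensorComm_tmul, TensorProduct.tensorTensorTensorComm_tmul]
  erw [map_add, map_add]
  rfl

theorem transposeAct_matrixCoeff (i j : Fin 2) (x y : Uq n q) :
    transposeAct k _ x y (matrixCoeff n q i j) =
      (standardRep n q y i 0 * standardRep n q x 0 j) • matrixCoeff n q 0 0 +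
      (standardRep n q y i 0 * standardRep n q x 1 j) • matrixCoeff n q 0 1 +
      (standardRep n q y i 1 * standardRep n q x 0 j) • matrixCoeff n q 1 0 +
      (standardRep n q y i 1 * standardRep n q x 1 j) • matrixCoeff n q 1 1 := by
  ext z
  simp only [transposeAct_apply, matrixCoeff_mul, LinearMap.add_apply, LinearMap.smul_apply,
    smul_eq_mul]
  simp only [matrixCoeff_apply]
  ring

variable (n q) in
theorem standardRep_K_inv : standardRep n q (K n q ^ (n - 1)) = !![q⁻¹, 0; 0, q] := by
  have h1 : standardRep n q (K n q ^ (n - 1)) * standardRep n q (K n q) = 1 := by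
    rw [← map_mul, isUqTriple.inv_mul_K, map_one]
  have h2 : standardRep n q (K n q) * !![q⁻¹, 0; 0, q] = 1 := by
    rw [standardRep_K]
    ext i j; fin_cases i <;> fin_cases j <;> simp [ne_zero n q]
  exact left_inv_eq_right_inv h1 h2

variable (hΦ : IsModuleAlgebra Φ)

include hΦ

theorem K_coeffAct (i j : Fin 2) :
    hopfPart Φ (K n q) * coeffAct Φ i j =
      (!![1, (q ^ 2)⁻¹; q ^ 2, 1] i j) • (coeffAct Φ i j * hopfPart Φ (K n q)) := by
  have hq := ne_zero n q
  rw [coeffAct, crosses_dualPart_hopfPart hΦ, straighten_K, combine_tmul,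
    transposeAct_matrixCoeff, standardRep_K_inv, standardRep_K]
  fin_cases i <;> fin_cases j <;> simp [hq, pow_two]

/-- The straightening rule for `E` and `a`. -/
theorem E_a : hopfPart Φ (E n q) * coeffAct Φ 0 0 =
    -(q⁻¹ • coeffAct Φ 1 0) + q⁻¹ • (coeffAct Φ 0 0 * hopfPart Φ (E n q)) := by
  have h1 : hopfPart Φ (1 : Uq n q) = 1 := LinearMap.ext hΦ.one_act
  rw [coeffAct, crosses_dualPart_hopfPart hΦ, straighten_E]
  simp only [map_neg, LinearMap.neg_apply, transposeAct_matrixCoeff, map_add, combine_tmul,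
    map_smul, map_mul, map_one, standardRep_K_inv, standardRep_E]
  simp [h1, coeffAct]

/-- The straightening rule for `F` and `a`. -/
theorem F_a : hopfPart Φ (F n q) * coeffAct Φ 0 0 =
    q⁻¹ • (coeffAct Φ 0 0 * hopfPart Φ (F n q)) + coeffAct Φ 0 1 := by
  have h1 : hopfPart Φ (1 : Uq n q) = 1 := LinearMap.ext hΦ.one_act
  rw [coeffAct, crosses_dualPart_hopfPart hΦ, straighten_F]
  simp only [map_neg, LinearMap.neg_apply, transposeAct_matrixCoeff, map_add, combine_tmul,
    map_smul, map_mul, map_one, standardRep_K_inv, standardRep_K, standardRep_F]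
  simp [h1, coeffAct]

/-- The straightening rule for `F` and `d`. -/
theorem F_d : hopfPart Φ (F n q) * coeffAct Φ 1 1 =
    -(q ^ 2 • (coeffAct Φ 0 1 * hopfPart Φ (K n q ^ (n - 1)))) +
      q • (coeffAct Φ 1 1 * hopfPart Φ (F n q)) := by
  have h1 : hopfPart Φ (1 : Uq n q) = 1 := LinearMap.ext hΦ.one_act
  rw [coeffAct, crosses_dualPart_hopfPart hΦ, straighten_F]
  simp only [map_neg, LinearMap.neg_apply, transposeAct_matrixCoeff, map_add, combine_tmul,
    map_smul, map_mul, map_one, standardRep_K_inv, standardRep_K, standardRep_F]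
  ext v
  simp [h1, coeffAct, pow_two, Module.End.mul_apply]

/-- The quantum determinant acts as the identity. -/
theorem quantum_det : q • (coeffAct Φ 0 0 * coeffAct Φ 1 1) - coeffAct Φ 1 0 * coeffAct Φ 0 1 =
    q • 1 := by
  have h := congrArg (fun f => dualPart Φ f.ofConv) (a_mul_d n q)
  simp only [WithConv.ofConv_sub, WithConv.ofConv_smul, map_sub, map_smul] at h
  have e : ∀ i j i' j', dualPart Φ (coeff n q i j * coeff n q i' j').ofConv =
      coeffAct Φ i j * coeffAct Φ i' j' := fun i j i' j' => dualPart_dualMul hΦ _ _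
  have e1 : dualPart Φ (1 : WithConv (Uq n q →ₗ[k] k)).ofConv = 1 := dualPart_counit hΦ
  rwa [e, e, e1] at h

omit hΦ

/-- Two module algebra structures over the double that agree on `u_q(sl₂)` and for which the matrix
coefficients act in the same way on a generator are equal: the matrix coefficients generate the
dual, and they span a subcoalgebra. -/
theorem eq_of_coeffAct_eq {Φ Φ' : UqDouble n q →ₗ[k] Module.End k A} (hΦ : IsModuleAlgebra Φ)
    (hΦ' : IsModuleAlgebra Φ') (hopf : hopfPart Φ = hopfPart Φ') {v : A}
    (h : ∀ i j, coeffAct Φ i j v = coeffAct Φ' i j v) (hv : Algebra.adjoin k {v} = ⊤) : Φ = Φ' := by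
  have agree : ∀ w i j, coeffAct Φ i j w = coeffAct Φ' i j w := by
    intro w
    have hw : w ∈ Algebra.adjoin k {v} := hv ▸ Algebra.mem_top
    induction hw using Algebra.adjoin_induction with
    | mem x hx => rwa [Set.mem_singleton_iff.1 hx]
    | algebraMap r =>
      intro i j
      rw [Algebra.algebraMap_eq_smul_one, map_smul, map_smul, coeffAct_one hΦ, coeffAct_one hΦ']
    | add x y _ _ hx hy => intro i j; rw [map_add, map_add, hx, hy]
    | mul x y _ _ hx hy =>
      intro i j
      simp only [coeffAct_mul hΦ, coeffAct_mul hΦ', hx, hy]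
  have top : LinearMap.eqLocus (dualPart Φ) (dualPart Φ') = ⊤ := by
    refine eq_top_of_matrixCoeff_mem n q _ ?_ ?_ ?_
    · rw [LinearMap.mem_eqLocus, dualPart_counit hΦ, dualPart_counit hΦ']
    · exact fun i j => LinearMap.ext fun w => agree w i j
    · intro p hp r hr
      rw [LinearMap.mem_eqLocus] at *
      rw [dualPart_dualMul hΦ, dualPart_dualMul hΦ', hp, hr]
  have dual : dualPart Φ = dualPart Φ' := LinearMap.ext fun p => by
    have : p ∈ LinearMap.eqLocus (dualPart Φ) (dualPart Φ') := top ▸ Submodule.mem_top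
    exact this
  rw [← act_dualPart_hopfPart hΦ, ← act_dualPart_hopfPart hΦ', dual, hopf]

end

/-! ### The two possible actions on `k[u]/(uⁿ - 1)` -/

section TruncPoly

open TruncPoly

variable {γ δ : k} {φ : Uq n q →ₗ[k] Module.End k (TruncPoly k n)} (hφ : IsModuleAlgebra φ)
    (hK : φ (Uq.K n q) (TruncPoly.u k n) = q ^ 2 • TruncPoly.u k n)

include hφ hK

theorem K_u_pow (i : ℕ) : φ (K n q) (u k n ^ i) = (q ^ 2) ^ i • u k n ^ i := by
  induction i with
  | zero => rw [pow_zero, pow_zero, one_smul, hφ.K_one]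
  | succ i ih => rw [pow_succ, hφ.K_mul, ih, hK, smul_mul_smul_comm, ← pow_succ]

theorem K_inv_u : φ (K n q ^ (n - 1)) (u k n) = (q ^ 2)⁻¹ • u k n := by
  have h := hφ.K_inv_K (n := n) (q := q) (u k n)
  rw [hK, map_smul] at h
  rw [eq_inv_smul_iff₀ (pow_ne_zero 2 (ne_zero n q)), h]

variable (hγδ : γ * δ = -q)
    (hF : φ (Uq.F n q) (TruncPoly.u k n) = γ • (1 : TruncPoly k n))
    (hE : φ (Uq.E n q) (TruncPoly.u k n) = δ • TruncPoly.u k n ^ 2)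
    {Φ : UqDouble n q →ₗ[k] Module.End k (TruncPoly k n)} (hΦ : IsDoubleExtension n q φ Φ)

include hΦ

/-- The matrix coefficients act on `u` by homogeneous elements. -/
theorem exists_coeffAct_u : ∃ α β η ω : k,
    coeffAct Φ 0 0 (u k n) = α • u k n ∧ coeffAct Φ 0 1 (u k n) = β • 1 ∧
    coeffAct Φ 1 0 (u k n) = η • u k n ^ 2 ∧ coeffAct Φ 1 1 (u k n) = ω • u k n := by
  have hq2 := pow_ne_zero 2 (ne_zero n q)
  have hn : 3 ≤ n := three_le (n := n) (q := q)
  have hopf : hopfPart Φ = φ := LinearMap.ext hΦ.2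
  have weight : ∀ i j, φ (K n q) (coeffAct Φ i j (u k n)) =
      ((!![1, (q ^ 2)⁻¹; q ^ 2, 1] : Matrix (Fin 2) (Fin 2) k) i j * q ^ 2) •
        coeffAct Φ i j (u k n) := by
    intro i j
    have h := LinearMap.congr_fun (K_coeffAct hΦ.1 i j) (u k n)
    rw [hopf, Module.End.mul_apply, LinearMap.smul_apply, Module.End.mul_apply, hK, map_smul,
      smul_smul] at h
    exact h
  have H : ∀ i j (m : ℕ), m < n →
      (!![1, (q ^ 2)⁻¹; q ^ 2, 1] : Matrix (Fin 2) (Fin 2) k) i j * q ^ 2 = (q ^ 2) ^ m →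
      ∃ r : k, coeffAct Φ i j (u k n) = r • u k n ^ m := fun i j m hm e =>
    exists_eq_smul_u_pow (sq_prim n q) (K_u_pow hφ hK) hm (by rw [weight, e])
  obtain ⟨α, h1⟩ := H 0 0 1 (by lia) (by simp)
  obtain ⟨β, h2⟩ := H 0 1 0 (by lia) (by simp [hq2])
  obtain ⟨η, h3⟩ := H 1 0 2 (by lia) (by simp [pow_two])
  obtain ⟨ω, h4⟩ := H 1 1 1 (by lia) (by simp)
  rw [pow_one] at h1 h4
  rw [pow_zero] at h2
  exact ⟨α, β, η, ω, h1, h2, h3, h4⟩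

include hγδ hF hE

/-- The quantum determinant and the commutation with `F` give `α ω = 1` and `α + ω = q + q⁻¹` for
the eigenvalues `α`, `ω` of `a`, `d` on `u`; the commutation with `E` and `F` then determines the
action of `b` and `c`. -/
theorem actsByFirst_or_actsBySecond : ActsByFirst n q γ Φ ∨ ActsBySecond n q γ Φ := by
  have hq := ne_zero n q
  have hn : 0 < n := pos n q
  have hopf : hopfPart Φ = φ := LinearMap.ext hΦ.2
  obtain ⟨α, β, η, ω, ha, hb, hc, hd⟩ := exists_coeffAct_u hφ hK hΦ
  have hγ : γ ≠ 0 := by rintro rfl; apply hq; simpa using hγδ.symm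
  have hδ : δ = -q * γ⁻¹ := by rw [eq_mul_inv_iff_mul_eq₀ hγ, mul_comm, hγδ]
  have det : α * ω = 1 := by
    have h := LinearMap.congr_fun (quantum_det hΦ.1) (u k n)
    simp only [LinearMap.sub_apply, LinearMap.smul_apply, Module.End.mul_apply, hd, hb, map_smul,
      ha, coeffAct_one hΦ.1, Module.End.one_apply] at h
    have h' : (q * (ω * α)) • u k n ^ 1 = q • u k n ^ 1 := by
      simpa [smul_smul] using h
    have := smul_u_pow_injective hn 1 h'
    rw [mul_comm]
    exact mul_left_cancel₀ hq (by rw [this, mul_one])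
  have eFa : α * γ = q⁻¹ * γ + β := by
    have h := LinearMap.congr_fun (F_a hΦ.1) (u k n)
    simp only [hopf, LinearMap.add_apply, LinearMap.smul_apply, Module.End.mul_apply, hb, ha, hF,
      map_smul, coeffAct_one hΦ.1] at h
    refine smul_u_pow_injective hn 0 ?_
    simpa [smul_smul, add_smul] using h
  have eFd : ω * γ = q * γ - β := by
    have h := LinearMap.congr_fun (F_d hΦ.1) (u k n)
    simp only [hopf, LinearMap.add_apply, LinearMap.neg_apply, LinearMap.smul_apply,
      Module.End.mul_apply, hb, hd, hF, K_inv_u hφ hK, map_smul, coeffAct_one hΦ.1] at h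
    refine smul_u_pow_injective hn 0 ?_
    rw [sub_eq_neg_add (q * γ) β, add_smul, neg_smul]
    simpa [smul_smul, hq, ← mul_assoc] using h
  have eEa : α * δ = -(q⁻¹ * η) + q⁻¹ * (δ * (α * α + η * β)) := by
    have h := LinearMap.congr_fun (E_a hΦ.1) (u k n)
    simp only [hopf, LinearMap.add_apply, LinearMap.neg_apply, LinearMap.smul_apply,
      Module.End.mul_apply, ha, hc, hE, map_smul] at h
    rw [pow_two, coeffAct_mul hΦ.1, ha, hc, hb, smul_mul_smul_comm, smul_mul_smul_comm, mul_one,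
      ← pow_two, ← add_smul] at h
    refine smul_u_pow_injective hn 2 ?_
    rw [add_smul, neg_smul]
    simpa [smul_smul] using h
  have hβ : β = γ * (α - q⁻¹) := by linear_combination -eFa
  have hω : ω = q + q⁻¹ - α := by
    refine mul_right_cancel₀ hγ ?_
    linear_combination eFd + eFa
  have hα : (α - q) * (α - q⁻¹) = 0 := by
    rw [hω] at det
    linear_combination -det + mul_inv_cancel₀ hq
  rcases mul_eq_zero.1 hα with h | h
  · left
    obtain rfl : α = q := sub_eq_zero.1 h
    have hη : η = 0 := by
      rw [hβ, hδ] at eEa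
      field_simp at eEa
      have : γ * α ^ 2 * η = 0 := by linear_combination eEa
      exact (mul_eq_zero.1 this).resolve_left (mul_ne_zero hγ (pow_ne_zero 2 hq))
    exact ⟨ha, by rw [← hβ]; exact hb, by rw [hη, zero_smul] at hc; exact hc, by
      rw [add_sub_cancel_left] at hω; exact hd.trans (by rw [hω])⟩
  · right
    have hα' : α = q⁻¹ := sub_eq_zero.1 h
    have hβ0 : β = 0 := by rw [hβ, h, mul_zero]
    have hη : η = γ⁻¹ * (q - q⁻¹) := by
      rw [hβ0, hα', hδ] at eEa
      field_simp at eEa ⊢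
      linear_combination eEa
    exact ⟨by rw [← hα']; exact ha, by rw [hβ0, zero_smul] at hb; exact hb,
      by rw [← hη]; exact hc, by
      rw [hα', add_sub_cancel_right] at hω; exact hd.trans (by rw [hω])⟩

end TruncPoly

end UqDouble

/-! ### Construction of the two extensions -/

/-- For `ζ` a primitive `n`-th root of unity the inner `ζ`-binomial coefficients of order `n`
vanish. -/
theorem add_pow_eq_add_pow_of_zeta {k B : Type*} [Field k] [Ring B] [Algebra k B] {ζ : k} {n : ℕ}
    (hζ : IsPrimitiveRoot ζ n) (hn : 0 < n) {x y : B} (h : y * x = ζ • (x * y)) :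
    (x + y) ^ n = x ^ n + y ^ n := by
  have hz : ∀ j, 0 < j → j < n → zetaBinom ζ n j = 0 := by
    intro j hj0 hjn
    obtain ⟨i, rfl⟩ := Nat.exists_eq_succ_of_ne_zero hj0.ne'
    have h2 : (ζ ^ i - ζ ^ n) * zetaBinom ζ n i = 0 := by
      clear hj0
      induction i with
      | zero => simp [hζ.pow_eq_one]
      | succ i ih =>
        have h1 := zetaBinom_rec ζ n i
        rw [ih (by lia)] at h1
        have h3 : (1 - ζ ^ (i + 1)) * ζ ^ i ≠ 0 := by
          refine mul_ne_zero (sub_ne_zero.2 fun h => ?_) (pow_ne_zero _ (hζ.ne_zero hn.ne'))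
          exact hζ.pow_ne_one_of_pos_of_lt (by lia) (by lia) h.symm
        rw [(mul_eq_zero.1 h1).resolve_left h3, mul_zero]
    have h1 := zetaBinom_rec ζ n i
    rw [h2] at h1
    have h3 : (1 - ζ ^ (i + 1)) * ζ ^ i ≠ 0 := by
      refine mul_ne_zero (sub_ne_zero.2 fun h => ?_) (pow_ne_zero _ (hζ.ne_zero hn.ne'))
      exact hζ.pow_ne_one_of_pos_of_lt (by lia) hjn h.symm
    exact (mul_eq_zero.1 h1).resolve_left h3
  have h0 : ∀ m, zetaBinom ζ m 0 = 1 := fun m => by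
    induction m with
    | zero => rfl
    | succ m ih => rw [zetaBinom, ih]
  have hd : ∀ m, zetaBinom ζ m m = 1 := fun m => by
    induction m with
    | zero => rfl
    | succ m ih => rw [zetaBinom, ih, zetaBinom_self_lt ζ m (m + 1) (by lia), mul_zero, add_zero]
  rw [add_pow_zeta ζ x y h, Finset.sum_range_succ, hd, Nat.sub_self, pow_zero, mul_one, one_smul,
    Finset.sum_eq_single_of_mem 0 (Finset.mem_range.2 hn), h0, one_smul, pow_zero, one_mul,
    Nat.sub_zero, add_comm]
  intro j hj hj0
  rw [hz j (Nat.pos_of_ne_zero hj0) (Finset.mem_range.1 hj), zero_smul]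

theorem TruncPoly.exists_algHom {k : Type*} [Field k] {n : ℕ} {B : Type*} [Ring B] [Algebra k B]
    {w : B} (hw : w ^ n = 1) : ∃ f : TruncPoly k n →ₐ[k] B, f (TruncPoly.u k n) = w := by
  refine ⟨Ideal.Quotient.liftₐ _ (Polynomial.aeval w) fun p hp => ?_, Polynomial.aeval_X w⟩
  obtain ⟨r, rfl⟩ := Ideal.mem_span_singleton.1 hp
  rw [map_mul, map_sub, map_pow, Polynomial.aeval_X, hw, map_one, sub_self, zero_mul]

namespace Uq

open IsOddPrimitiveRoot DrinfeldDouble DoubleConstruction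

variable {k : Type*} [Field k] {n : ℕ} {q : k} [IsOddPrimitiveRoot n q]
  {A : Type*} [CommRing A] [Algebra k A]

/-- The relation `uⁿ = 1` is compatible with the coaction `v ↦ v ⊗ K + r 1 ⊗ X`. -/
theorem coaction_pow {ω : k} (hω : IsPrimitiveRoot ω n) {v : A} (hv : v ^ n = 1) {X : Uq n q}
    (hX : X ^ n = 0) (hKX : K n q * X = ω • (X * K n q)) (r : k) :
    (v ⊗ₜ[k] K n q + r • (1 ⊗ₜ X)) ^ n = 1 := by
  rw [add_comm, add_pow_eq_add_pow_of_zeta hω (pos n q), smul_pow,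
    Algebra.TensorProduct.tmul_pow, Algebra.TensorProduct.tmul_pow, hX, hv, K_pow,
    TensorProduct.tmul_zero, smul_zero, zero_add, Algebra.TensorProduct.one_def]
  rw [mul_smul_comm, smul_mul_assoc, Algebra.TensorProduct.tmul_mul_tmul,
    Algebra.TensorProduct.tmul_mul_tmul, hKX, TensorProduct.tmul_smul, mul_one, one_mul, smul_comm]

section Coaction

variable {κ : A →ₐ[k] A ⊗[k] Uq n q} {v : A} {X : Uq n q} {r : k}
  (hκ : κ v = v ⊗ₜ[k] K n q + r • (1 ⊗ₜ X))

include hκ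

theorem coaction_coassoc (hv : Algebra.adjoin k {v} = ⊤)
    (hX : Coalgebra.comul (R := k) X = 1 ⊗ₜ X + X ⊗ₜ K n q) (a : A) :
    TensorProduct.assoc k A _ _ (κ.toLinearMap.rTensor _ (κ a)) =
      Coalgebra.comul.lTensor A (κ a) := by
  have h : ((Algebra.TensorProduct.assoc k k k A (Uq n q) (Uq n q)).toAlgHom.comp
      (Algebra.TensorProduct.map κ (AlgHom.id k (Uq n q)))).comp κ =
      (Algebra.TensorProduct.map (AlgHom.id k A) (Bialgebra.comulAlgHom k (Uq n q))).comp κ := by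
    refine AlgHom.ext_of_adjoin_eq_top hv ?_
    rintro _ rfl
    simp only [AlgHom.comp_apply, hκ, map_add, map_smul, Algebra.TensorProduct.map_tmul,
      AlgHom.id_apply, Bialgebra.comulAlgHom_apply, comul_K, hX, map_one, TensorProduct.tmul_add,
      TensorProduct.add_tmul, smul_add, ← TensorProduct.smul_tmul']
    simp only [Algebra.TensorProduct.one_def, add_assoc]
    exact congrArg _ (add_comm _ _)
  exact AlgHom.congr_fun h a

theorem coaction_counit (hv : Algebra.adjoin k {v} = ⊤)
    (hX : Coalgebra.counit (R := k) X = 0) (a : A) :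
    contract Coalgebra.counit (κ a) = a := by
  have h : ((Algebra.TensorProduct.rid k k A).toAlgHom.comp
      (Algebra.TensorProduct.map (AlgHom.id k A) (Bialgebra.counitAlgHom k (Uq n q)))).comp κ =
      AlgHom.id k A := by
    refine AlgHom.ext_of_adjoin_eq_top hv ?_
    rintro _ rfl
    simp [hκ, counit_K, hX]
  exact AlgHom.congr_fun h a

theorem coaction_yetterDrinfeldK {φ : Uq n q →ₗ[k] Module.End k A} (hφ : IsModuleAlgebra φ) {ω : k}
    (hKv : φ (K n q) v = ω • v) (hKX : K n q * X = ω • (X * K n q)) : YetterDrinfeldK φ κ v := by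
  rw [YetterDrinfeldK, hKv, map_smul, hκ]
  simp only [map_add, map_smul, LinearMap.rTensor_tmul, hKv, hφ.K_one, mul_add, add_mul,
    mul_smul_comm, Algebra.TensorProduct.tmul_mul_tmul, one_mul, mul_one, hKX,
    TensorProduct.tmul_smul, smul_add, TensorProduct.smul_tmul']

/-- The extension to the double given by a coaction `v ↦ v ⊗ K + r 1 ⊗ X`, for a generator `v` of
`A` and a skew primitive element `X`. -/
theorem isModuleAlgebra_of_coaction {φ : Uq n q →ₗ[k] Module.End k A} (hφ : IsModuleAlgebra φ)
    (hv : Algebra.adjoin k {v} = ⊤)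
    (hX : Coalgebra.comul (R := k) X = 1 ⊗ₜ X + X ⊗ₜ K n q)
    (hX' : Coalgebra.counit (R := k) X = 0) {ω : k} (hKv : φ (K n q) v = ω • v)
    (hKX : K n q * X = ω • (X * K n q))
    (hE : YetterDrinfeldE φ κ v) (hF : YetterDrinfeldF φ κ v) :
    IsModuleAlgebra (act (antipode_bijective n q) (dualAct κ) φ) := by
  have hK := coaction_yetterDrinfeldK hκ hφ hKv hKX
  exact isModuleAlgebra_act_dualAct hφ (coaction_coassoc hκ hv hX) (coaction_counit hκ hv hX')
    (hK.forall hv hφ) (hE.forall hv hφ hK) (hF.forall hv hφ hK)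

end Coaction

end Uq

namespace UqDouble

open Uq IsOddPrimitiveRoot DrinfeldDouble DoubleConstruction TruncPoly

variable {k : Type*} [Field k] {n : ℕ} {q : k} [IsOddPrimitiveRoot n q]
  {γ δ : k} (hγδ : γ * δ = -q) {φ : Uq n q →ₗ[k] Module.End k (TruncPoly k n)}
  (hφ : IsModuleAlgebra φ) (hK : φ (Uq.K n q) (TruncPoly.u k n) = q ^ 2 • TruncPoly.u k n)
  (hF : φ (Uq.F n q) (TruncPoly.u k n) = γ • (1 : TruncPoly k n))
  (hE : φ (Uq.E n q) (TruncPoly.u k n) = δ • TruncPoly.u k n ^ 2)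

theorem isDoubleExtension_act {κ : TruncPoly k n →ₐ[k] TruncPoly k n ⊗[k] Uq n q}
    (h : IsModuleAlgebra (act (antipode_bijective n q) (dualAct κ) φ)) (hφ : IsModuleAlgebra φ) :
    IsDoubleExtension n q φ (act (antipode_bijective n q) (dualAct κ) φ) := by
  refine ⟨h, fun x => ?_⟩
  have h1 : φ 1 = 1 := LinearMap.ext hφ.one_act
  have hP : dualAct κ Coalgebra.counit = 1 := by
    have := dualPart_counit h
    rw [dualPart_apply, ofDual, act_pure, h1, mul_one] at this
    exact this
  rw [incl, ofHopf, act_pure, hP, one_mul]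

theorem coeffAct_act {κ : TruncPoly k n →ₐ[k] TruncPoly k n ⊗[k] Uq n q}
    (hφ : IsModuleAlgebra φ) (i j : Fin 2) (x : TruncPoly k n) :
    coeffAct (act (antipode_bijective n q) (dualAct κ) φ) i j x =
      contract (matrixCoeff n q i j) (κ x) := by
  rw [coeffAct, dualPart_apply, ofDual, act_pure, Module.End.mul_apply, hφ.one_act, dualAct_apply]

include hγδ hφ hK hF hE

/-- The first extension comes from the coaction `u ↦ u ⊗ K + γ (q - q⁻¹) 1 ⊗ E`. -/
theorem exists_actsByFirst : ∃ Φ, IsDoubleExtension n q φ Φ ∧ ActsByFirst n q γ Φ := by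
  have hq := ne_zero n q
  have hs := sub_inv_ne_zero n q
  have hq1 : q ^ 2 - 1 ≠ 0 := fun h => hs (by field_simp; rw [h, mul_zero])
  have hγ : γ ≠ 0 := by rintro rfl; apply hq; simpa using hγδ.symm
  have hδ : δ = -q * γ⁻¹ := by rw [eq_mul_inv_iff_mul_eq₀ hγ, mul_comm, hγδ]
  have hw := coaction_pow (k := k) (A := TruncPoly k n) (sq_prim n q) u_pow (E_pow n q)
    (K_mul_E n q) (γ * (q - q⁻¹))
  obtain ⟨κ, hκ⟩ := exists_algHom (k := k) (n := n) hw
  have hYE : YetterDrinfeldE φ κ (u k n) := by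
    rw [YetterDrinfeldE, hE, hK, map_smul, map_smul, map_pow, hκ]
    simp only [map_add, map_smul, LinearMap.rTensor_tmul, hE, hφ.E_one, mul_add, add_mul, pow_two,
      mul_smul_comm, smul_mul_assoc, Algebra.TensorProduct.tmul_mul_tmul, one_mul, mul_one,
      K_mul_E, TensorProduct.tmul_smul, smul_add, ← TensorProduct.smul_tmul',
      TensorProduct.zero_tmul, smul_zero, add_zero, smul_smul, hδ]
    match_scalars <;> field_simp <;> ring
  have hYF : YetterDrinfeldF φ κ (u k n) := by
    have hEF : E n q * F n q = F n q * E n q + (q - q⁻¹)⁻¹ • (K n q - K n q ^ (n - 1)) := by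
      rw [← E_mul_F]; abel
    rw [YetterDrinfeldF, hF, map_smul, map_one, hκ]
    simp only [map_add, map_smul, LinearMap.rTensor_tmul, K_inv_u hφ hK, hF, hφ.F_one, mul_add,
      add_mul, mul_smul_comm, smul_mul_assoc, Algebra.TensorProduct.tmul_mul_tmul, one_mul, mul_one,
      K_mul_F, hEF, TensorProduct.tmul_smul, TensorProduct.tmul_add, TensorProduct.tmul_sub,
      ← TensorProduct.smul_tmul', TensorProduct.zero_tmul]
    have hK1 : φ (K n q ^ (n - 1)) 1 = 1 := by
      conv_lhs => rw [← hφ.K_one (n := n) (q := q)]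
      exact hφ.K_inv_K 1
    rw [hK1]
    match_scalars <;> field_simp
    ring
  have hmod := isModuleAlgebra_of_coaction hκ hφ adjoin_u (comul_E n q) (counit_E n q) hK
    (K_mul_E n q) hYE hYF
  have hu : ∀ i j, coeffAct (act (antipode_bijective n q) (dualAct κ) φ) i j (u k n) =
      matrixCoeff n q i j (K n q) • u k n +
        (γ * (q - q⁻¹)) • matrixCoeff n q i j (E n q) • 1 := fun i j => by
    rw [coeffAct_act hφ, hκ, map_add, map_smul, contract_tmul, contract_tmul]
  refine ⟨_, isDoubleExtension_act hmod hφ, ⟨(hu 0 0).trans ?_, (hu 0 1).trans ?_,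
    (hu 1 0).trans ?_, (hu 1 1).trans ?_⟩⟩ <;>
  simp [matrixCoeff_apply, standardRep_K, standardRep_E]

/-- The second extension comes from the coaction `v ↦ v ⊗ K - γ⁻¹ (1 - q⁻²) 1 ⊗ F K` on
`v = u⁻¹`. -/
theorem exists_actsBySecond : ∃ Φ, IsDoubleExtension n q φ Φ ∧ ActsBySecond n q γ Φ := by
  have hq := ne_zero n q
  have hs := sub_inv_ne_zero n q
  have hq1 : q ^ 2 - 1 ≠ 0 := fun h => hs (by field_simp; rw [h, mul_zero])
  have hn := pos n q
  have hγ : γ ≠ 0 := by rintro rfl; apply hq; simpa using hγδ.symm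
  have hδ : δ = -q * γ⁻¹ := by rw [eq_mul_inv_iff_mul_eq₀ hγ, mul_comm, hγδ]
  obtain ⟨v, hv⟩ : ∃ v, v = u k n ^ (n - 1) := ⟨_, rfl⟩
  have huv : u k n * v = 1 := hv ▸ u_mul_u_pow hn
  have hvn : v ^ n = 1 := by rw [hv, ← pow_mul, mul_comm, pow_mul, u_pow, one_pow]
  have hKv : φ (K n q) v = (q ^ 2)⁻¹ • v := by
    have h := hφ.K_mul (n := n) (q := q) (u k n) v
    rw [huv, hφ.K_one, hK, smul_mul_assoc] at h
    rw [eq_inv_smul_iff₀ (pow_ne_zero 2 hq)]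
    calc q ^ 2 • φ (K n q) v = v * (q ^ 2 • (u k n * φ (K n q) v)) := by
          rw [mul_smul_comm, ← mul_assoc, mul_comm v, huv, one_mul]
      _ = v := by rw [← h, mul_one]
  have hKiv : φ (K n q ^ (n - 1)) v = q ^ 2 • v := by
    have h := hφ.K_inv_K (n := n) (q := q) v
    rw [hKv, map_smul, inv_smul_eq_iff₀ (pow_ne_zero 2 hq)] at h
    exact h
  have hEv : φ (E n q) v = -(δ * (q ^ 2)⁻¹) • 1 := by
    have h := hφ.E_mul (n := n) (q := q) (u k n) v
    rw [huv, hφ.E_one, hE, hKv, smul_mul_smul_comm, pow_two (u k n), mul_assoc, huv, mul_one] at h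
    calc φ (E n q) v = v * (u k n * φ (E n q) v) := by
          rw [← mul_assoc, mul_comm v, huv, one_mul]
      _ = v * -((δ * (q ^ 2)⁻¹) • u k n) := by rw [eq_neg_of_add_eq_zero_left h.symm]
      _ = _ := by rw [mul_neg, mul_smul_comm, mul_comm v, huv, neg_smul]
  have hFv : φ (F n q) v = -(q ^ 2 * γ) • v ^ 2 := by
    have h := hφ.F_mul (n := n) (q := q) (u k n) v
    rw [huv, hφ.F_one, hF, K_inv_u hφ hK, smul_mul_assoc, smul_mul_assoc, one_mul] at h
    calc φ (F n q) v = v * (q ^ 2 • ((q ^ 2)⁻¹ • (u k n * φ (F n q) v))) := by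
          rw [smul_inv_smul₀ (pow_ne_zero 2 hq), ← mul_assoc, mul_comm v, huv, one_mul]
      _ = v * (q ^ 2 • -(γ • v)) := by rw [eq_neg_of_add_eq_zero_left h.symm]
      _ = _ := by rw [smul_neg, mul_neg, smul_smul, mul_smul_comm, ← pow_two, neg_smul]
  have hKX : K n q * (F n q * K n q) = (q ^ 2)⁻¹ • (F n q * K n q * K n q) := by
    rw [← mul_assoc, K_mul_F, smul_mul_assoc]
  set r := -(γ⁻¹ * (q - q⁻¹) * q⁻¹) with hr
  have hw := coaction_pow (k := k) (sq_prim n q).inv hvn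
    (mul_pow_eq_zero_of_zeta (K_mul_F n q) (F_pow n q)) hKX r
  obtain ⟨κ, hκu⟩ := exists_algHom (k := k) (n := n)
    (w := (v ⊗ₜ[k] K n q + r • (1 ⊗ₜ (F n q * K n q))) ^ (n - 1))
    (by rw [← pow_mul, mul_comm, pow_mul, hw, one_pow])
  have hκ : κ v = v ⊗ₜ[k] K n q + r • (1 ⊗ₜ (F n q * K n q)) := by
    rw [hv, map_pow, hκu, ← pow_mul, ← hv]
    have hm : (n - 1) * (n - 1) = n * (n - 2) + 1 := by
      obtain ⟨m, rfl⟩ : ∃ m, n = m + 2 :=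
        ⟨n - 2, by have := three_le (n := n) (q := q); lia⟩
      simp only [Nat.add_sub_cancel, show m + 2 - 1 = m + 1 by lia]
      ring
    rw [hm, pow_succ, pow_mul, hw, one_pow, one_mul]
  have hFE : F n q * E n q = E n q * F n q - (q - q⁻¹)⁻¹ • (K n q - K n q ^ (n - 1)) := by
    rw [← E_mul_F]; abel
  have hK1 : φ (K n q ^ (n - 1)) 1 = 1 := by
    conv_lhs => rw [← hφ.K_one (n := n) (q := q)]
    exact hφ.K_inv_K 1
  have hYE : YetterDrinfeldE φ κ v := by
    have hFKE : F n q * K n q * E n q = q ^ 2 • (E n q * F n q * K n q -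
        (q - q⁻¹)⁻¹ • (K n q * K n q - 1)) := by
      rw [mul_assoc, K_mul_E, mul_smul_comm, ← mul_assoc, hFE, sub_mul, smul_mul_assoc, sub_mul,
        isUqTriple.inv_mul_K]
    rw [YetterDrinfeldE, hEv, hKv, map_smul, map_smul, map_one, hκ]
    simp only [map_add, map_smul, LinearMap.rTensor_tmul, hEv, hφ.E_one, mul_add, add_mul,
      mul_smul_comm, smul_mul_assoc, Algebra.TensorProduct.tmul_mul_tmul, one_mul, mul_one,
      K_mul_E, hFKE, TensorProduct.tmul_smul, TensorProduct.tmul_sub, smul_add, ← mul_assoc,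
      ← TensorProduct.smul_tmul', TensorProduct.zero_tmul, smul_zero, add_zero, hδ, hr,
      Algebra.TensorProduct.one_def]
    match_scalars <;> field_simp
    ring
  have hYF : YetterDrinfeldF φ κ v := by
    have hKK : K n q * K n q * K n q ^ (n - 1) = K n q := by
      rw [mul_assoc, isUqTriple.K_mul_inv, mul_one]
    have h1 : K n q * (F n q * K n q) * K n q ^ (n - 1) = (q ^ 2)⁻¹ • (F n q * K n q) := by
      rw [← mul_assoc, mul_assoc, isUqTriple.K_mul_inv, mul_one, K_mul_F]
    have h2 : F n q * K n q * K n q * K n q ^ (n - 1) = F n q * K n q := by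
      rw [mul_assoc, isUqTriple.K_mul_inv, mul_one]
    have h3 : F n q * K n q * (F n q * K n q) * K n q ^ (n - 1) =
        (q ^ 2)⁻¹ • (F n q * F n q * K n q) := by
      rw [mul_assoc, mul_assoc (F n q) (K n q) (K n q ^ (n - 1)), isUqTriple.K_mul_inv, mul_one,
        mul_assoc, K_mul_F, mul_smul_comm, mul_assoc]
    have h4 : F n q * K n q * F n q = (q ^ 2)⁻¹ • (F n q * F n q * K n q) := by
      rw [mul_assoc, K_mul_F, mul_smul_comm, mul_assoc]
    rw [YetterDrinfeldF, hFv, map_smul κ, map_pow κ, hκ]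
    simp only [map_add, map_smul, LinearMap.rTensor_tmul, hKiv, hK1, hFv, hφ.F_one, mul_add,
      add_mul, mul_smul_comm, smul_mul_assoc, Algebra.TensorProduct.tmul_mul_tmul, one_mul, mul_one,
      pow_two v, pow_two (_ + _), hKK, h1, h2, h3, h4, TensorProduct.tmul_smul, smul_add,
      ← TensorProduct.smul_tmul', TensorProduct.zero_tmul, smul_zero, add_zero, hr, K_mul_F,
      ← mul_assoc (F n q)]
    match_scalars <;> field_simp <;> ring
  have hX : Coalgebra.comul (R := k) (F n q * K n q) =
      1 ⊗ₜ (F n q * K n q) + (F n q * K n q) ⊗ₜ K n q := by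
    rw [Bialgebra.comul_mul, comul_F, comul_K, add_mul, Algebra.TensorProduct.tmul_mul_tmul,
      Algebra.TensorProduct.tmul_mul_tmul, isUqTriple.inv_mul_K, one_mul]
  have hX' : Coalgebra.counit (R := k) (F n q * K n q) = 0 := by
    rw [Bialgebra.counit_mul, counit_F, zero_mul]
  have hmod := isModuleAlgebra_of_coaction hκ hφ (hv ▸ adjoin_u_pow hn) hX hX' hKv hKX hYE hYF
  have hext := isDoubleExtension_act hmod hφ
  refine ⟨_, hext, (actsByFirst_or_actsBySecond hφ hK hγδ hF hE hext).resolve_left fun h => ?_⟩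
  -- In the first case `c` would annihilate all powers of `u`, whereas it does not annihilate `v`.
  have hc : ∀ m, coeffAct (act (antipode_bijective n q) (dualAct κ) φ) 1 0 (u k n ^ m) = 0 := by
    intro m
    induction m with
    | zero => rw [pow_zero, coeffAct_one hmod]; simp
    | succ m ih =>
      have hcu : coeffAct (act (antipode_bijective n q) (dualAct κ) φ) 1 0 (u k n) = 0 := h.c_act
      rw [pow_succ, coeffAct_mul hmod, ih, hcu, mul_zero, zero_mul, add_zero]
  have hcv := hc (n - 1)
  rw [← hv, coeffAct_act hφ, hκ, map_add, map_smul, contract_tmul, contract_tmul] at hcv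
  have hcv' : (r * q) • u k n ^ 0 = (0 : k) • u k n ^ 0 := by
    simpa [matrixCoeff_apply, standardRep_K, standardRep_F, smul_smul] using hcv
  have := smul_u_pow_injective hn 0 hcv'
  simp [hr, hq, hγ, hs] at this

end UqDouble

/-! ### Uniqueness of the extensions -/

namespace UqDouble

open TruncPoly DoubleConstruction

variable {k : Type*} [Field k] {n : ℕ} {q : k} [IsOddPrimitiveRoot n q] {γ : k}
  {φ : Uq n q →ₗ[k] Module.End k (TruncPoly k n)}
  {Φ Φ' : UqDouble n q →ₗ[k] Module.End k (TruncPoly k n)}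

theorem eq_of_actsByFirst (hΦ : IsDoubleExtension n q φ Φ) (hΦ' : IsDoubleExtension n q φ Φ')
    (h : ActsByFirst n q γ Φ) (h' : ActsByFirst n q γ Φ') : Φ = Φ' := by
  refine eq_of_coeffAct_eq hΦ.1 hΦ'.1
    (LinearMap.ext fun x => (hΦ.2 x).trans (hΦ'.2 x).symm) (v := u k n) ?_ adjoin_u
  rw [Fin.forall_fin_two, Fin.forall_fin_two, Fin.forall_fin_two]
  exact ⟨⟨h.a_act.trans h'.a_act.symm, h.b_act.trans h'.b_act.symm⟩,
    h.c_act.trans h'.c_act.symm, h.d_act.trans h'.d_act.symm⟩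

theorem eq_of_actsBySecond (hΦ : IsDoubleExtension n q φ Φ) (hΦ' : IsDoubleExtension n q φ Φ')
    (h : ActsBySecond n q γ Φ) (h' : ActsBySecond n q γ Φ') : Φ = Φ' := by
  refine eq_of_coeffAct_eq hΦ.1 hΦ'.1
    (LinearMap.ext fun x => (hΦ.2 x).trans (hΦ'.2 x).symm) (v := u k n) ?_ adjoin_u
  rw [Fin.forall_fin_two, Fin.forall_fin_two, Fin.forall_fin_two]
  exact ⟨⟨h.a_act.trans h'.a_act.symm, h.b_act.trans h'.b_act.symm⟩,
    h.c_act.trans h'.c_act.symm, h.d_act.trans h'.d_act.symm⟩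

/-- The two cases exclude each other, as `a` acts on `u` by `q` and `q⁻¹`. -/
theorem ActsByFirst.not_actsBySecond (h : ActsByFirst n q γ Φ) : ¬ ActsBySecond n q γ Φ := by
  intro h'
  have h1 : q • u k n ^ 1 = q⁻¹ • u k n ^ 1 := by
    rw [pow_one]; exact h.a_act.symm.trans h'.a_act
  exact IsOddPrimitiveRoot.sub_inv_ne_zero n q
    (sub_eq_zero.2 (smul_u_pow_injective (IsOddPrimitiveRoot.pos n q) 1 h1))

end UqDouble

end

theorem theorem5 {k : Type*} [Field k] [IsAlgClosed k] [CharZero k]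
    (n : ℕ) (q : k) [IsOddPrimitiveRoot n q]
    (γ δ : k) (hγδ : γ * δ = -q)
    (φ : Uq n q →ₗ[k] Module.End k (TruncPoly k n)) (hφ : IsModuleAlgebra φ)
    (hK : φ (Uq.K n q) (TruncPoly.u k n) = q ^ 2 • TruncPoly.u k n)
    (hF : φ (Uq.F n q) (TruncPoly.u k n) = γ • (1 : TruncPoly k n))
    (hE : φ (Uq.E n q) (TruncPoly.u k n) = δ • TruncPoly.u k n ^ 2) :
    (∀ Φ : UqDouble n q →ₗ[k] Module.End k (TruncPoly k n),
      IsDoubleExtension n q φ Φ → ActsByFirst n q γ Φ ∨ ActsBySecond n q γ Φ) ∧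
    (∃! Φ : UqDouble n q →ₗ[k] Module.End k (TruncPoly k n),
      IsDoubleExtension n q φ Φ ∧ ActsByFirst n q γ Φ) ∧
    (∃! Φ : UqDouble n q →ₗ[k] Module.End k (TruncPoly k n),
      IsDoubleExtension n q φ Φ ∧ ActsBySecond n q γ Φ) ∧
    {Φ : UqDouble n q →ₗ[k] Module.End k (TruncPoly k n) |
      IsDoubleExtension n q φ Φ}.ncard = 2 := by
  have hdich (Φ) (hΦ : IsDoubleExtension n q φ Φ) : ActsByFirst n q γ Φ ∨ ActsBySecond n q γ Φ :=
    UqDouble.actsByFirst_or_actsBySecond hφ hK hγδ hF hE hΦ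
  obtain ⟨Φ₁, hΦ₁, h₁⟩ := UqDouble.exists_actsByFirst hγδ hφ hK hF hE
  obtain ⟨Φ₂, hΦ₂, h₂⟩ := UqDouble.exists_actsBySecond hγδ hφ hK hF hE
  refine ⟨hdich, ⟨Φ₁, ⟨hΦ₁, h₁⟩, fun Φ h => UqDouble.eq_of_actsByFirst h.1 hΦ₁ h.2 h₁⟩,
    ⟨Φ₂, ⟨hΦ₂, h₂⟩, fun Φ h => UqDouble.eq_of_actsBySecond h.1 hΦ₂ h.2 h₂⟩, ?_⟩
  have hne : Φ₁ ≠ Φ₂ := by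
    rintro rfl
    exact UqDouble.ActsByFirst.not_actsBySecond h₁ h₂
  rw [← Set.ncard_pair hne]
  congr 1
  ext Φ
  simp only [Set.mem_ofPred_eq, Set.mem_insert_iff, Set.mem_singleton_iff]
  constructor
  · intro hΦ
    exact (hdich Φ hΦ).imp (fun h => UqDouble.eq_of_actsByFirst hΦ hΦ₁ h h₁)
      fun h => UqDouble.eq_of_actsBySecond hΦ hΦ₂ h h₂
  · rintro (rfl | rfl) <;> assumption
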